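/- Setting. Let $p\ge 1$, $q\ge 0$, and let $(e_t)_{t\in\mathbb Z}$ be i.i.d. with median $0$, distribution function $F$ and probability density $f$, where $F$ is continuous, and differentiable at $0$ with $F'(0)=f(0)>0$. Let $\mathcal B\subset\mathbb R^p$ be compact with non-empty interior such that $1-\beta_1z-\cdots-\beta_pz^p\ne 0$ for all $|z|\le 1$ and $\beta\in\mathcal B$. Let $w:\mathbb R^p\to(0,\infty)$ and $\varphi:\mathbb R^p\to\mathbb R^q$ be measurable, $a(x)=(x',\varphi(x)')'\in\mathbb R^m$ with $m=p+q$, and $a^*(x)=w(x)a(x)$. For a sequence $y$ put $X_{t-1}=(y_{t-1},\dots,y_{t-p})'$ and $$g_t(\beta)=\bigl\{\tfrac12-\mathbb I(y_t-X_{t-1}'\beta\le 0)\bigr\}\,a^*(X_{t-1}).$$ Alternative. Let $\theta_1\ne\theta_2$ be fixed points of $\mathrm{Int}(\mathcal B)$. For each of $\beta_0=\theta_1$ and $\beta_0=\theta_2$ suppose that there is a strictly stationary process $y_t=X_{t-1}'\beta_0+e_t$ $(t\in\mathbb Z)$, with $e_t$ independent of $(y_s)_{s<t}$, for which - $\mathbb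 E[(w(X_{t-1})+w(X_{t-1})^2)(\|a(X_{t-1})\|^2+\|a(X_{t-1})\|^3)]<\infty$; - $\mathbb E[g_t(\beta_0)g_t(\beta_0)']$ is positive definite; - for some $\gamma>2$, $\mathbb E\|a^*(X_{t-1})\|^\gamma<\infty$ and the strong mixing coefficients $\alpha_l$ of $(\mathrm{sign}(e_t)a^*(X_{t-1}))_{t\in\mathbb Z}$ satisfy $\sum_{l\ge1}\alpha_l^{1-2/\gamma}<\infty$. For each $n$ the observations $y_{1-p},\dots,y_n$ are as follows: $y_{1-p},\dots,y_0$ are taken from the stationary process with parameter $\theta_1$, $y_t=X_{t-1}'\theta_1+e_t$ for $1\le t\le k_n^*$, and $y_t=X_{t-1}'\theta_2+e_t$ for $k_n^*<t\le n$, where $k_n^*/n\to\tau$ for some $\tau\in(0,1)$. Statistic. For $0<k<n$ let $$l_{n,k}(\beta,\beta)=-\log\frac{\sup\{\prod_{i=1}^n v_i: v\in\mathcal P_{n,k}\cap\mathcal M_{n,k}(\beta,\beta)\}}{\sup\{\prod_{i=1}^n v_i: v\in\mathcal P_{n,k}\}}\in[0,\infty],$$ where $\mathcal P_{n,k}=\{v\in[0,1]^n:\sum_{i\le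 k}v_i=\sum_{j>k}v_j=1\}$, $\mathcal M_{n,k}(\beta,\beta)=\{v\in[0,1]^n:\sum_{i\le k}v_ig_i(\beta)=\sum_{j>k}v_jg_j(\beta)=0\}$, $\sup\emptyset=0$ and $-\log 0=\infty$. Put $P_{n,k}=\inf_{\beta\in\mathcal B}l_{n,k}(\beta,\beta)$ and, for fixed $0<r_1<r_2<1$, $$\tilde T_n=2\max_{r_1n\le k\le r_2n}h(k/n)\,P_{n,k},$$ where the weight function $h$ satisfies $\sup_{0<r<1}h(r)^2<\infty$ and $\inf_{r_1\le r\le r_2}h(r)>0$. Theorem. Then $\tilde T_n\to\infty$ in probability: $P(\tilde T_n\le M)\to0$ as $n\to\infty$ for every $M\in\mathbb R$. Hence the test is consistent: for every sequence of real, possibly random, critical values $c_n$ that is bounded in probability (in particular for any fixed real critical value), the test that rejects when $\tilde T_n>c_n$ satisfies $P(\tilde T_n>c_n)\to1$. -/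

import Mathlib

open MeasureTheory ProbabilityTheory Filter Topology Matrix
open scoped ENNReal

noncomputable section

namespace ARChange

/-! ### Moment functions -/

/-- The lag vector `X_{t-1} = (y_{t-1}, …, y_{t-p})` of a real sequence indexed by `ℤ`. -/
def lag (p : ℕ) (y : ℤ → ℝ) (t : ℤ) : Fin p → ℝ := fun j => y (t - 1 - (j : ℤ))

/-- The instrument `a(x) = (x', φ(x)')'`, with values in `ℝ^(p+q)` with its Euclidean norm. -/
def instr {p q : ℕ} (φ : (Fin p → ℝ) → (Fin q → ℝ)) (x : Fin p → ℝ) :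
    EuclideanSpace ℝ (Fin p ⊕ Fin q) :=
  WithLp.toLp 2 (Sum.elim x (φ x))

/-- The self-weighted instrument `a*(x) = w(x) a(x)`. -/
def wInstr {p q : ℕ} (w : (Fin p → ℝ) → ℝ) (φ : (Fin p → ℝ) → (Fin q → ℝ)) (x : Fin p → ℝ) :
    EuclideanSpace ℝ (Fin p ⊕ Fin q) :=
  w x • instr φ x

open Classical in
/-- The moment function `{1/2 - 𝟙(y_t - X_{t-1}'β ≤ 0)} a*(X_{t-1})` along a sequence `y`. -/
def moment {p q : ℕ} (w : (Fin p → ℝ) → ℝ) (φ : (Fin p → ℝ) → (Fin q → ℝ))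
    (y : ℤ → ℝ) (t : ℤ) (β : Fin p → ℝ) : EuclideanSpace ℝ (Fin p ⊕ Fin q) :=
  ((1 / 2 : ℝ) - if y t - lag p y t ⬝ᵥ β ≤ 0 then 1 else 0) • wInstr w φ (lag p y t)

/-! ### Empirical likelihood -/

/-- Weights `(v_1, …, v_n) ∈ [0,1]^n` with `∑_{i ≤ k} v_i = ∑_{k < j ≤ n} v_j = 1`
(the values of `v` outside `1, …, n` are irrelevant). -/
def weightSet (n k : ℕ) : Set (ℕ → ℝ) :=
  {v | (∀ i ∈ Finset.Icc 1 n, v i ∈ Set.Icc (0 : ℝ) 1) ∧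
    ∑ i ∈ Finset.Icc 1 k, v i = 1 ∧ ∑ j ∈ Finset.Icc (k + 1) n, v j = 1}

/-- Weights under which the moment constraints hold for `β = θ₁` on `1, …, k` and for `β = θ₂`
on `k+1, …, n`; here `G β t` is the moment function at time `t` and parameter `β`. -/
def momentSet {P E : Type*} [AddCommGroup E] [Module ℝ E] (G : P → ℕ → E) (n k : ℕ)
    (θ₁ θ₂ : P) : Set (ℕ → ℝ) :=
  {v | ∑ i ∈ Finset.Icc 1 k, v i • G θ₁ i = 0 ∧ ∑ j ∈ Finset.Icc (k + 1) n, v j • G θ₂ j = 0}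

/-- The likelihood `∏_{i ≤ k} v_i ∏_{k < j ≤ n} v_j`. -/
def likelihood (n k : ℕ) (v : ℕ → ℝ) : ℝ≥0∞ :=
  ENNReal.ofReal ((∏ i ∈ Finset.Icc 1 k, v i) * ∏ j ∈ Finset.Icc (k + 1) n, v j)

/-- The empirical likelihood `L_{n,k}(θ₁, θ₂)`; it is `0` if no weights are admissible. -/
def EL {P E : Type*} [AddCommGroup E] [Module ℝ E] (G : P → ℕ → E) (n k : ℕ)
    (θ₁ θ₂ : P) : ℝ≥0∞ :=
  ⨆ v ∈ weightSet n k ∩ momentSet G n k θ₁ θ₂, likelihood n k v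

/-- The unconstrained maximum `L_{n,k,E}` of the empirical likelihood. -/
def ELmax (n k : ℕ) : ℝ≥0∞ := ⨆ v ∈ weightSet n k, likelihood n k v

/-- `l_{n,k}(θ₁, θ₂) = - log (L_{n,k}(θ₁, θ₂) / L_{n,k,E})`, with `- log 0 = +∞`. -/
def logELR {P E : Type*} [AddCommGroup E] [Module ℝ E] (G : P → ℕ → E) (n k : ℕ)
    (θ₁ θ₂ : P) : EReal :=
  -ENNReal.log (EL G n k θ₁ θ₂ / ELmax n k)

/-- `P_{n,k} = inf_{β ∈ 𝓑} l_{n,k}(β, β)`. -/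
def profile {P E : Type*} [AddCommGroup E] [Module ℝ E] (G : P → ℕ → E) (B : Set P)
    (n k : ℕ) : EReal :=
  ⨅ β ∈ B, logELR G n k β β

/-- The trimmed and weighted statistic
`T̃_n = 2 max {h(k/n) P_{n,k} : r₁ n ≤ k ≤ r₂ n}` computed from a data sequence `y`. -/
def statT {p q : ℕ} (w : (Fin p → ℝ) → ℝ) (φ : (Fin p → ℝ) → (Fin q → ℝ))
    (B : Set (Fin p → ℝ)) (h : ℝ → ℝ) (r₁ r₂ : ℝ) (n : ℕ) (y : ℤ → ℝ) : EReal :=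
  2 * ⨆ k ∈ {k : ℕ | r₁ * n ≤ k ∧ (k : ℝ) ≤ r₂ * n},
    ((h ((k : ℝ) / n) : ℝ) : EReal) * profile (fun β (t : ℕ) => moment w φ y (t : ℤ) β) B n k

/-! ### Autoregressive processes -/

variable {Ω : Type*} [MeasurableSpace Ω]

/-- `y` is a strictly stationary AR(p) process with parameter `θ` and innovations `e`, each
innovation being independent of the past of the process. -/
structure IsStationaryAR {p : ℕ} (μ : Measure Ω) (e : ℤ → Ω → ℝ) (θ : Fin p → ℝ)
    (y : ℤ → Ω → ℝ) : Prop where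
  measurable : ∀ t, Measurable (y t)
  recursion : ∀ t, ∀ᵐ ω ∂μ, y t ω = lag p (fun s => y s ω) t ⬝ᵥ θ + e t ω
  stationary : ∀ s : ℤ,
    IdentDistrib (fun ω (t : ℤ) => y (t + s) ω) (fun ω (t : ℤ) => y t ω) μ μ
  indep_past : ∀ t, Indep (MeasurableSpace.comap (e t) inferInstance)
    (⨆ s ∈ Set.Iio t, MeasurableSpace.comap (y s) inferInstance) μ

/-- A series of length `n` with a change after time `kstar`: the initial stretch
`y_{1-p}, …, y_0` comes from the process `y₁`, and then `y_t = X_{t-1}'θ₁ + e_t` for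
`1 ≤ t ≤ kstar` and `y_t = X_{t-1}'θ₂ + e_t` for `kstar < t ≤ n`. -/
structure IsChangeSeries {p : ℕ} (μ : Measure Ω) (e : ℤ → Ω → ℝ) (θ₁ θ₂ : Fin p → ℝ)
    (y₁ : ℤ → Ω → ℝ) (n kstar : ℕ) (y : ℤ → Ω → ℝ) : Prop where
  init : ∀ t : ℤ, 1 - (p : ℤ) ≤ t → t ≤ 0 → ∀ᵐ ω ∂μ, y t ω = y₁ t ω
  before : ∀ t : ℤ, 1 ≤ t → t ≤ n → t ≤ kstar →
    ∀ᵐ ω ∂μ, y t ω = lag p (fun s => y s ω) t ⬝ᵥ θ₁ + e t ω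
  after : ∀ t : ℤ, 1 ≤ t → t ≤ n → kstar < t →
    ∀ᵐ ω ∂μ, y t ω = lag p (fun s => y s ω) t ⬝ᵥ θ₂ + e t ω

/-! ### Assumptions -/

/-- `(e_t)` is i.i.d. with median zero and probability density `f`; its distribution function
`F` is continuous, and differentiable at `0` with `F'(0) = f(0) > 0`. -/
structure Innovations (μ : Measure Ω) (e : ℤ → Ω → ℝ) (f : ℝ → ℝ) : Prop where
  measurable : ∀ t, Measurable (e t)
  indep : iIndepFun e μ
  measurable_density : Measurable f
  density_nonneg : ∀ x, 0 ≤ f x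
  law : ∀ t, μ.map (e t) = volume.withDensity (fun x => ENNReal.ofReal (f x))
  median_le : ∀ t, (1 / 2 : ℝ) ≤ μ.real {ω | e t ω ≤ 0}
  median_ge : ∀ t, (1 / 2 : ℝ) ≤ μ.real {ω | 0 ≤ e t ω}
  continuous_cdf : ∀ t, Continuous (cdf (μ.map (e t)))
  hasDerivAt_cdf : ∀ t, HasDerivAt (cdf (μ.map (e t))) (f 0) 0
  density_pos : 0 < f 0

/-- The parameter space is compact with non-empty interior, and `1 - β_1 z - ⋯ - β_p z^p ≠ 0`
for `|z| ≤ 1` and all `β` in it. -/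
structure ParameterSpace {p : ℕ} (B : Set (Fin p → ℝ)) : Prop where
  compact : IsCompact B
  interior_nonempty : (interior B).Nonempty
  stable : ∀ β ∈ B, ∀ z : ℂ, ‖z‖ ≤ 1 → 1 - ∑ j : Fin p, (β j : ℂ) * z ^ ((j : ℕ) + 1) ≠ 0

/-- Strong mixing coefficients
`α_l = sup |P(A ∩ B) - P(A) P(B)|` over `A ∈ σ(v_s : s ≤ t)`, `B ∈ σ(v_s : s ≥ t + l)`, `t ∈ ℤ`. -/
def alphaMixing {E : Type*} [MeasurableSpace E] (μ : Measure Ω) (v : ℤ → Ω → E) (l : ℕ) : ℝ :=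
  sSup {x | ∃ (t : ℤ) (A B : Set Ω),
    MeasurableSet[⨆ s ∈ Set.Iic t, MeasurableSpace.comap (v s) inferInstance] A ∧
    MeasurableSet[⨆ s ∈ Set.Ici (t + (l : ℤ)), MeasurableSpace.comap (v s) inferInstance] B ∧
    x = |μ.real (A ∩ B) - μ.real A * μ.real B|}

/-- The moment, non-degeneracy and mixing assumptions for the stationary AR(p) process `y` with
true parameter `β₀`. -/
structure MomentMixing {p q : ℕ} (μ : Measure Ω) (e : ℤ → Ω → ℝ) (w : (Fin p → ℝ) → ℝ)
    (φ : (Fin p → ℝ) → (Fin q → ℝ)) (β₀ : Fin p → ℝ) (y : ℤ → Ω → ℝ) : Prop where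
  weighted_moments : ∀ t, Integrable (fun ω =>
    (w (lag p (fun s => y s ω) t) + w (lag p (fun s => y s ω) t) ^ 2) *
      (‖instr φ (lag p (fun s => y s ω) t)‖ ^ 2 + ‖instr φ (lag p (fun s => y s ω) t)‖ ^ 3)) μ
  posDef : ∀ t, (Matrix.of fun i j : Fin p ⊕ Fin q =>
    ∫ ω, moment w φ (fun s => y s ω) t β₀ i * moment w φ (fun s => y s ω) t β₀ j ∂μ).PosDef
  mixing : ∃ γ : ℝ, 2 < γ ∧
    (∀ t, Integrable (fun ω => ‖wInstr w φ (lag p (fun s => y s ω) t)‖ ^ γ) μ) ∧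
    Summable (fun l : ℕ => alphaMixing μ
      (fun (t : ℤ) ω => Real.sign (e t ω) • wInstr w φ (lag p (fun s => y s ω) t)) (l + 1)
        ^ (1 - 2 / γ))

/-- A sequence of real random variables is bounded in probability. -/
def BoundedInProb (μ : Measure Ω) (c : ℕ → Ω → ℝ) : Prop :=
  ∀ ε : ℝ≥0∞, 0 < ε → ∃ M : ℝ, ∀ᶠ n in atTop, μ {ω | M < |c n ω|} ≤ ε

end ARChange

end

/-!
# Divergence of the empirical likelihood change statistic under a change

The profile likelihood ratio at a candidate `k` is bounded below by weak duality: if some linear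
functional of the moments has, over one of the two blocks cut at `k`, a sum of order `n` and a
square sum of order `n`, then tilting the weights by that functional divided by a multiple of `√n`
costs a likelihood factor `exp (-c √n)` (`le_logELR`). So it is enough to find one candidate at
which no single `β` makes the moments of both blocks average to nearly zero (`le_statT`).

Take `k ∼ κ n` with `r₁ < κ < r₂` and `κ` different from the change fraction `τ`. Then one block
belongs to a single regime, and there the moments at `β` average to a non-zero vector unless `β` is
the parameter of that regime (`integral_score_pos`: in the direction `θ - β` the mean is
`E [w(X) (F(X'(β - θ)) - 1/2) X'(β - θ)]`, and `(F(z) - 1/2) z > 0` for `z ≠ 0`). At that parameter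
the other block, a mixture of both regimes with positive fractions, has a non-zero mean
(`exists_block_pos`). A bound on the oscillation of the moment function over small balls and the
compactness of the parameter space make this uniform in `β` (`exists_ball_whp_le_logELR`,
`whp_le_logELR_of_isCompact`).

The probabilistic input is a weak law of large numbers for functions of lag vector and innovation,
also after the change, where the series is not stationary (`ARChain.lln_of_initial_law`). The
functions are merely measurable, so closeness of the paths is of no use, and convergence in total
variation is needed. It holds because the innovations have a density (`trans_iterate_le`): under the
root condition, common innovations bring two copies of the process close together, and once they
are close, `p` slightly shifted innovations merge them, at a cost in total variation that is the
`L¹` distance between the density and its translates. For a stationary chain this gives vanishing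
correlations, hence the law of large numbers by Chebyshev's inequality and truncation; for another
initial law the distribution of the path after finitely many steps is nearly the stationary one.
-/

namespace ARChange

/-! ### Weak duality for the empirical likelihood -/

lemma exp_sub_sq_le_one_add {x : ℝ} (hx : |x| ≤ 1 / 2) : Real.exp (x - x ^ 2) ≤ 1 + x := by
  have h := abs_le.1 hx
  have h1 : 0 < 1 + x := by linarith
  rcases le_or_gt 0 x with h0 | h0
  · rw [← Real.le_log_iff_exp_le h1]
    refine le_trans ?_ (Real.one_sub_inv_le_log_of_pos h1)
    have h3 : 1 - (1 + x)⁻¹ - (x - x ^ 2) = x ^ 3 / (1 + x) := by field_simp; ring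
    have : 0 ≤ x ^ 3 / (1 + x) := by positivity
    linarith
  · have h2 := Real.quadratic_le_exp_of_nonneg (x := -x + x ^ 2) (by nlinarith)
    have h3 : Real.exp (x - x ^ 2) = (Real.exp (-x + x ^ 2))⁻¹ := by
      rw [← Real.exp_neg]; congr 1; ring
    rw [h3]
    refine inv_le_of_inv_le₀ h1 (le_trans ?_ h2)
    rw [inv_le_iff_one_le_mul₀ h1]
    have h4 : 0 ≤ 1 + x - x ^ 2 + x ^ 3 := by
      nlinarith [mul_nonneg (neg_nonneg.2 h0.le) (sq_nonneg x)]
    nlinarith [mul_nonneg (sq_nonneg x) h4]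

/-- Weights that satisfy the tilted constraint `∑ vᵢ zᵢ = 0` have a likelihood smaller than the
maximal one by the factor `exp (-∑ (zᵢ - zᵢ²))`. -/
lemma prod_le_of_tilt {s : Finset ℕ} (hs : s.Nonempty) {v z : ℕ → ℝ} (hv : ∀ i ∈ s, 0 ≤ v i)
    (hsum : ∑ i ∈ s, v i = 1) (hz : ∑ i ∈ s, v i * z i = 0) (hz' : ∀ i ∈ s, |z i| ≤ 1 / 2) :
    ∏ i ∈ s, v i ≤ ((s.card : ℝ)⁻¹) ^ s.card * Real.exp (-∑ i ∈ s, (z i - z i ^ 2)) := by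
  have hk : (0 : ℝ) < s.card := by exact_mod_cast hs.card_pos
  have h1 : ∏ i ∈ s, ((s.card : ℝ) * (v i * Real.exp (z i - z i ^ 2))) ≤ 1 := by
    calc ∏ i ∈ s, ((s.card : ℝ) * (v i * Real.exp (z i - z i ^ 2)))
        ≤ ∏ i ∈ s, Real.exp ((s.card : ℝ) * (v i * (1 + z i)) - 1) := by
          refine Finset.prod_le_prod (fun i hi => ?_) fun i hi => ?_
          · have := hv i hi; positivity
          · have h2 := Real.add_one_le_exp ((s.card : ℝ) * (v i * (1 + z i)) - 1)
            have h3 := exp_sub_sq_le_one_add (hz' i hi)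
            have h4 : (s.card : ℝ) * (v i * Real.exp (z i - z i ^ 2))
                ≤ (s.card : ℝ) * (v i * (1 + z i)) := by
              have := hv i hi; gcongr
            linarith
      _ = 1 := by
          rw [← Real.exp_sum, Finset.sum_sub_distrib, ← Finset.mul_sum]
          simp only [mul_add, mul_one, Finset.sum_add_distrib, hsum, hz]
          simp
  rw [Finset.prod_mul_distrib, Finset.prod_mul_distrib, Finset.prod_const, ← Real.exp_sum] at h1
  rw [Real.exp_neg, inv_pow, ← mul_inv, ← one_div, le_div_iff₀ (by positivity)]
  linarith

lemma prod_le_card_inv_pow {s : Finset ℕ} (hs : s.Nonempty) {v : ℕ → ℝ} (hv : ∀ i ∈ s, 0 ≤ v i)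
    (hsum : ∑ i ∈ s, v i = 1) : ∏ i ∈ s, v i ≤ ((s.card : ℝ)⁻¹) ^ s.card := by
  simpa using prod_le_of_tilt (z := fun _ => 0) hs hv hsum (by simp) (by simp)

/-- The bound of `prod_le_of_tilt` for the tilt `zᵢ / (2 √(C n))`. The bound on the square sum
both makes this tilt at most `1/2`, so that no separate control of `max |zᵢ|` is needed, and bounds
the quadratic term. -/
lemma prod_le_of_drift {s : Finset ℕ} (hs : s.Nonempty) {v z : ℕ → ℝ} (hv : ∀ i ∈ s, 0 ≤ v i)
    (hsum : ∑ i ∈ s, v i = 1) (hz : ∑ i ∈ s, v i * z i = 0) {c C : ℝ} (hC : 0 < C) {n : ℕ}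
    (hn : 0 < n) (hc : c * n ≤ ∑ i ∈ s, z i) (hsq : ∑ i ∈ s, z i ^ 2 ≤ C * n) :
    ∏ i ∈ s, v i ≤
      ((s.card : ℝ)⁻¹) ^ s.card * Real.exp (-(c / (2 * √C) * √n - 1 / 4)) := by
  have hn' : (0 : ℝ) < n := by exact_mod_cast hn
  set r : ℝ := √(C * n) with hr
  have hr0 : 0 < r := Real.sqrt_pos.2 (by positivity)
  have hr2 : r ^ 2 = C * n := Real.sq_sqrt (by positivity)
  refine (prod_le_of_tilt (z := fun i => z i / (2 * r)) hs hv hsum ?_ ?_).trans ?_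
  · simp_rw [mul_div_assoc', ← Finset.sum_div, hz, zero_div]
  · intro i hi
    have h1 : z i ^ 2 ≤ r ^ 2 := by
      rw [hr2]
      exact (Finset.single_le_sum (f := fun i => z i ^ 2) (fun j _ => sq_nonneg _) hi).trans hsq
    have h2 : |z i| ≤ r := abs_le_of_sq_le_sq h1 hr0.le
    rw [abs_div, abs_of_pos (by positivity : 0 < 2 * r), div_le_iff₀ (by positivity)]
    linarith
  · gcongr
    rw [Finset.sum_sub_distrib, ← Finset.sum_div]
    simp_rw [div_pow]
    rw [← Finset.sum_div]
    have h3 : (∑ i ∈ s, z i ^ 2) / (2 * r) ^ 2 ≤ 1 / 4 := by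
      rw [div_le_iff₀ (by positivity), mul_pow, hr2]; linarith
    have h4 : c / (2 * √C) * √n ≤ (∑ i ∈ s, z i) / (2 * r) := by
      rw [le_div_iff₀ (by positivity), hr, Real.sqrt_mul hC.le]
      have h5 : √(n : ℝ) * √(n : ℝ) = n := Real.mul_self_sqrt hn'.le
      have h6 : 0 < √C := Real.sqrt_pos.2 hC
      calc c / (2 * √C) * √n * (2 * (√C * √n)) = c * (√n * √n) := by field_simp
        _ ≤ _ := by rw [h5]; exact hc
    linarith

lemma ELmax_ge {n k : ℕ} (hk : 0 < k) (hkn : k < n) :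
    ENNReal.ofReal (((k : ℝ)⁻¹) ^ k * (((n - k : ℕ) : ℝ)⁻¹) ^ (n - k)) ≤ ELmax n k := by
  have hk1 : (1 : ℝ) ≤ k := by exact_mod_cast hk
  have hk2 : (1 : ℝ) ≤ ((n - k : ℕ) : ℝ) := by exact_mod_cast (by omega : 1 ≤ n - k)
  set v : ℕ → ℝ := fun i => if i ≤ k then (k : ℝ)⁻¹ else ((n - k : ℕ) : ℝ)⁻¹ with hv
  have e1 : ∀ i ∈ Finset.Icc 1 k, v i = (k : ℝ)⁻¹ := fun i hi => by
    simp [hv, (Finset.mem_Icc.1 hi).2]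
  have e2 : ∀ i ∈ Finset.Icc (k + 1) n, v i = ((n - k : ℕ) : ℝ)⁻¹ := fun i hi => by
    have := (Finset.mem_Icc.1 hi).1
    simp only [hv]; rw [if_neg (by omega)]
  have c2 : (Finset.Icc (k + 1) n).card = n - k := by simp
  refine le_trans (le_of_eq ?_) (le_iSup₂ (f := fun v (_ : v ∈ weightSet n k) => likelihood n k v)
    v ⟨?_, ?_, ?_⟩)
  · rw [likelihood, Finset.prod_congr rfl e1, Finset.prod_congr rfl e2]
    simp
  · intro i _
    simp only [hv]
    split_ifs
    · exact ⟨by positivity, inv_le_one_of_one_le₀ hk1⟩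
    · exact ⟨by positivity, inv_le_one_of_one_le₀ hk2⟩
  · rw [Finset.sum_congr rfl e1]; simp; field_simp
  · rw [Finset.sum_congr rfl e2, Finset.sum_const, c2]; simp; field_simp

/-- If on one of the two blocks some linear functional of the moments has sum at least `c n` and
square sum at most `C n`, then the log-likelihood ratio is at least of order `√n`. -/
lemma le_logELR {P E : Type*} [AddCommGroup E] [Module ℝ E] {G : P → ℕ → E} {β : P} {n k : ℕ}
    (hk : 0 < k) (hkn : k < n) {c C : ℝ} (hC : 0 < C) (L : E →ₗ[ℝ] ℝ) {s : Finset ℕ}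
    (hs : s = Finset.Icc 1 k ∨ s = Finset.Icc (k + 1) n)
    (hc : c * n ≤ ∑ i ∈ s, L (G β i)) (hsq : ∑ i ∈ s, L (G β i) ^ 2 ≤ C * n) :
    ((c / (2 * √C) * √n - 1 / 4 : ℝ) : EReal) ≤ logELR G n k β β := by
  set R : ℝ := c / (2 * √C) * √n - 1 / 4 with hR
  have hn : 0 < n := by omega
  have hk1 : (0 : ℝ) < k := by exact_mod_cast hk
  have hk2 : (0 : ℝ) < ((n - k : ℕ) : ℝ) := by exact_mod_cast (by omega : 0 < n - k)
  have c1 : (Finset.Icc 1 k).card = k := by simp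
  have c2 : (Finset.Icc (k + 1) n).card = n - k := by simp
  have n1 : (Finset.Icc 1 k).Nonempty := Finset.card_pos.1 (by omega)
  have n2 : (Finset.Icc (k + 1) n).Nonempty := Finset.card_pos.1 (by omega)
  set K : ℝ := ((k : ℝ)⁻¹) ^ k * (((n - k : ℕ) : ℝ)⁻¹) ^ (n - k) with hK
  have hK0 : 0 < K := by positivity
  have hEL : EL G n k β β ≤ ENNReal.ofReal K * ENNReal.ofReal (Real.exp (-R)) := by
    rw [← ENNReal.ofReal_mul hK0.le]
    refine iSup₂_le fun v hv => ENNReal.ofReal_le_ofReal ?_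
    obtain ⟨⟨hv1, hv2, hv3⟩, hv4, hv5⟩ := hv
    have p1 : ∀ i ∈ Finset.Icc 1 k, 0 ≤ v i := fun i hi =>
      (hv1 i (Finset.mem_Icc.2 ⟨(Finset.mem_Icc.1 hi).1, by
        have := (Finset.mem_Icc.1 hi).2; omega⟩)).1
    have p2 : ∀ i ∈ Finset.Icc (k + 1) n, 0 ≤ v i := fun i hi =>
      (hv1 i (Finset.mem_Icc.2 ⟨by have := (Finset.mem_Icc.1 hi).1; omega,
        (Finset.mem_Icc.1 hi).2⟩)).1
    have z1 := congrArg L hv4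
    have z2 := congrArg L hv5
    simp only [map_sum, map_smul, smul_eq_mul, map_zero] at z1 z2
    have q1 := prod_le_card_inv_pow n1 p1 hv2
    have q2 := prod_le_card_inv_pow n2 p2 hv3
    rw [c1] at q1
    rw [c2] at q2
    rcases hs with rfl | rfl
    · have q3 := prod_le_of_drift n1 p1 hv2 z1 hC hn hc hsq
      rw [c1, ← hR] at q3
      calc _ ≤ (((k : ℝ)⁻¹) ^ k * Real.exp (-R)) * (((n - k : ℕ) : ℝ)⁻¹) ^ (n - k) :=
            mul_le_mul q3 q2 (Finset.prod_nonneg p2) (by positivity)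
        _ = _ := by rw [hK]; ring
    · have q3 := prod_le_of_drift n2 p2 hv3 z2 hC hn hc hsq
      rw [c2, ← hR] at q3
      calc _ ≤ ((k : ℝ)⁻¹) ^ k * ((((n - k : ℕ) : ℝ)⁻¹) ^ (n - k) * Real.exp (-R)) :=
            mul_le_mul q1 q3 (Finset.prod_nonneg p2) (by positivity)
        _ = _ := by rw [hK]; ring
  have hratio : EL G n k β β / ELmax n k ≤ ENNReal.ofReal (Real.exp (-R)) := by
    refine ENNReal.div_le_of_le_mul (hEL.trans ?_)
    rw [mul_comm]
    gcongr
    exact ELmax_ge hk hkn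
  rw [logELR, EReal.le_neg]
  refine (ENNReal.log_monotone hratio).trans ?_
  rw [ENNReal.log_ofReal_of_pos (Real.exp_pos _), Real.log_exp]
  simp

/-- A lower bound for the statistic from a single candidate `k` of the trimmed range. -/
lemma le_statT {p q : ℕ} {w : (Fin p → ℝ) → ℝ} {φ : (Fin p → ℝ) → (Fin q → ℝ)}
    {B : Set (Fin p → ℝ)} {h : ℝ → ℝ} {r₁ r₂ : ℝ} {n k : ℕ} {y : ℤ → ℝ}
    (h1 : r₁ * n ≤ k) (h2 : (k : ℝ) ≤ r₂ * n) {a R : ℝ} (ha : 0 ≤ a) (hR : 0 ≤ R)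
    (hh : a ≤ h ((k : ℝ) / n))
    (hP : ∀ β ∈ B, (R : EReal) ≤ logELR (fun β (t : ℕ) => moment w φ y (t : ℤ) β) n k β β) :
    ((2 * (a * R) : ℝ) : EReal) ≤ statT w φ B h r₁ r₂ n y := by
  have h3 : (R : EReal) ≤ profile (fun β (t : ℕ) => moment w φ y (t : ℤ) β) B n k :=
    le_iInf₂ hP
  have h4 : ((a * R : ℝ) : EReal) ≤ ((h ((k : ℝ) / n) : ℝ) : EReal) *
      profile (fun β (t : ℕ) => moment w φ y (t : ℤ) β) B n k := by
    rw [EReal.coe_mul]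
    exact mul_le_mul (by exact_mod_cast hh) h3 (by exact_mod_cast hR)
      (by exact_mod_cast ha.trans hh)
  rw [EReal.coe_mul, statT]
  refine mul_le_mul le_rfl (h4.trans ?_) (by exact_mod_cast (mul_nonneg ha hR)) (by norm_num)
  exact le_iSup₂ (f := fun k (_ : k ∈ {k : ℕ | r₁ * n ≤ k ∧ (k : ℝ) ≤ r₂ * n}) =>
    ((h ((k : ℝ) / n) : ℝ) : EReal) * profile (fun β (t : ℕ) => moment w φ y (t : ℤ) β) B n k)
    k ⟨h1, h2⟩

/-! ### The state recursion and its stability -/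

/-- The next lag vector `(x'θ + u, x_1, …, x_{p-1})` after the lag vector `x` and the
innovation `u`. With `u = 0` it is the companion map of `θ`. -/
def step {R : Type*} [CommSemiring R] {p : ℕ} (θ x : Fin p → R) (u : R) : Fin p → R := fun j =>
  if (j : ℕ) = 0 then x ⬝ᵥ θ + u else x ⟨(j : ℕ) - 1, by have := j.2; omega⟩

lemma step_sub {p : ℕ} (θ x x' : Fin p → ℝ) (u u' : ℝ) :
    step θ x u - step θ x' u' = step θ (x - x') (u - u') := by
  funext j
  simp only [step, Pi.sub_apply, sub_dotProduct]
  split_ifs <;> ring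

/-- The companion map as a linear map. -/
def compMap {p : ℕ} (θ : Fin p → ℂ) : (Fin p → ℂ) →ₗ[ℂ] (Fin p → ℂ) where
  toFun x := step θ x 0
  map_add' x y := by
    funext j; simp only [step, Pi.add_apply, add_dotProduct]; split_ifs <;> ring
  map_smul' c x := by
    funext j; simp only [step, Pi.smul_apply, smul_dotProduct, RingHom.id_apply]
    split_ifs <;> simp

/-- An eigenvector for `c ≠ 0` is a multiple of `(1, c⁻¹, …, c^(1-p))`, and its first coordinate
shows that `c⁻¹` is a root of the autoregressive polynomial. -/
lemma norm_lt_one_of_hasEigenvalue {p : ℕ} {θ : Fin p → ℂ}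
    (h : ∀ z : ℂ, ‖z‖ ≤ 1 → 1 - ∑ j : Fin p, θ j * z ^ ((j : ℕ) + 1) ≠ 0) {c : ℂ}
    (hc : Module.End.HasEigenvalue (compMap θ) c) : ‖c‖ < 1 := by
  by_contra! hc1
  obtain ⟨v, hv⟩ := hc.exists_hasEigenvector
  have hv0 : v ≠ 0 := hv.2
  have hv1 : compMap θ v = c • v := hv.apply_eq_smul
  have hc0 : c ≠ 0 := by rintro rfl; simp at hc1; linarith
  have hp : 0 < p := by
    rcases Nat.eq_zero_or_pos p with rfl | hp
    · exact absurd (Subsingleton.elim v 0) hv0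
    · exact hp
  have key : ∀ j : ℕ, ∀ hj : j < p, v ⟨j, hj⟩ = (c⁻¹) ^ j * v ⟨0, hp⟩ := by
    intro j
    induction j with
    | zero => intro _; simp
    | succ j ih =>
      intro hj
      have h1 := congrFun hv1 ⟨j + 1, hj⟩
      simp only [compMap, LinearMap.coe_mk, AddHom.coe_mk, step, Nat.succ_ne_zero, if_false,
        Nat.add_sub_cancel, Pi.smul_apply, smul_eq_mul] at h1
      rw [ih (by omega)] at h1
      rw [pow_succ, mul_right_comm, h1, mul_comm, inv_mul_cancel_left₀ hc0]
  have h00 : v ⟨0, hp⟩ ≠ 0 := by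
    intro h0
    apply hv0
    funext j
    rw [show j = ⟨(j : ℕ), j.2⟩ from rfl, key, h0]
    simp
  have h2 := congrFun hv1 ⟨0, hp⟩
  simp only [compMap, LinearMap.coe_mk, AddHom.coe_mk, step, if_true, add_zero, Pi.smul_apply,
    smul_eq_mul, dotProduct] at h2
  refine h c⁻¹ (by rw [norm_inv]; exact inv_le_one_of_one_le₀ hc1) ?_
  have h3 : ∑ j : Fin p, v j * θ j = (∑ j : Fin p, θ j * (c⁻¹) ^ (j : ℕ)) * v ⟨0, hp⟩ := by
    rw [Finset.sum_mul]
    refine Finset.sum_congr rfl fun j _ => ?_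
    rw [show v j = v ⟨(j : ℕ), j.2⟩ from rfl, key]
    ring
  rw [h3] at h2
  have h4 := mul_right_cancel₀ h00 h2
  simp_rw [pow_succ, ← mul_assoc]
  rw [← Finset.sum_mul, h4, mul_inv_cancel₀ hc0, sub_self]

lemma tendsto_pow_zero_of_spectralRadius_lt_one {A : Type*} [NormedRing A] [NormedAlgebra ℂ A]
    [CompleteSpace A] {a : A} (h : spectralRadius ℂ a < 1) :
    Tendsto (fun n : ℕ => a ^ n) atTop (𝓝 0) := by
  obtain ⟨r, h1, h2⟩ := exists_between h
  have h3 := (spectrum.pow_norm_pow_one_div_tendsto_nhds_spectralRadius a).eventually_lt_const h1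
  have hr : r ≠ ∞ := (h2.trans ENNReal.one_lt_top).ne
  rw [tendsto_zero_iff_norm_tendsto_zero]
  refine squeeze_zero' (Eventually.of_forall fun _ => norm_nonneg _) ?_
    (tendsto_pow_atTop_nhds_zero_of_lt_one (r := r.toReal) ENNReal.toReal_nonneg ?_)
  · filter_upwards [h3, eventually_gt_atTop 0] with n hn hn0
    have h4 : ‖a ^ n‖ ^ (1 / n : ℝ) ≤ r.toReal := by
      rw [← ENNReal.ofReal_le_iff_le_toReal hr]; exact hn.le
    have h5 := Real.rpow_le_rpow (by positivity) h4 (Nat.cast_nonneg n)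
    rw [← Real.rpow_mul (norm_nonneg _), one_div, inv_mul_cancel₀ (by positivity), Real.rpow_one,
      Real.rpow_natCast] at h5
    exact h5
  · rw [← ENNReal.toReal_one]
    exact (ENNReal.toReal_lt_toReal hr ENNReal.one_ne_top).2 h2

/-- Under the root condition the powers of the companion map tend to zero. -/
lemma tendsto_iterate_step {p : ℕ} {θ : Fin p → ℝ}
    (h : ∀ z : ℂ, ‖z‖ ≤ 1 → 1 - ∑ j : Fin p, (θ j : ℂ) * z ^ ((j : ℕ) + 1) ≠ 0)
    (d : Fin p → ℝ) :
    Tendsto (fun m : ℕ => (fun x => step θ x 0)^[m] d) atTop (𝓝 0) := by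
  rcases Nat.eq_zero_or_pos p with rfl | hp
  · have : (fun m : ℕ => (fun x => step θ x 0)^[m] d) = fun _ => 0 := by
      funext m; exact Subsingleton.elim _ _
    rw [this]
    exact tendsto_const_nhds
  have : Nonempty (Fin p) := ⟨⟨0, hp⟩⟩
  set θc : Fin p → ℂ := fun j => (θ j : ℂ) with hθc
  set T : (Fin p → ℂ) →L[ℂ] (Fin p → ℂ) := LinearMap.toContinuousLinearMap (compMap θc) with hT
  have hrad : spectralRadius ℂ T < 1 := by
    refine spectrum.spectralRadius_lt_of_forall_lt (r := 1) T fun c hc => ?_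
    rw [← NNReal.coe_lt_coe, coe_nnnorm, NNReal.coe_one]
    rcases eq_or_ne c 0 with rfl | hc0
    · simp
    have hcomp : IsCompactOperator T :=
      isCompactOperator_of_locallyCompactSpace_dom T
    have := (hcomp.hasEigenvalue_iff_mem_spectrum hc0).2 hc
    exact norm_lt_one_of_hasEigenvalue (θ := θc) h this
  have h1 := tendsto_pow_zero_of_spectralRadius_lt_one hrad
  have h2 : ∀ m : ℕ, (T ^ m) (fun j => (d j : ℂ)) =
      fun j => (((fun x => step θ x 0)^[m] d j : ℝ) : ℂ) := by
    intro m
    induction m with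
    | zero => simp
    | succ m ih =>
      rw [pow_succ', mul_apply_eq_comp, ih, Function.iterate_succ_apply']
      funext j
      change step θc (fun j => (((fun x => step θ x 0)^[m] d j : ℝ) : ℂ)) 0 j =
        ((step θ ((fun x => step θ x 0)^[m] d) 0 j : ℝ) : ℂ)
      simp only [step, dotProduct]
      split_ifs <;> simp [hθc]
  have h3 : Tendsto (fun m : ℕ => (T ^ m) (fun j => (d j : ℂ))) atTop (𝓝 0) := by
    have := ((ContinuousLinearMap.apply ℂ (Fin p → ℂ) (fun j => (d j : ℂ))).continuous.tendsto
      0).comp h1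
    rw [map_zero] at this
    exact this
  rw [tendsto_pi_nhds] at h3 ⊢
  intro j
  have h4 := (Complex.continuous_re.tendsto _).comp (h3 j)
  refine h4.congr fun m => ?_
  rw [Function.comp_apply, h2 m, Complex.ofReal_re]

/-! ### Contraction in total variation of the autoregressive transition operator -/

section

/-- The `L¹` distance between a density and its translate. -/
noncomputable def shiftDist (f : ℝ → ℝ) (z : ℝ) : ℝ≥0∞ := ∫⁻ u, ‖f (u + z) - f u‖ₑ

lemma measurable_shiftDist {f : ℝ → ℝ} (hf : Measurable f) : Measurable (shiftDist f) := by
  unfold shiftDist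
  refine Measurable.lintegral_prod_right' (f := fun q : ℝ × ℝ => ‖f (q.2 + q.1) - f q.2‖ₑ) ?_
  fun_prop

lemma shiftDist_le {f : ℝ → ℝ} (hf : Measurable f) (z : ℝ) :
    shiftDist f z ≤ 2 * ∫⁻ u, ‖f u‖ₑ := by
  calc shiftDist f z ≤ ∫⁻ u, (‖f (u + z)‖ₑ + ‖f u‖ₑ) := lintegral_mono fun u => enorm_sub_le
    _ = (∫⁻ u, ‖f (u + z)‖ₑ) + ∫⁻ u, ‖f u‖ₑ := lintegral_add_right _ hf.enorm
    _ = _ := by rw [lintegral_add_right_eq_self (fun u => ‖f u‖ₑ) z, two_mul]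

/-- Translation is continuous in `L¹`. -/
lemma tendsto_shiftDist {f : ℝ → ℝ} (hf : Integrable f) :
    Tendsto (shiftDist f) (𝓝 0) (𝓝 0) := by
  have hm : MemLp f 1 volume := memLp_one_iff_integrable.2 hf
  let g : ℝ → C(ℝ, ℝ) := fun z => ⟨fun u => u + z, by fun_prop⟩
  have hg : Tendsto g (𝓝 0) (𝓝 (g 0)) := by
    let G : C(ℝ × ℝ, ℝ) := ⟨fun q => q.2 + q.1, by fun_prop⟩
    exact G.curry.continuous.tendsto 0
  have hgm : ∀ z, MeasurePreserving (g z) volume volume := fun z =>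
    measurePreserving_add_right volume z
  have h1 := Filter.Tendsto.compMeasurePreservingLp (f := fun _ : ℝ => hm.toLp f)
    tendsto_const_nhds hg hgm (hgm 0) ENNReal.one_ne_top
  rw [EMetric.tendsto_nhds] at h1
  rw [ENNReal.tendsto_nhds_zero]
  intro ε hε
  filter_upwards [h1 ε hε] with z hz
  rw [Lp.toLp_compMeasurePreserving, Lp.toLp_compMeasurePreserving, Lp.edist_toLp_toLp,
    eLpNorm_one_eq_lintegral_enorm] at hz
  refine (le_of_eq ?_).trans hz.le
  simp [shiftDist, g]

variable {p : ℕ}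

/-- The transition operator `(T V)(x) = E V(x'θ + u, x_1, …, x_{p-1})`, `u ∼ ε`. -/
noncomputable def trans (ε : Measure ℝ) (θ : Fin p → ℝ) (V : (Fin p → ℝ) → ℝ≥0∞)
    (x : Fin p → ℝ) : ℝ≥0∞ :=
  ∫⁻ u, V (step θ x u) ∂ε

lemma measurable_step (θ : Fin p → ℝ) :
    Measurable fun q : (Fin p → ℝ) × ℝ => step θ q.1 q.2 := by
  refine measurable_pi_lambda _ fun j => ?_
  by_cases h : (j : ℕ) = 0
  · simp only [step, h, if_true, dotProduct]
    fun_prop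
  · simp only [step, h, if_false]
    fun_prop

lemma measurable_trans {ε : Measure ℝ} [SFinite ε] {θ : Fin p → ℝ} {V : (Fin p → ℝ) → ℝ≥0∞}
    (hV : Measurable V) : Measurable (trans ε θ V) :=
  Measurable.lintegral_prod_right' (f := fun q : (Fin p → ℝ) × ℝ => V (step θ q.1 q.2))
    (hV.comp (measurable_step θ))

lemma measurable_trans_iterate {ε : Measure ℝ} [SFinite ε] {θ : Fin p → ℝ}
    {V : (Fin p → ℝ) → ℝ≥0∞} (hV : Measurable V) (m : ℕ) :
    Measurable ((trans ε θ)^[m] V) := by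
  induction m with
  | zero => exact hV
  | succ m ih => rw [Function.iterate_succ_apply']; exact measurable_trans ih

lemma trans_le_one {ε : Measure ℝ} [IsProbabilityMeasure ε] {θ : Fin p → ℝ}
    {V : (Fin p → ℝ) → ℝ≥0∞} (hV : ∀ x, V x ≤ 1) (x : Fin p → ℝ) : trans ε θ V x ≤ 1 := by
  calc trans ε θ V x ≤ ∫⁻ _, 1 ∂ε := lintegral_mono fun u => hV _
    _ = 1 := by simp

lemma trans_iterate_le_one {ε : Measure ℝ} [IsProbabilityMeasure ε] {θ : Fin p → ℝ}
    {V : (Fin p → ℝ) → ℝ≥0∞} (hV : ∀ x, V x ≤ 1) (m : ℕ) (x : Fin p → ℝ) :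
    (trans ε θ)^[m] V x ≤ 1 := by
  induction m generalizing x with
  | zero => exact hV x
  | succ m ih => rw [Function.iterate_succ_apply']; exact trans_le_one ih x

lemma lintegral_le_lintegral_shift {f : ℝ → ℝ} (hf : Measurable f) (hf0 : ∀ x, 0 ≤ f x)
    {V : ℝ → ℝ≥0∞} (hV : Measurable V) (hV1 : ∀ u, V u ≤ 1) (z : ℝ) :
    ∫⁻ u, V u ∂(volume.withDensity fun x => ENNReal.ofReal (f x)) ≤
      ∫⁻ u, V (u + z) ∂(volume.withDensity fun x => ENNReal.ofReal (f x)) + shiftDist f z := by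
  have hfm : Measurable fun x => ENNReal.ofReal (f x) := hf.ennreal_ofReal
  rw [lintegral_withDensity_eq_lintegral_mul _ hfm hV,
    lintegral_withDensity_eq_lintegral_mul _ hfm (g := fun u => V (u + z))
      (hV.comp (measurable_add_const z)),
    ← lintegral_add_right_eq_self (fun u => ((fun x => ENNReal.ofReal (f x)) * V) u) z,
    shiftDist, ← lintegral_add_right _ (by fun_prop)]
  refine lintegral_mono fun u => ?_
  simp only [Pi.mul_apply]
  have h1 : ENNReal.ofReal (f (u + z)) ≤ ENNReal.ofReal (f u) + ‖f (u + z) - f u‖ₑ := by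
    rw [Real.enorm_eq_ofReal_abs, ← ENNReal.ofReal_add (hf0 u) (abs_nonneg _)]
    exact ENNReal.ofReal_le_ofReal (by linarith [le_abs_self (f (u + z) - f u)])
  calc ENNReal.ofReal (f (u + z)) * V (u + z)
      ≤ (ENNReal.ofReal (f u) + ‖f (u + z) - f u‖ₑ) * V (u + z) := by gcongr
    _ ≤ ENNReal.ofReal (f u) * V (u + z) + ‖f (u + z) - f u‖ₑ := by
        rw [add_mul]
        gcongr
        exact mul_le_of_le_one_right zero_le (hV1 _)

/-- Bound for the total variation distance after `k` steps between two copies of the process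
whose lag vectors differ by `d`, when `d` vanishes except for its last `k` coordinates: in each
step the innovation of one copy is shifted so that the new observations coincide. -/
noncomputable def mergeBound (f : ℝ → ℝ) (θ : Fin p → ℝ) : ℕ → (Fin p → ℝ) → ℝ≥0∞
  | 0, _ => 0
  | k + 1, d => shiftDist f (-(d ⬝ᵥ θ)) + mergeBound f θ k (step 0 d 0)

lemma measurable_mergeBound {f : ℝ → ℝ} (hf : Measurable f) (θ : Fin p → ℝ) (k : ℕ) :
    Measurable (mergeBound f θ k) := by
  induction k with
  | zero => exact measurable_const
  | succ k ih =>
    refine Measurable.add ?_ (ih.comp ?_)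
    · refine (measurable_shiftDist hf).comp (Measurable.neg ?_)
      simp only [dotProduct]
      fun_prop
    · exact (measurable_step (0 : Fin p → ℝ)).comp (measurable_id.prodMk measurable_const)

lemma mergeBound_le {f : ℝ → ℝ} (hf : Measurable f) (hf1 : ∫⁻ u, ‖f u‖ₑ = 1) (θ : Fin p → ℝ)
    (k : ℕ) (d : Fin p → ℝ) : mergeBound f θ k d ≤ 2 * k := by
  induction k generalizing d with
  | zero => simp [mergeBound]
  | succ k ih =>
    have h1 := shiftDist_le hf (-(d ⬝ᵥ θ))
    rw [hf1, mul_one] at h1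
    rw [mergeBound, Nat.cast_succ, mul_add, mul_one, add_comm]
    exact add_le_add (ih _) h1

lemma continuous_step_zero (θ : Fin p → ℝ) : Continuous fun d : Fin p → ℝ => step θ d 0 := by
  refine continuous_pi fun j => ?_
  by_cases h : (j : ℕ) = 0
  · simp only [step, h, if_true, dotProduct]
    fun_prop
  · simp only [step, h, if_false]
    fun_prop

lemma step_zero_zero (θ : Fin p → ℝ) : step θ (0 : Fin p → ℝ) 0 = 0 := by
  funext j; simp [step]

lemma tendsto_mergeBound {f : ℝ → ℝ} (hf : Integrable f) (θ : Fin p → ℝ) (k : ℕ) :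
    Tendsto (mergeBound f θ k) (𝓝 0) (𝓝 0) := by
  induction k with
  | zero => exact tendsto_const_nhds
  | succ k ih =>
    have h1 : Tendsto (fun d : Fin p → ℝ => -(d ⬝ᵥ θ)) (𝓝 0) (𝓝 0) := by
      have : Continuous fun d : Fin p → ℝ => -(d ⬝ᵥ θ) := by
        simp only [dotProduct]; fun_prop
      simpa using this.tendsto 0
    have h2 : Tendsto (fun d : Fin p → ℝ => step 0 d 0) (𝓝 0) (𝓝 0) := by
      simpa [step_zero_zero] using (continuous_step_zero (0 : Fin p → ℝ)).tendsto 0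
    have h3 := ((tendsto_shiftDist hf).comp h1).add (ih.comp h2)
    rw [add_zero] at h3
    exact h3

variable {f : ℝ → ℝ} {ε : Measure ℝ} [IsProbabilityMeasure ε] {θ : Fin p → ℝ}

lemma trans_iterate_le_of_agree (hf : Measurable f) (hf0 : ∀ x, 0 ≤ f x)
    (hε : ε = volume.withDensity fun x => ENNReal.ofReal (f x))
    {V : (Fin p → ℝ) → ℝ≥0∞} (hV : Measurable V) (hV1 : ∀ x, V x ≤ 1) (k : ℕ)
    (x x' : Fin p → ℝ) (hxx : ∀ j : Fin p, (j : ℕ) + k < p → x j = x' j) :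
    (trans ε θ)^[k] V x ≤ (trans ε θ)^[k] V x' + mergeBound f θ k (x - x') := by
  induction k generalizing x x' with
  | zero =>
    have : x = x' := funext fun j => hxx j (by simp)
    simp [this]
  | succ k ih =>
    rw [Function.iterate_succ_apply']
    set W := (trans ε θ)^[k] V with hW
    have hWm : Measurable W := measurable_trans_iterate hV k
    have hW1 : ∀ x, W x ≤ 1 := trans_iterate_le_one hV1 k
    -- the shift that makes the new observations of the two copies equal
    set z : ℝ := -((x - x') ⬝ᵥ θ) with hz
    have h1 : trans ε θ W x ≤ ∫⁻ u, W (step θ x (u + z)) ∂ε + shiftDist f z := by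
      subst hε
      exact lintegral_le_lintegral_shift (V := fun u => W (step θ x u)) hf hf0
        (hWm.comp ((measurable_step θ).comp measurable_prodMk_left)) (fun u => hW1 _) z
    have h2 : ∫⁻ u, W (step θ x (u + z)) ∂ε ≤
        ∫⁻ u, (W (step θ x' u) + mergeBound f θ k (step 0 (x - x') 0)) ∂ε := by
      refine lintegral_mono fun u => ?_
      have h3 : step θ x (u + z) - step θ x' u = step 0 (x - x') 0 := by
        rw [step_sub]
        funext j
        simp only [step]
        split_ifs
        · simp [hz]
        · rfl
      rw [← h3]
      refine ih _ _ fun j hj => ?_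
      simp only [step]
      split_ifs with h0
      · rw [hz, sub_dotProduct]; ring
      · exact hxx _ (by simp only; omega)
    rw [lintegral_add_right _ measurable_const, lintegral_const, measure_univ, mul_one] at h2
    calc trans ε θ W x ≤ _ := h1
      _ ≤ (∫⁻ u, W (step θ x' u) ∂ε + mergeBound f θ k (step 0 (x - x') 0)) + shiftDist f z := by
          gcongr
      _ = _ := by rw [mergeBound, trans, add_assoc, add_comm (mergeBound f θ k _)]

/-- Two copies of the process started from different lag vectors are close in total variation
after `m + p` steps: `m` steps with common innovations shrink the difference by the companion map,
and `p` steps with shifted innovations merge the copies. -/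
lemma trans_iterate_le (hf : Measurable f) (hf0 : ∀ x, 0 ≤ f x)
    (hε : ε = volume.withDensity fun x => ENNReal.ofReal (f x))
    {V : (Fin p → ℝ) → ℝ≥0∞} (hV : Measurable V) (hV1 : ∀ x, V x ≤ 1) (m : ℕ)
    (x x' : Fin p → ℝ) :
    (trans ε θ)^[m + p] V x ≤
      (trans ε θ)^[m + p] V x' + mergeBound f θ p ((fun d => step θ d 0)^[m] (x - x')) := by
  induction m generalizing x x' with
  | zero =>
    rw [zero_add]
    exact trans_iterate_le_of_agree hf hf0 hε hV hV1 p x x' fun j hj => by omega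
  | succ m ih =>
    rw [Nat.succ_add, Function.iterate_succ_apply']
    set W := (trans ε θ)^[m + p] V with hW
    have h2 : trans ε θ W x ≤ ∫⁻ u, (W (step θ x' u) +
        mergeBound f θ p ((fun d => step θ d 0)^[m + 1] (x - x'))) ∂ε := by
      refine lintegral_mono fun u => ?_
      have h3 := ih (step θ x u) (step θ x' u)
      rwa [step_sub, sub_self, ← Function.iterate_succ_apply (fun d => step θ d 0)] at h3
    rwa [lintegral_add_right _ measurable_const, lintegral_const, measure_univ, mul_one] at h2

end

/-! ### Autoregressive chains -/

section

variable {Ω : Type*} [mΩ : MeasurableSpace Ω] {p : ℕ}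

/-- Lag vectors `X 0, X 1, …` driven by innovations `u 0, u 1, …` of law `ε` through
`X (i + 1) = step θ (X i) (u i)`, where `u i` is independent of the past `𝓕 i`. The law of `X 0`
is arbitrary. -/
structure ARChain (μ : Measure Ω) (ε : Measure ℝ) (θ : Fin p → ℝ) (𝓕 : ℕ → MeasurableSpace Ω)
    (X : ℕ → Ω → Fin p → ℝ) (u : ℕ → Ω → ℝ) : Prop where
  le : ∀ i, 𝓕 i ≤ mΩ
  mono : Monotone 𝓕
  adapted_zero : Measurable[𝓕 0] (X 0)
  adapted_innov : ∀ i, Measurable[𝓕 (i + 1)] (u i)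
  law : ∀ i, μ.map (u i) = ε
  indep : ∀ i, Indep (𝓕 i) (MeasurableSpace.comap (u i) inferInstance) μ
  step_eq : ∀ i ω, X (i + 1) ω = step θ (X i ω) (u i ω)

/-- Partial sums of a function of the lag vector and the innovation, from time `a` on. -/
def psum (H : (Fin p → ℝ) × ℝ → ℝ) (X : ℕ → Ω → Fin p → ℝ) (u : ℕ → Ω → ℝ) (a N : ℕ) (ω : Ω) :
    ℝ :=
  ∑ i ∈ Finset.range N, H (X (a + i) ω, u (a + i) ω)

/-- The probability that `r` plus the partial sum of length `N` of the chain started at `x` lies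
in `D`. -/
noncomputable def pathProb (ε : Measure ℝ) (θ : Fin p → ℝ) (H : (Fin p → ℝ) × ℝ → ℝ) (D : Set ℝ) :
    ℕ → (Fin p → ℝ) × ℝ → ℝ≥0∞
  | 0, q => D.indicator 1 q.2
  | N + 1, q => ∫⁻ v, pathProb ε θ H D N (step θ q.1 v, q.2 + H (q.1, v)) ∂ε

section

variable {ε : Measure ℝ} [IsProbabilityMeasure ε] {θ : Fin p → ℝ} {H : (Fin p → ℝ) × ℝ → ℝ}
  {D : Set ℝ}

lemma measurable_pathProb (hH : Measurable H) (hD : MeasurableSet D) (N : ℕ) :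
    Measurable (pathProb ε θ H D N) := by
  induction N with
  | zero => exact (measurable_one.indicator hD).comp measurable_snd
  | succ N ih =>
    refine Measurable.lintegral_prod_right' (f := fun q : ((Fin p → ℝ) × ℝ) × ℝ =>
      pathProb ε θ H D N (step θ q.1.1 q.2, q.1.2 + H (q.1.1, q.2))) (ih.comp ?_)
    refine Measurable.prodMk ?_ ?_
    · exact (measurable_step θ).comp (by fun_prop : Measurable
        fun q : ((Fin p → ℝ) × ℝ) × ℝ => (q.1.1, q.2))
    · exact (measurable_snd.comp measurable_fst).add (hH.comp (by fun_prop))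

lemma pathProb_le_one (N : ℕ) (q : (Fin p → ℝ) × ℝ) : pathProb ε θ H D N q ≤ 1 := by
  induction N generalizing q with
  | zero => exact Set.indicator_le_self' (fun _ _ => zero_le) _
  | succ N ih =>
    calc pathProb ε θ H D (N + 1) q ≤ ∫⁻ _, 1 ∂ε := lintegral_mono fun v => ih _
      _ = 1 := by simp

end

namespace ARChain

variable {μ : Measure Ω} {ε : Measure ℝ} {θ : Fin p → ℝ} {𝓕 : ℕ → MeasurableSpace Ω}
  {X : ℕ → Ω → Fin p → ℝ} {u : ℕ → Ω → ℝ}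

lemma adapted (h : ARChain μ ε θ 𝓕 X u) (i : ℕ) : Measurable[𝓕 i] (X i) := by
  induction i with
  | zero => exact h.adapted_zero
  | succ i ih =>
    have h1 : X (i + 1) = fun ω => step θ (X i ω) (u i ω) := funext (h.step_eq i)
    rw [h1]
    exact (measurable_step θ).comp
      ((ih.mono (h.mono i.le_succ) le_rfl).prodMk (h.adapted_innov i))

lemma measurable_state (h : ARChain μ ε θ 𝓕 X u) (i : ℕ) : Measurable (X i) :=
  (h.adapted i).mono (h.le i) le_rfl

lemma measurable_innov (h : ARChain μ ε θ 𝓕 X u) (i : ℕ) : Measurable (u i) :=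
  (h.adapted_innov i).mono (h.le _) le_rfl

lemma shift (h : ARChain μ ε θ 𝓕 X u) (a : ℕ) :
    ARChain μ ε θ (fun i => 𝓕 (a + i)) (fun i => X (a + i)) (fun i => u (a + i)) where
  le i := h.le _
  mono i j hij := h.mono (by omega)
  adapted_zero := h.adapted a
  adapted_innov i := h.adapted_innov (a + i)
  law i := h.law _
  indep i := h.indep _
  step_eq i := h.step_eq _

lemma measurable_psum (h : ARChain μ ε θ 𝓕 X u) {H : (Fin p → ℝ) × ℝ → ℝ} (hH : Measurable H)
    (a N : ℕ) : Measurable (psum H X u a N) :=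
  Finset.measurable_sum _ fun _ _ =>
    hH.comp ((h.measurable_state _).prodMk (h.measurable_innov _))

variable [IsProbabilityMeasure μ] [IsProbabilityMeasure ε]

/-- The innovation `u i` can be integrated out against any function of the past. -/
lemma lintegral_innov (h : ARChain μ ε θ 𝓕 X u) {E : Type*} [MeasurableSpace E] {i : ℕ}
    {U : Ω → E} (hU : Measurable[𝓕 i] U) {F : E × ℝ → ℝ≥0∞} (hF : Measurable F) :
    ∫⁻ ω, F (U ω, u i ω) ∂μ = ∫⁻ ω, ∫⁻ v, F (U ω, v) ∂ε ∂μ := by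
  have hU' : Measurable U := hU.mono (h.le i) le_rfl
  have hu := h.measurable_innov i
  have hind : IndepFun U (u i) μ := by
    rw [IndepFun_iff_Indep]
    exact indep_of_indep_of_le_left (h.indep i) hU.comap_le
  have h1 := (indepFun_iff_map_prod_eq_prod_map_map hU'.aemeasurable hu.aemeasurable).1 hind
  have h2 : ∫⁻ ω, F (U ω, u i ω) ∂μ = ∫⁻ q, F q ∂(μ.map fun ω => (U ω, u i ω)) :=
    (lintegral_map hF (hU'.prodMk hu)).symm
  rw [h2, h1, h.law i]
  have : IsProbabilityMeasure (μ.map U) := Measure.isProbabilityMeasure_map hU'.aemeasurable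
  rw [lintegral_prod _ hF.aemeasurable, lintegral_map hF.lintegral_prod_right' hU']

lemma lintegral_mul_state (h : ARChain μ ε θ 𝓕 X u) {i : ℕ} {g : Ω → ℝ≥0∞}
    (hg : Measurable[𝓕 i] g) {V : (Fin p → ℝ) → ℝ≥0∞} (hV : Measurable V) (m : ℕ) :
    ∫⁻ ω, g ω * V (X (i + m) ω) ∂μ = ∫⁻ ω, g ω * (trans ε θ)^[m] V (X i ω) ∂μ := by
  induction m generalizing V with
  | zero => rfl
  | succ m ih =>
    have h1 := h.lintegral_innov (i := i + m) (U := fun ω => (g ω, X (i + m) ω))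
      (F := fun q : (ℝ≥0∞ × (Fin p → ℝ)) × ℝ => q.1.1 * V (step θ q.1.2 q.2))
      ((hg.mono (h.mono (by omega)) le_rfl).prodMk (h.adapted _))
      ((measurable_fst.comp measurable_fst).mul (hV.comp ((measurable_step θ).comp
        (by fun_prop : Measurable fun q : (ℝ≥0∞ × (Fin p → ℝ)) × ℝ => (q.1.2, q.2)))))
    simp only [← h.step_eq] at h1
    rw [← add_assoc, h1, Function.iterate_succ_apply, ← ih (measurable_trans hV)]
    refine lintegral_congr fun ω => ?_
    exact lintegral_const_mul _ (hV.comp ((measurable_step θ).comp measurable_prodMk_left))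

lemma lintegral_state (h : ARChain μ ε θ 𝓕 X u) {V : (Fin p → ℝ) → ℝ≥0∞} (hV : Measurable V)
    (m : ℕ) : ∫⁻ ω, V (X m ω) ∂μ = ∫⁻ x, (trans ε θ)^[m] V x ∂(μ.map (X 0)) := by
  have h1 := h.lintegral_mul_state (i := 0) (g := fun _ => 1) measurable_const hV m
  simp only [one_mul, zero_add] at h1
  rw [h1, lintegral_map (measurable_trans_iterate hV m) (h.measurable_state 0)]

/-- The offset `R` makes the induction on the number of summands possible. -/
lemma measure_psum_aux (h : ARChain μ ε θ 𝓕 X u) {H : (Fin p → ℝ) × ℝ → ℝ} (hH : Measurable H)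
    {D : Set ℝ} (hD : MeasurableSet D) (N a : ℕ) {R : Ω → ℝ} (hR : Measurable[𝓕 a] R) :
    μ {ω | R ω + psum H X u a N ω ∈ D} = ∫⁻ ω, pathProb ε θ H D N (X a ω, R ω) ∂μ := by
  induction N generalizing a R with
  | zero =>
    have hR' : Measurable R := hR.mono (h.le a) le_rfl
    simp only [psum, Finset.range_zero, Finset.sum_empty, add_zero, pathProb]
    exact (lintegral_indicator_one (hR' hD)).symm
  | succ N ih =>
    have h1 : Measurable[𝓕 (a + 1)] fun ω => R ω + H (X a ω, u a ω) :=
      (hR.mono (h.mono a.le_succ) le_rfl).add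
        (hH.comp (((h.adapted a).mono (h.mono a.le_succ) le_rfl).prodMk (h.adapted_innov a)))
    have h2 := ih (a + 1) h1
    have h3 : ∀ ω, R ω + psum H X u a (N + 1) ω =
        R ω + H (X a ω, u a ω) + psum H X u (a + 1) N ω := fun ω => by
      simp only [psum, Finset.sum_range_succ', add_zero]
      rw [add_assoc, add_comm (H (X a ω, u a ω))]
      simp only [add_assoc, add_comm 1]
    simp only [h3, h2]
    simp only [h.step_eq]
    exact h.lintegral_innov (i := a) (U := fun ω => (X a ω, R ω))
      (F := fun q : ((Fin p → ℝ) × ℝ) × ℝ =>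
        pathProb ε θ H D N (step θ q.1.1 q.2, q.1.2 + H (q.1.1, q.2)))
      ((h.adapted a).prodMk hR)
      ((measurable_pathProb hH hD N).comp (Measurable.prodMk
        ((measurable_step θ).comp (by fun_prop : Measurable
          fun q : ((Fin p → ℝ) × ℝ) × ℝ => (q.1.1, q.2)))
        ((measurable_snd.comp measurable_fst).add (hH.comp (by fun_prop)))))

lemma measure_psum (h : ARChain μ ε θ 𝓕 X u) {H : (Fin p → ℝ) × ℝ → ℝ} (hH : Measurable H)
    {D : Set ℝ} (hD : MeasurableSet D) (N a : ℕ) :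
    μ {ω | psum H X u a N ω ∈ D} = ∫⁻ ω, pathProb ε θ H D N (X a ω, 0) ∂μ := by
  have h1 := h.measure_psum_aux hH hD N a (R := fun _ => 0) measurable_const
  simpa using h1

end ARChain

/-- Mean total variation bound after `m + p` steps between chains with initial laws `ν`
and `π`. -/
noncomputable def discrep (f : ℝ → ℝ) (θ : Fin p → ℝ) (ν π : Measure (Fin p → ℝ)) (m : ℕ) :
    ℝ≥0∞ :=
  ∫⁻ x, ∫⁻ x', mergeBound f θ p ((fun d => step θ d 0)^[m] (x - x')) ∂π ∂ν

section

variable {f : ℝ → ℝ} {θ : Fin p → ℝ} {ν π : Measure (Fin p → ℝ)} [IsProbabilityMeasure ν]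
  [IsProbabilityMeasure π]

lemma measurable_mergeBound_iterate (hf : Measurable f) (m : ℕ) :
    Measurable fun q : (Fin p → ℝ) × (Fin p → ℝ) =>
      mergeBound f θ p ((fun d => step θ d 0)^[m] (q.1 - q.2)) :=
  (measurable_mergeBound hf θ p).comp
    (((continuous_step_zero θ).iterate m).measurable.comp (by fun_prop))

lemma discrep_le (hf : Measurable f) (hf1 : ∫⁻ u, ‖f u‖ₑ = 1) (m : ℕ) :
    discrep f θ ν π m ≤ 2 * p := by
  calc discrep f θ ν π m ≤ ∫⁻ _, ∫⁻ _, (2 * p : ℝ≥0∞) ∂π ∂ν :=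
        lintegral_mono fun x => lintegral_mono fun x' => mergeBound_le hf hf1 _ _ _
    _ = 2 * p := by simp

lemma tendsto_discrep (hf : Measurable f) (hf1 : ∫⁻ u, ‖f u‖ₑ = 1)
    (hθ : ∀ z : ℂ, ‖z‖ ≤ 1 → 1 - ∑ j : Fin p, (θ j : ℂ) * z ^ ((j : ℕ) + 1) ≠ 0) :
    Tendsto (discrep f θ ν π) atTop (𝓝 0) := by
  have hfi : Integrable f := ⟨hf.aestronglyMeasurable, by
    rw [HasFiniteIntegral, hf1]; exact ENNReal.one_lt_top⟩
  have hfin : (2 * p : ℝ≥0∞) ≠ ∞ := ENNReal.mul_ne_top (by simp) (by simp)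
  have h1 : ∀ x, Tendsto (fun m => ∫⁻ x', mergeBound f θ p
      ((fun d => step θ d 0)^[m] (x - x')) ∂π) atTop (𝓝 0) := by
    intro x
    rw [show (0 : ℝ≥0∞) = ∫⁻ _ : Fin p → ℝ, 0 ∂π by simp]
    refine tendsto_lintegral_of_dominated_convergence (fun _ => 2 * p) (fun m => ?_)
      (fun m => Eventually.of_forall fun x' => mergeBound_le hf hf1 _ _ _) (by simp [hfin])
      (Eventually.of_forall fun x' => ?_)
    · exact (measurable_mergeBound_iterate hf m).comp measurable_prodMk_left
    · exact (tendsto_mergeBound hfi θ p).comp (tendsto_iterate_step hθ (x - x'))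
  rw [show (0 : ℝ≥0∞) = ∫⁻ _ : Fin p → ℝ, 0 ∂ν by simp]
  refine tendsto_lintegral_of_dominated_convergence (fun _ => 2 * p) (fun m => ?_)
    (fun m => Eventually.of_forall fun x => ?_) (by simp [hfin]) (Eventually.of_forall h1)
  · exact (measurable_mergeBound_iterate hf m).lintegral_prod_right'
  · calc _ ≤ ∫⁻ _, (2 * p : ℝ≥0∞) ∂π := lintegral_mono fun x' => mergeBound_le hf hf1 _ _ _
      _ = 2 * p := by simp

lemma lintegral_trans_iterate_le {ε : Measure ℝ} [IsProbabilityMeasure ε]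
    (hf : Measurable f) (hf0 : ∀ x, 0 ≤ f x)
    (hε : ε = volume.withDensity fun x => ENNReal.ofReal (f x))
    {V : (Fin p → ℝ) → ℝ≥0∞} (hV : Measurable V) (hV1 : ∀ x, V x ≤ 1) (m : ℕ) (x : Fin p → ℝ) :
    (trans ε θ)^[m + p] V x ≤ ∫⁻ x', (trans ε θ)^[m + p] V x' ∂π +
      ∫⁻ x', mergeBound f θ p ((fun d => step θ d 0)^[m] (x - x')) ∂π := by
  rw [← lintegral_add_left (measurable_trans_iterate hV _)]
  calc (trans ε θ)^[m + p] V x = ∫⁻ _, (trans ε θ)^[m + p] V x ∂π := by simp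
    _ ≤ _ := lintegral_mono fun x' => trans_iterate_le hf hf0 hε hV hV1 m x x'

end

end

/-! ### Weak law of large numbers -/

section

variable {Ω : Type*} [mΩ : MeasurableSpace Ω] {p : ℕ}

lemma integral_sum_sq_le {μ : Measure Ω} [IsProbabilityMeasure μ] {g : ℕ → Ω → ℝ}
    (hg : ∀ i, Measurable (g i)) (hg1 : ∀ i ω, |g i ω| ≤ 1) {κ : ℕ → ℝ} (hκ0 : ∀ k, 0 ≤ κ k)
    (hκ : ∀ i k, ∫ ω, g i ω * g (i + k) ω ∂μ ≤ κ k) (N : ℕ) :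
    ∫ ω, (∑ i ∈ Finset.range N, g i ω) ^ 2 ∂μ ≤ 2 * N * ∑ k ∈ Finset.range N, κ k := by
  have hint : ∀ i j, Integrable (fun ω => g i ω * g j ω) μ := fun i j =>
    Integrable.of_bound ((hg i).mul (hg j)).aestronglyMeasurable 1 (Eventually.of_forall fun ω => by
      rw [Real.norm_eq_abs, abs_mul]
      exact mul_le_one₀ (hg1 i ω) (abs_nonneg _) (hg1 j ω))
  induction N with
  | zero => simp
  | succ N ih =>
    have h1 : ∀ ω, (∑ i ∈ Finset.range (N + 1), g i ω) ^ 2 = (∑ i ∈ Finset.range N, g i ω) ^ 2 +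
        2 * ∑ i ∈ Finset.range N, g i ω * g N ω + g N ω * g N ω := fun ω => by
      rw [Finset.sum_range_succ, ← Finset.sum_mul]; ring
    have hsq : Integrable (fun ω => (∑ i ∈ Finset.range N, g i ω) ^ 2) μ := by
      simp_rw [sq, Finset.sum_mul_sum]
      exact integrable_finsetSum _ fun i _ => integrable_finsetSum _ fun j _ => hint i j
    have hcr : Integrable (fun ω => 2 * ∑ i ∈ Finset.range N, g i ω * g N ω) μ :=
      (integrable_finsetSum _ fun i _ => hint i N).const_mul 2
    have hadd : Integrable (fun ω => (∑ i ∈ Finset.range N, g i ω) ^ 2 +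
        2 * ∑ i ∈ Finset.range N, g i ω * g N ω) μ := hsq.add hcr
    simp_rw [h1]
    rw [integral_add hadd (hint N N), integral_add hsq hcr, integral_const_mul,
      integral_finsetSum _ fun i _ => hint i N]
    have h2 : ∑ i ∈ Finset.range N, ∫ ω, g i ω * g N ω ∂μ ≤ ∑ k ∈ Finset.range N, κ (k + 1) := by
      rw [← Finset.sum_range_reflect (fun k => κ (k + 1))]
      refine Finset.sum_le_sum fun i hi => ?_
      have hi' := Finset.mem_range.1 hi
      have h3 := hκ i (N - 1 - i + 1)
      rwa [show i + (N - 1 - i + 1) = N by omega] at h3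
    have h4 : ∫ ω, g N ω * g N ω ∂μ ≤ κ 0 := hκ N 0
    have h5 : ∑ k ∈ Finset.range (N + 1), κ k = ∑ k ∈ Finset.range N, κ (k + 1) + κ 0 :=
      Finset.sum_range_succ' _ _
    have h6 : ∑ k ∈ Finset.range N, κ k ≤ ∑ k ∈ Finset.range (N + 1), κ k := by
      rw [Finset.sum_range_succ]; linarith [hκ0 N]
    have h7 : (N : ℝ) * ∑ k ∈ Finset.range N, κ k ≤ N * ∑ k ∈ Finset.range (N + 1), κ k := by
      gcongr
    push_cast
    nlinarith [hκ0 0]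

/-- Uniformly bounded variables whose correlations are dominated by a null sequence of the time
lag satisfy the weak law of large numbers. -/
lemma tendsto_measure_sum_of_cov {μ : Measure Ω} [IsProbabilityMeasure μ] {g : ℕ → Ω → ℝ}
    (hg : ∀ i, Measurable (g i)) (hg1 : ∀ i ω, |g i ω| ≤ 1) {κ : ℕ → ℝ} (hκ0 : ∀ k, 0 ≤ κ k)
    (hκl : Tendsto κ atTop (𝓝 0)) (hκ : ∀ i k, ∫ ω, g i ω * g (i + k) ω ∂μ ≤ κ k) {δ : ℝ}
    (hδ : 0 < δ) :
    Tendsto (fun N : ℕ => μ {ω | δ * N ≤ |∑ i ∈ Finset.range N, g i ω|}) atTop (𝓝 0) := by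
  have h1 : Tendsto (fun N : ℕ => ENNReal.ofReal (2 / δ ^ 2 *
      ((N : ℝ)⁻¹ * ∑ k ∈ Finset.range N, κ k))) atTop (𝓝 0) := by
    rw [← ENNReal.ofReal_zero]
    refine ENNReal.tendsto_ofReal ?_
    simpa using (hκl.cesaro).const_mul (2 / δ ^ 2)
  refine tendsto_of_tendsto_of_tendsto_of_le_of_le' tendsto_const_nhds h1
    (Eventually.of_forall fun _ => zero_le) ?_
  filter_upwards [eventually_gt_atTop 0] with N hN
  have hN' : (0 : ℝ) < N := by exact_mod_cast hN
  have hm : Measurable fun ω => ∑ i ∈ Finset.range N, g i ω :=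
    Finset.measurable_sum _ fun i _ => hg i
  have hint : Integrable (fun ω => (∑ i ∈ Finset.range N, g i ω) ^ 2) μ := by
    refine Integrable.of_bound (hm.pow_const 2).aestronglyMeasurable ((N : ℝ) ^ 2)
      (Eventually.of_forall fun ω => ?_)
    rw [Real.norm_eq_abs, abs_pow]
    gcongr
    calc |∑ i ∈ Finset.range N, g i ω| ≤ ∑ i ∈ Finset.range N, |g i ω| :=
          Finset.abs_sum_le_sum_abs _ _
      _ ≤ ∑ i ∈ Finset.range N, 1 := Finset.sum_le_sum fun i _ => hg1 i ω
      _ = N := by simp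
  have h2 := mul_meas_ge_le_integral_of_nonneg (Eventually.of_forall fun ω => sq_nonneg _) hint
    ((δ * N) ^ 2)
  have h3 := integral_sum_sq_le hg hg1 hκ0 hκ N
  have h4 : {ω | δ * N ≤ |∑ i ∈ Finset.range N, g i ω|} ⊆
      {ω | (δ * N) ^ 2 ≤ (∑ i ∈ Finset.range N, g i ω) ^ 2} := fun ω hω => by
    have : 0 ≤ δ * N := by positivity
    calc (δ * N) ^ 2 ≤ |∑ i ∈ Finset.range N, g i ω| ^ 2 := by gcongr; exact hω
      _ = _ := sq_abs _
  refine (measure_mono h4).trans ?_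
  rw [← ofReal_measureReal]
  refine ENNReal.ofReal_le_ofReal ?_
  have h5 : (δ * N) ^ 2 * μ.real {ω | (δ * N) ^ 2 ≤ (∑ i ∈ Finset.range N, g i ω) ^ 2} ≤
      2 * N * ∑ k ∈ Finset.range N, κ k := h2.trans h3
  have h6 : 2 / δ ^ 2 * ((N : ℝ)⁻¹ * ∑ k ∈ Finset.range N, κ k) =
      (2 * N * ∑ k ∈ Finset.range N, κ k) / (δ * N) ^ 2 := by field_simp
  rw [h6, le_div_iff₀ (by positivity)]
  linarith

namespace ARChain

variable {μ : Measure Ω} [IsProbabilityMeasure μ] {f : ℝ → ℝ} {ε : Measure ℝ}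
  [IsProbabilityMeasure ε] {θ : Fin p → ℝ} {𝓕 : ℕ → MeasurableSpace Ω}
  {X : ℕ → Ω → Fin p → ℝ} {u : ℕ → Ω → ℝ} {π : Measure (Fin p → ℝ)}

lemma lintegral_pair (h : ARChain μ ε θ 𝓕 X u) {F : (Fin p → ℝ) × ℝ → ℝ≥0∞} (hF : Measurable F)
    (i : ℕ) : ∫⁻ ω, F (X i ω, u i ω) ∂μ = ∫⁻ x, ∫⁻ v, F (x, v) ∂ε ∂(μ.map (X i)) := by
  rw [h.lintegral_innov (h.adapted i) hF,
    lintegral_map hF.lintegral_prod_right' (h.measurable_state i)]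

lemma map_pair (h : ARChain μ ε θ 𝓕 X u) (i : ℕ) :
    μ.map (fun ω => (X i ω, u i ω)) = (μ.map (X i)).prod ε := by
  have hm := (h.measurable_state i).prodMk (h.measurable_innov i)
  refine Measure.ext fun s hs => ?_
  rw [Measure.map_apply hm hs, Measure.prod_apply hs]
  have h1 := h.lintegral_pair (F := s.indicator 1) (measurable_one.indicator hs) i
  have h2 : ∫⁻ ω, s.indicator 1 (X i ω, u i ω) ∂μ = μ ((fun ω => (X i ω, u i ω)) ⁻¹' s) :=
    lintegral_indicator_one (hm hs)
  rw [← h2, h1]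
  refine lintegral_congr fun x => ?_
  exact lintegral_indicator_one (measurable_prodMk_left hs)

/-- Correlations of a stationary chain, for functions with values in `[0, 1]`. -/
lemma lintegral_mul_le (h : ARChain μ ε θ 𝓕 X u) (hX : ∀ i, μ.map (X i) = π)
    (hf : Measurable f) (hf0 : ∀ x, 0 ≤ f x)
    (hε : ε = volume.withDensity fun x => ENNReal.ofReal (f x))
    {F : (Fin p → ℝ) × ℝ → ℝ≥0∞} (hF : Measurable F) (hF1 : ∀ q, F q ≤ 1) (i m : ℕ) :
    ∫⁻ ω, F (X i ω, u i ω) * F (X (i + 1 + (m + p)) ω, u (i + 1 + (m + p)) ω) ∂μ ≤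
      (∫⁻ ω, F (X 0 ω, u 0 ω) ∂μ) * (∫⁻ ω, F (X 0 ω, u 0 ω) ∂μ) + discrep f θ π π m := by
  have hπ : IsProbabilityMeasure π := hX 0 ▸
    Measure.isProbabilityMeasure_map (h.measurable_state 0).aemeasurable
  set ψ : (Fin p → ℝ) → ℝ≥0∞ := fun x => ∫⁻ v, F (x, v) ∂ε with hψ
  have hψm : Measurable ψ := hF.lintegral_prod_right'
  have hψ1 : ∀ x, ψ x ≤ 1 := fun x => by
    calc ψ x ≤ ∫⁻ _, 1 ∂ε := lintegral_mono fun v => hF1 _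
      _ = 1 := by simp
  set c : ℝ≥0∞ := ∫⁻ ω, F (X 0 ω, u 0 ω) ∂μ with hc
  have hc' : c = ∫⁻ x, ψ x ∂π := by rw [hc, h.lintegral_pair hF, hX 0]
  have hci : ∫⁻ ω, F (X i ω, u i ω) ∂μ = c := by rw [h.lintegral_pair hF, hX i, hc']
  have hFi : Measurable[𝓕 (i + 1)] fun ω => F (X i ω, u i ω) :=
    hF.comp (((h.adapted i).mono (h.mono i.le_succ) le_rfl).prodMk (h.adapted_innov i))
  have hT : ∫⁻ x, (trans ε θ)^[m + p] ψ x ∂π = c := by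
    rw [← hX 0, ← h.lintegral_state hψm, hc', ← hX (m + p),
      lintegral_map hψm (h.measurable_state _)]
  set Γ : (Fin p → ℝ) → ℝ≥0∞ := fun x =>
    ∫⁻ x', mergeBound f θ p ((fun d => step θ d 0)^[m] (x - x')) ∂π with hΓ
  have hΓm : Measurable Γ := (measurable_mergeBound_iterate hf m).lintegral_prod_right'
  have h1 := h.lintegral_innov (i := i + 1 + (m + p))
    (U := fun ω => (F (X i ω, u i ω), X (i + 1 + (m + p)) ω))
    (F := fun q : (ℝ≥0∞ × (Fin p → ℝ)) × ℝ => q.1.1 * F (q.1.2, q.2))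
    ((hFi.mono (h.mono (by omega)) le_rfl).prodMk (h.adapted _))
    ((measurable_fst.comp measurable_fst).mul (hF.comp (by fun_prop)))
  calc _ = ∫⁻ ω, ∫⁻ v, F (X i ω, u i ω) * F (X (i + 1 + (m + p)) ω, v) ∂ε ∂μ := h1
    _ = ∫⁻ ω, F (X i ω, u i ω) * ψ (X (i + 1 + (m + p)) ω) ∂μ :=
        lintegral_congr fun ω => lintegral_const_mul _ (hF.comp measurable_prodMk_left)
    _ = ∫⁻ ω, F (X i ω, u i ω) * (trans ε θ)^[m + p] ψ (X (i + 1) ω) ∂μ :=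
        h.lintegral_mul_state hFi hψm (m + p)
    _ ≤ ∫⁻ ω, (F (X i ω, u i ω) * c + Γ (X (i + 1) ω)) ∂μ := by
        refine lintegral_mono fun ω => ?_
        have h2 := lintegral_trans_iterate_le (π := π) (θ := θ) hf hf0 hε hψm hψ1 m (X (i + 1) ω)
        rw [hT] at h2
        calc _ ≤ F (X i ω, u i ω) * (c + Γ (X (i + 1) ω)) := by gcongr
          _ = F (X i ω, u i ω) * c + F (X i ω, u i ω) * Γ (X (i + 1) ω) := mul_add _ _ _
          _ ≤ _ := by gcongr; exact mul_le_of_le_one_left zero_le (hF1 _)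
    _ = c * c + discrep f θ π π m := by
        have hΓX : Measurable fun ω => Γ (X (i + 1) ω) := hΓm.comp (h.measurable_state _)
        rw [lintegral_add_right _ hΓX, lintegral_mul_const _ (hFi.mono (h.le _) le_rfl), hci,
          ← lintegral_map (f := Γ) hΓm (h.measurable_state _), hX]
        rfl

lemma lln_unit (h : ARChain μ ε θ 𝓕 X u) (hX : ∀ i, μ.map (X i) = π)
    (hf : Measurable f) (hf0 : ∀ x, 0 ≤ f x) (hf1 : ∫⁻ u, ‖f u‖ₑ = 1)
    (hε : ε = volume.withDensity fun x => ENNReal.ofReal (f x))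
    (hθ : ∀ z : ℂ, ‖z‖ ≤ 1 → 1 - ∑ j : Fin p, (θ j : ℂ) * z ^ ((j : ℕ) + 1) ≠ 0)
    {H : (Fin p → ℝ) × ℝ → ℝ} (hH : Measurable H) (hH0 : ∀ q, 0 ≤ H q) (hH1 : ∀ q, H q ≤ 1)
    {δ : ℝ} (hδ : 0 < δ) :
    Tendsto (fun N : ℕ => μ {ω | δ * N ≤
      |psum H X u 0 N ω - N * ∫ ω, H (X 0 ω, u 0 ω) ∂μ|}) atTop (𝓝 0) := by
  have hπ : IsProbabilityMeasure π := hX 0 ▸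
    Measure.isProbabilityMeasure_map (h.measurable_state 0).aemeasurable
  set c : ℝ := ∫ ω, H (X 0 ω, u 0 ω) ∂μ with hc
  have hm : ∀ i, Measurable fun ω => H (X i ω, u i ω) := fun i =>
    hH.comp ((h.measurable_state i).prodMk (h.measurable_innov i))
  have hint : ∀ i, Integrable (fun ω => H (X i ω, u i ω)) μ := fun i =>
    Integrable.of_bound (hm i).aestronglyMeasurable 1 (Eventually.of_forall fun ω => by
      rw [Real.norm_eq_abs, abs_of_nonneg (hH0 _)]; exact hH1 _)
  have hci : ∀ i, ∫ ω, H (X i ω, u i ω) ∂μ = c := fun i => by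
    have e : ∀ j, ∫ ω, H (X j ω, u j ω) ∂μ = ∫ q, H q ∂(π.prod ε) := fun j => by
      rw [← hX j, ← h.map_pair j, integral_map ((h.measurable_state j).prodMk
        (h.measurable_innov j)).aemeasurable hH.aestronglyMeasurable]
    rw [e, hc, e]
  have hc0 : 0 ≤ c := integral_nonneg fun ω => hH0 _
  have hc1 : c ≤ 1 := by
    calc c ≤ ∫ _, (1 : ℝ) ∂μ := integral_mono (hint 0) (integrable_const _) fun ω => hH1 _
      _ = 1 := by simp
  have hcE : ∫⁻ ω, ENNReal.ofReal (H (X 0 ω, u 0 ω)) ∂μ = ENNReal.ofReal c :=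
    (ofReal_integral_eq_lintegral_ofReal (hint 0) (Eventually.of_forall fun ω => hH0 _)).symm
  have hd : ∀ m, discrep f θ π π m ≠ ∞ := fun m =>
    ne_top_of_le_ne_top (ENNReal.mul_ne_top (by simp) (by simp)) (discrep_le hf hf1 m)
  -- the contraction bound is available only after the `p` merging steps
  set κ : ℕ → ℝ := fun k => if k ≤ p then 1 else (discrep f θ π π (k - 1 - p)).toReal with hκ
  have hκ0 : ∀ k, 0 ≤ κ k := fun k => by simp only [hκ]; split_ifs <;> positivity
  have hκl : Tendsto κ atTop (𝓝 0) := by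
    have h1 : Tendsto (fun m => (discrep f θ π π m).toReal) atTop (𝓝 0) := by
      rw [← ENNReal.toReal_zero]
      exact (ENNReal.tendsto_toReal ENNReal.zero_ne_top).comp (tendsto_discrep hf hf1 hθ)
    rw [← tendsto_add_atTop_iff_nat (p + 1)]
    refine h1.congr fun m => ?_
    simp only [hκ]
    rw [if_neg (by omega)]
    congr 2; omega
  have hg1 : ∀ i ω, |H (X i ω, u i ω) - c| ≤ 1 := fun i ω => by
    rw [abs_le]; constructor <;> linarith [hH0 (X i ω, u i ω), hH1 (X i ω, u i ω)]
  have hcov : ∀ i k, ∫ ω, (H (X i ω, u i ω) - c) * (H (X (i + k) ω, u (i + k) ω) - c) ∂μ ≤ κ k := by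
    intro i k
    by_cases hk : k ≤ p
    · simp only [hκ, hk, if_true]
      have hb : ∀ ω, |(H (X i ω, u i ω) - c) * (H (X (i + k) ω, u (i + k) ω) - c)| ≤ 1 :=
        fun ω => by rw [abs_mul]; exact mul_le_one₀ (hg1 _ _) (abs_nonneg _) (hg1 _ _)
      calc _ ≤ ∫ _, (1 : ℝ) ∂μ := by
            refine integral_mono ?_ (integrable_const _) fun ω => (abs_le.1 (hb ω)).2
            exact Integrable.of_bound (((hm i).sub_const c).mul
              ((hm _).sub_const c)).aestronglyMeasurable 1 (Eventually.of_forall hb)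
        _ = 1 := by simp
    · obtain ⟨m, rfl⟩ : ∃ m, k = 1 + (m + p) := ⟨k - 1 - p, by omega⟩
      have hκk : κ (1 + (m + p)) = (discrep f θ π π m).toReal := by
        simp only [hκ]
        rw [if_neg (by omega)]
        congr 2; omega
      rw [hκk, ← add_assoc i 1]
      set j := i + 1 + (m + p)
      have hprod : Integrable (fun ω => H (X i ω, u i ω) * H (X j ω, u j ω)) μ :=
        Integrable.of_bound ((hm i).mul (hm j)).aestronglyMeasurable 1
          (Eventually.of_forall fun ω => by
            rw [Real.norm_eq_abs, abs_of_nonneg (mul_nonneg (hH0 _) (hH0 _))]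
            exact mul_le_one₀ (hH1 _) (hH0 _) (hH1 _))
      have e1 : ∫ ω, (H (X i ω, u i ω) - c) * (H (X j ω, u j ω) - c) ∂μ =
          ∫ ω, H (X i ω, u i ω) * H (X j ω, u j ω) ∂μ - c * c := by
        have e2 : ∀ ω, (H (X i ω, u i ω) - c) * (H (X j ω, u j ω) - c) =
            H (X i ω, u i ω) * H (X j ω, u j ω) - c * H (X i ω, u i ω) - c * H (X j ω, u j ω)
              + c * c := fun ω => by ring
        have i1 : Integrable (fun ω => H (X i ω, u i ω) * H (X j ω, u j ω) -
            c * H (X i ω, u i ω)) μ := hprod.sub ((hint i).const_mul c)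
        have i2 : Integrable (fun ω => H (X i ω, u i ω) * H (X j ω, u j ω) -
            c * H (X i ω, u i ω) - c * H (X j ω, u j ω)) μ := i1.sub ((hint j).const_mul c)
        simp_rw [e2]
        rw [integral_add i2 (integrable_const _), integral_sub i1 ((hint j).const_mul c),
          integral_sub hprod ((hint i).const_mul c), integral_const_mul, integral_const_mul, hci,
          hci]
        simp
      have e3 := h.lintegral_mul_le hX hf hf0 hε (F := fun q => ENNReal.ofReal (H q))
        hH.ennreal_ofReal (fun q => by rw [← ENNReal.ofReal_one]
                                       exact ENNReal.ofReal_le_ofReal (hH1 q)) i m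
      rw [hcE] at e3
      simp_rw [← ENNReal.ofReal_mul (hH0 _)] at e3
      rw [← ofReal_integral_eq_lintegral_ofReal hprod
        (Eventually.of_forall fun ω => mul_nonneg (hH0 _) (hH0 _)), ← ENNReal.ofReal_mul hc0,
        ← ENNReal.ofReal_toReal (hd m), ← ENNReal.ofReal_add (by positivity) (by positivity),
        ENNReal.ofReal_le_ofReal_iff (by positivity)] at e3
      rw [e1]; linarith
  have hfin := tendsto_measure_sum_of_cov (fun i => (hm i).sub_const c) hg1 hκ0 hκl hcov hδ
  refine hfin.congr fun N => ?_
  simp [psum, Finset.sum_sub_distrib]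

lemma lln_bounded (h : ARChain μ ε θ 𝓕 X u) (hX : ∀ i, μ.map (X i) = π)
    (hf : Measurable f) (hf0 : ∀ x, 0 ≤ f x) (hf1 : ∫⁻ u, ‖f u‖ₑ = 1)
    (hε : ε = volume.withDensity fun x => ENNReal.ofReal (f x))
    (hθ : ∀ z : ℂ, ‖z‖ ≤ 1 → 1 - ∑ j : Fin p, (θ j : ℂ) * z ^ ((j : ℕ) + 1) ≠ 0)
    {H : (Fin p → ℝ) × ℝ → ℝ} (hH : Measurable H) {K : ℝ} (hK : 0 < K) (hHK : ∀ q, |H q| ≤ K)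
    {δ : ℝ} (hδ : 0 < δ) :
    Tendsto (fun N : ℕ => μ {ω | δ * N ≤
      |psum H X u 0 N ω - N * ∫ ω, H (X 0 ω, u 0 ω) ∂μ|}) atTop (𝓝 0) := by
  have h1 := h.lln_unit hX hf hf0 hf1 hε hθ (H := fun q => (H q + K) / (2 * K))
    ((hH.add_const K).div_const _)
    (fun q => div_nonneg (by linarith [(abs_le.1 (hHK q)).1]) (by positivity))
    (fun q => (div_le_one (by positivity)).2 (by linarith [(abs_le.1 (hHK q)).2]))
    (δ := δ / (2 * K)) (by positivity)
  refine h1.congr fun N => ?_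
  have hint : Integrable (fun ω => H (X 0 ω, u 0 ω)) μ :=
    Integrable.of_bound (hH.comp ((h.measurable_state 0).prodMk
      (h.measurable_innov 0))).aestronglyMeasurable K (Eventually.of_forall fun ω => hHK _)
  rw [integral_div, integral_add hint (integrable_const _)]
  simp only [integral_const, probReal_univ, one_smul]
  congr 1
  ext ω
  simp only [Set.mem_ofPred_eq]
  have e1 : psum (fun q => (H q + K) / (2 * K)) X u 0 N ω -
      N * ((∫ ω, H (X 0 ω, u 0 ω) ∂μ + K) / (2 * K)) =
      (psum H X u 0 N ω - N * ∫ ω, H (X 0 ω, u 0 ω) ∂μ) / (2 * K) := by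
    simp only [psum, ← Finset.sum_div, Finset.sum_add_distrib, Finset.sum_const,
      Finset.card_range, nsmul_eq_mul]
    ring
  rw [e1, abs_div, abs_of_pos (by positivity : 0 < 2 * K), div_mul_eq_mul_div,
    div_le_div_iff_of_pos_right (by positivity)]

end ARChain

end

section

variable {Ω : Type*} [mΩ : MeasurableSpace Ω] {p : ℕ}

lemma tendsto_measure_le_abs {μ : Measure Ω} [IsFiniteMeasure μ] {Z : Ω → ℝ} (hZ : Measurable Z)
    {a : ℕ → ℝ} (ha : Tendsto a atTop atTop) :
    Tendsto (fun n => μ {ω | a n ≤ |Z ω|}) atTop (𝓝 0) := by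
  have h1 : TendstoInMeasure μ (fun n ω => Z ω / a n) atTop (fun _ => (0 : ℝ)) :=
    tendstoInMeasure_of_tendsto_ae (fun n => (hZ.div_const _).aestronglyMeasurable)
      (Eventually.of_forall fun ω => ha.const_div_atTop _)
  rw [tendstoInMeasure_iff_norm] at h1
  refine (h1 1 one_pos).congr' ?_
  filter_upwards [ha.eventually_gt_atTop 0] with n hn
  congr 1
  ext ω
  simp only [Set.mem_ofPred_eq, sub_zero, Real.norm_eq_abs, abs_div, abs_of_pos hn]
  rw [one_le_div hn]

/-- Truncation of a real number to `[-K, K]`. -/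
def trunc (K x : ℝ) : ℝ := max (-K) (min K x)

lemma measurable_trunc (K : ℝ) : Measurable (trunc K) := by unfold trunc; fun_prop

lemma abs_trunc_le {K : ℝ} (hK : 0 ≤ K) (x : ℝ) : |trunc K x| ≤ K := by
  rw [abs_le, trunc]
  exact ⟨le_max_left _ _, max_le (by linarith) (min_le_left _ _)⟩

lemma abs_sub_trunc_le {K : ℝ} (hK : 0 ≤ K) (x : ℝ) : |x - trunc K x| ≤ |x| := by
  rw [trunc]
  rcases le_total K x with h | h
  · rw [min_eq_left h, max_eq_right (by linarith), abs_of_nonneg (by linarith),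
      abs_of_nonneg (by linarith)]
    linarith
  · rw [min_eq_right h]
    rcases le_total (-K) x with h' | h'
    · rw [max_eq_right h']; simp
    · rw [max_eq_left h', abs_of_nonpos (by linarith), abs_of_nonpos (by linarith)]
      linarith

lemma trunc_eq_self {K x : ℝ} (h : |x| ≤ K) : trunc K x = x := by
  rw [trunc, min_eq_right (abs_le.1 h).2, max_eq_right (abs_le.1 h).1]

lemma tendsto_integral_abs_sub_trunc {μ : Measure Ω} {Z : Ω → ℝ} (hZ : Integrable Z μ) :
    Tendsto (fun K : ℕ => ∫ ω, |Z ω - trunc K (Z ω)| ∂μ) atTop (𝓝 0) := by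
  rw [show (0 : ℝ) = ∫ _, (0 : ℝ) ∂μ by simp]
  refine tendsto_integral_of_dominated_convergence (fun ω => |Z ω|) (fun K => ?_) hZ.abs
    (fun K => Eventually.of_forall fun ω => ?_) (Eventually.of_forall fun ω => ?_)
  · exact (hZ.aestronglyMeasurable.sub (((measurable_trunc K).comp_aemeasurable
      hZ.aemeasurable).aestronglyMeasurable)).norm
  · rw [Real.norm_eq_abs, abs_abs]
    exact abs_sub_trunc_le (Nat.cast_nonneg K) _
  · refine tendsto_const_nhds.congr' ?_
    obtain ⟨K, hK⟩ := exists_nat_ge |Z ω|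
    filter_upwards [eventually_ge_atTop K] with L hL
    rw [trunc_eq_self (hK.trans (by exact_mod_cast hL)), sub_self, abs_zero]

namespace ARChain

variable {μ : Measure Ω} [IsProbabilityMeasure μ] {f : ℝ → ℝ} {ε : Measure ℝ}
  [IsProbabilityMeasure ε] {θ : Fin p → ℝ} {𝓕 : ℕ → MeasurableSpace Ω}
  {X : ℕ → Ω → Fin p → ℝ} {u : ℕ → Ω → ℝ} {π : Measure (Fin p → ℝ)}

/-- The weak law of large numbers for a stationary chain. -/
lemma lln_stationary (h : ARChain μ ε θ 𝓕 X u) (hX : ∀ i, μ.map (X i) = π)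
    (hf : Measurable f) (hf0 : ∀ x, 0 ≤ f x) (hf1 : ∫⁻ u, ‖f u‖ₑ = 1)
    (hε : ε = volume.withDensity fun x => ENNReal.ofReal (f x))
    (hθ : ∀ z : ℂ, ‖z‖ ≤ 1 → 1 - ∑ j : Fin p, (θ j : ℂ) * z ^ ((j : ℕ) + 1) ≠ 0)
    {H : (Fin p → ℝ) × ℝ → ℝ} (hH : Measurable H)
    (hHi : Integrable (fun ω => H (X 0 ω, u 0 ω)) μ) {δ : ℝ} (hδ : 0 < δ) :
    Tendsto (fun N : ℕ => μ {ω | δ * N ≤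
      |psum H X u 0 N ω - N * ∫ ω, H (X 0 ω, u 0 ω) ∂μ|}) atTop (𝓝 0) := by
  have hpm : ∀ i, Measurable fun ω => (X i ω, u i ω) := fun i =>
    (h.measurable_state i).prodMk (h.measurable_innov i)
  have hid : ∀ i, IdentDistrib (fun ω => (X i ω, u i ω)) (fun ω => (X 0 ω, u 0 ω)) μ μ := fun i =>
    ⟨(hpm i).aemeasurable, (hpm 0).aemeasurable, by rw [h.map_pair, h.map_pair, hX, hX]⟩
  rw [ENNReal.tendsto_nhds_zero]
  intro η hη
  obtain ⟨η', hη'0, hη'⟩ : ∃ η' : ℝ, 0 < η' ∧ ENNReal.ofReal η' ≤ η / 2 := by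
    rcases eq_or_ne η ∞ with rfl | hη2
    · exact ⟨1, one_pos, by simp [ENNReal.top_div]⟩
    · refine ⟨(η / 2).toReal, ENNReal.toReal_pos (by simp [hη.ne'])
        (ENNReal.div_ne_top hη2 (by simp)),
        ENNReal.ofReal_toReal_le⟩
  -- truncate at a level `K` with `E |H - H_K|` small
  have htr := tendsto_integral_abs_sub_trunc hHi
  obtain ⟨K, hKt, hK1⟩ := ((htr.eventually_lt_const
    (show (0:ℝ) < min (δ / 4) (δ / 4 * η') by positivity)).and (eventually_ge_atTop 1)).exists
  have hK0 : (0 : ℝ) < K := by exact_mod_cast hK1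
  set t : ℝ := ∫ ω, |H (X 0 ω, u 0 ω) - trunc K (H (X 0 ω, u 0 ω))| ∂μ with ht
  have ht1 : t < δ / 4 := hKt.trans_le (min_le_left _ _)
  have ht2 : t ≤ δ / 4 * η' := (hKt.trans_le (min_le_right _ _)).le
  set c : ℝ := ∫ ω, H (X 0 ω, u 0 ω) ∂μ with hc
  set HK : (Fin p → ℝ) × ℝ → ℝ := fun q => trunc K (H q) with hHK
  have hHKm : Measurable HK := (measurable_trunc K).comp hH
  set cK : ℝ := ∫ ω, HK (X 0 ω, u 0 ω) ∂μ with hcK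
  have hHKi : Integrable (fun ω => HK (X 0 ω, u 0 ω)) μ :=
    Integrable.of_bound (hHKm.comp (hpm 0)).aestronglyMeasurable K
      (Eventually.of_forall fun ω => abs_trunc_le hK0.le _)
  have hcc : |c - cK| ≤ t := by
    rw [hc, hcK, ← integral_sub hHi hHKi]
    exact abs_integral_le_integral_abs
  have hG : Measurable fun q => |H q - HK q| := (hH.sub hHKm).abs
  have hGi : ∀ i, Integrable (fun ω => |H (X i ω, u i ω) - HK (X i ω, u i ω)|) μ := fun i =>
    ((hid i).comp hG).integrable_iff.2 (hHi.sub hHKi).abs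
  have hGt : ∀ i, ∫ ω, |H (X i ω, u i ω) - HK (X i ω, u i ω)| ∂μ = t := fun i =>
    ((hid i).comp hG).integral_eq
  have hb := h.lln_bounded hX hf hf0 hf1 hε hθ hHKm hK0 (fun q => abs_trunc_le hK0.le _)
    (δ := δ / 4) (by positivity)
  rw [ENNReal.tendsto_nhds_zero] at hb
  filter_upwards [hb (η / 2) (by simp [hη.ne']), eventually_gt_atTop 0] with N hN hN0
  have hN' : (0 : ℝ) < N := by exact_mod_cast hN0
  set D : Ω → ℝ := fun ω => ∑ i ∈ Finset.range N,
    |H (X (0 + i) ω, u (0 + i) ω) - HK (X (0 + i) ω, u (0 + i) ω)| with hD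
  have hsub : {ω | δ * N ≤ |psum H X u 0 N ω - N * c|} ⊆
      {ω | δ / 4 * N ≤ |psum HK X u 0 N ω - N * cK|} ∪ {ω | δ / 4 * N ≤ D ω} := by
    intro ω hω
    by_contra hcon
    simp only [Set.mem_union, Set.mem_ofPred_eq, not_or, not_le] at hcon hω
    have h1 : |psum H X u 0 N ω - psum HK X u 0 N ω| ≤ D ω := by
      rw [psum, psum, ← Finset.sum_sub_distrib]
      exact Finset.abs_sum_le_sum_abs _ _
    have h2 : |(N : ℝ) * (cK - c)| ≤ N * t := by
      rw [abs_mul, abs_of_pos hN', abs_sub_comm]; gcongr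
    have h3 : psum H X u 0 N ω - N * c = (psum H X u 0 N ω - psum HK X u 0 N ω) +
        (psum HK X u 0 N ω - N * cK) + N * (cK - c) := by ring
    have h4 := abs_add_three (psum H X u 0 N ω - psum HK X u 0 N ω)
      (psum HK X u 0 N ω - N * cK) (N * (cK - c))
    rw [← h3] at h4
    nlinarith [hcon.1, hcon.2]
  have hDm : ∫ ω, D ω ∂μ = N * t := by
    rw [hD, integral_finsetSum _ fun i _ => hGi _]
    simp [hGt]
  have hDi : Integrable D μ := integrable_finsetSum _ fun i _ => hGi _
  have hmark := mul_meas_ge_le_integral_of_nonneg (Eventually.of_forall fun ω =>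
    Finset.sum_nonneg fun i _ => abs_nonneg _) hDi (δ / 4 * N)
  have hD2 : μ {ω | δ / 4 * N ≤ D ω} ≤ η / 2 := by
    rw [← ofReal_measureReal]
    refine (ENNReal.ofReal_le_ofReal ?_).trans hη'
    rw [hDm] at hmark
    have : δ / 4 * N * μ.real {ω | δ / 4 * N ≤ D ω} ≤ δ / 4 * N * η' := by
      nlinarith
    exact le_of_mul_le_mul_left this (by positivity)
  calc _ ≤ _ := measure_mono hsub
    _ ≤ _ := measure_union_le _ _
    _ ≤ η / 2 + η / 2 := add_le_add hN hD2
    _ = η := ENNReal.add_halves η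

/-- Along chains with a common, arbitrary initial law the weak law of large numbers holds with
the stationary mean: after finitely many steps the chains are close in total variation to the
stationary one, and finitely many summands are negligible. -/
lemma lln_of_initial_law (h : ARChain μ ε θ 𝓕 X u) (hX : ∀ i, μ.map (X i) = π)
    (hf : Measurable f) (hf0 : ∀ x, 0 ≤ f x) (hf1 : ∫⁻ u, ‖f u‖ₑ = 1)
    (hε : ε = volume.withDensity fun x => ENNReal.ofReal (f x))
    (hθ : ∀ z : ℂ, ‖z‖ ≤ 1 → 1 - ∑ j : Fin p, (θ j : ℂ) * z ^ ((j : ℕ) + 1) ≠ 0)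
    {H : (Fin p → ℝ) × ℝ → ℝ} (hH : Measurable H)
    (hHi : Integrable (fun ω => H (X 0 ω, u 0 ω)) μ)
    {𝓖 : ℕ → ℕ → MeasurableSpace Ω} {X' : ℕ → ℕ → Ω → Fin p → ℝ} {u' : ℕ → ℕ → Ω → ℝ}
    (h' : ∀ n, ARChain μ ε θ (𝓖 n) (X' n) (u' n)) {ν : Measure (Fin p → ℝ)}
    (hν : ∀ n, μ.map (X' n 0) = ν) {l : ℕ → ℕ} (hl : Tendsto l atTop atTop)
    {δ : ℝ} (hδ : 0 < δ) :
    Tendsto (fun n : ℕ => μ {ω | δ * l n ≤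
      |psum H (X' n) (u' n) 0 (l n) ω - l n * ∫ ω, H (X 0 ω, u 0 ω) ∂μ|}) atTop (𝓝 0) := by
  have hπ : IsProbabilityMeasure π := hX 0 ▸
    Measure.isProbabilityMeasure_map (h.measurable_state 0).aemeasurable
  have hν' : IsProbabilityMeasure ν := hν 0 ▸
    Measure.isProbabilityMeasure_map ((h' 0).measurable_state 0).aemeasurable
  set c : ℝ := ∫ ω, H (X 0 ω, u 0 ω) ∂μ with hc
  rw [ENNReal.tendsto_nhds_zero]
  intro η hη
  have hη3 : 0 < η / 3 := by simp [hη.ne']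
  obtain ⟨m, hm⟩ := ((ENNReal.tendsto_nhds_zero.1
    (tendsto_discrep (ν := ν) (π := π) hf hf1 hθ)) _ hη3).exists
  set M := m + p with hM
  -- the first `M` summands have a law that does not depend on `n`
  have hfirst : Tendsto (fun n => μ {ω | δ / 2 * l n ≤ |psum H (X' n) (u' n) 0 M ω - M * c|})
      atTop (𝓝 0) := by
    have h1 : Tendsto (fun n => μ {ω | δ / 2 * l n ≤ |psum H (X' 0) (u' 0) 0 M ω - M * c|})
        atTop (𝓝 0) :=
      tendsto_measure_le_abs (((h' 0).measurable_psum hH 0 M).sub_const _)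
        ((tendsto_natCast_atTop_atTop.comp hl).const_mul_atTop (by positivity))
    refine h1.congr fun n => ?_
    have hDm : MeasurableSet {r : ℝ | δ / 2 * l n ≤ |r - M * c|} :=
      measurableSet_le measurable_const (by fun_prop)
    have e : ∀ k, μ {ω | psum H (X' k) (u' k) 0 M ω ∈ {r : ℝ | δ / 2 * l n ≤ |r - M * c|}} =
        ∫⁻ x, pathProb ε θ H {r : ℝ | δ / 2 * l n ≤ |r - M * c|} M (x, 0) ∂ν := fun k => by
      rw [(h' k).measure_psum hH hDm, ← hν k, lintegral_map _ ((h' k).measurable_state 0)]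
      exact (measurable_pathProb hH hDm M).comp measurable_prodMk_right
    exact (e 0).trans (e n).symm
  -- the remaining summands are compared with the stationary chain
  have hlM : Tendsto (fun n => l n - M) atTop atTop := tendsto_sub_atTop_nat M |>.comp hl
  have hstat := ((h.shift M).lln_stationary (fun i => hX _) hf hf0 hf1 hε hθ hH
    (H := H) (δ := δ / 2) (hδ := by positivity) (by
      have hid : IdentDistrib (fun ω => (X (M + 0) ω, u (M + 0) ω)) (fun ω => (X 0 ω, u 0 ω)) μ μ :=
        ⟨((h.measurable_state _).prodMk (h.measurable_innov _)).aemeasurable,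
          ((h.measurable_state 0).prodMk (h.measurable_innov 0)).aemeasurable,
          by rw [h.map_pair, h.map_pair, hX, hX]⟩
      exact (hid.comp hH).integrable_iff.2 hHi)).comp hlM
  have hcM : ∫ ω, H (X (M + 0) ω, u (M + 0) ω) ∂μ = c := by
    have hid : IdentDistrib (fun ω => (X (M + 0) ω, u (M + 0) ω)) (fun ω => (X 0 ω, u 0 ω)) μ μ :=
      ⟨((h.measurable_state _).prodMk (h.measurable_innov _)).aemeasurable,
        ((h.measurable_state 0).prodMk (h.measurable_innov 0)).aemeasurable,
        by rw [h.map_pair, h.map_pair, hX, hX]⟩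
    exact (hid.comp hH).integral_eq
  rw [hcM] at hstat
  have htrans : ∀ n N, μ {ω | δ / 2 * N ≤ |psum H (X' n) (u' n) M N ω - N * c|} ≤
      μ {ω | δ / 2 * N ≤ |psum H X u M N ω - N * c|} + η / 3 := by
    intro n N
    have hDm : MeasurableSet {r : ℝ | δ / 2 * N ≤ |r - N * c|} :=
      measurableSet_le measurable_const (by fun_prop)
    have e1 := (h' n).measure_psum hH hDm N M
    have e2 := h.measure_psum hH hDm N M
    set V : (Fin p → ℝ) → ℝ≥0∞ := fun x =>
      pathProb ε θ H {r : ℝ | δ / 2 * N ≤ |r - N * c|} N (x, 0) with hV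
    have hVm : Measurable V := (measurable_pathProb hH hDm N).comp measurable_prodMk_right
    have e3 : ∫⁻ ω, V (X' n M ω) ∂μ ≤ ∫⁻ ω, V (X M ω) ∂μ + η / 3 := by
      rw [(h' n).lintegral_state hVm, h.lintegral_state hVm, hν, hX]
      calc ∫⁻ x, (trans ε θ)^[M] V x ∂ν
          ≤ ∫⁻ x, (∫⁻ x', (trans ε θ)^[M] V x' ∂π +
            ∫⁻ x', mergeBound f θ p ((fun d => step θ d 0)^[m] (x - x')) ∂π) ∂ν :=
            lintegral_mono fun x =>
              lintegral_trans_iterate_le hf hf0 hε hVm (fun x => pathProb_le_one _ _) m x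
        _ = ∫⁻ x', (trans ε θ)^[M] V x' ∂π + discrep f θ ν π m := by
            rw [lintegral_add_left measurable_const, lintegral_const, measure_univ, mul_one]
            rfl
        _ ≤ _ := by gcongr
    calc _ = ∫⁻ ω, V (X' n M ω) ∂μ := e1
      _ ≤ _ := e3
      _ = _ := by rw [← e2]; rfl
  filter_upwards [ENNReal.tendsto_nhds_zero.1 hfirst _ hη3, ENNReal.tendsto_nhds_zero.1 hstat _ hη3,
    hl.eventually_ge_atTop M] with n hn1 hn2 hn3
  obtain ⟨N, hN⟩ : ∃ N, l n = M + N := ⟨l n - M, by omega⟩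
  have hN2 : l n - M = N := by omega
  simp only [Function.comp_apply, hN2] at hn2
  have hn2' : μ {ω | δ / 2 * N ≤ |psum H X u M N ω - N * c|} ≤ η / 3 := by
    refine le_trans (le_of_eq ?_) hn2
    simp [psum]
  have hsplit : ∀ ω, psum H (X' n) (u' n) 0 (l n) ω =
      psum H (X' n) (u' n) 0 M ω + psum H (X' n) (u' n) M N ω := fun ω => by
    simp only [psum, hN, Finset.sum_range_add, zero_add]
  have hsub : {ω | δ * l n ≤ |psum H (X' n) (u' n) 0 (l n) ω - l n * c|} ⊆
      {ω | δ / 2 * l n ≤ |psum H (X' n) (u' n) 0 M ω - M * c|} ∪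
      {ω | δ / 2 * N ≤ |psum H (X' n) (u' n) M N ω - N * c|} := by
    intro ω hω
    by_contra hcon
    simp only [Set.mem_union, Set.mem_ofPred_eq, not_or, not_le] at hcon hω
    rw [hsplit, show (psum H (X' n) (u' n) 0 M ω + psum H (X' n) (u' n) M N ω - l n * c : ℝ) =
      (psum H (X' n) (u' n) 0 M ω - M * c) + (psum H (X' n) (u' n) M N ω - N * c) by
        rw [hN]; push_cast; ring] at hω
    have h4 := abs_add_le (psum H (X' n) (u' n) 0 M ω - M * c)
      (psum H (X' n) (u' n) M N ω - N * c)
    have h5 : (N : ℝ) ≤ l n := by rw [hN]; push_cast; linarith [(Nat.cast_nonneg M : (0:ℝ) ≤ M)]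
    nlinarith [hcon.1, hcon.2]
  calc _ ≤ _ := measure_mono hsub
    _ ≤ _ := measure_union_le _ _
    _ ≤ η / 3 + (η / 3 + η / 3) := add_le_add hn1 ((htrans n N).trans (by gcongr))
    _ = η := by rw [← add_assoc, ENNReal.add_thirds]

end ARChain

end

/-! ### Means of the scores -/

section

variable {p : ℕ}

/-- The component of the moment function in the direction `d` of the lag coordinates, as a
function of the lag vector `x` and the innovation `u`, when the true parameter is `θ`. -/
noncomputable def score (w : (Fin p → ℝ) → ℝ) (θ β d : Fin p → ℝ) (q : (Fin p → ℝ) × ℝ) : ℝ :=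
  ((1 / 2 : ℝ) - if q.2 ≤ q.1 ⬝ᵥ (β - θ) then 1 else 0) * (w q.1 * (q.1 ⬝ᵥ d))

/-- A bound for the oscillation of the score over the ball of radius `δ` around `β`. -/
noncomputable def scoreOsc (w : (Fin p → ℝ) → ℝ) (θ β d : Fin p → ℝ) (δ : ℝ)
    (q : (Fin p → ℝ) × ℝ) : ℝ :=
  if |q.2 - q.1 ⬝ᵥ (β - θ)| ≤ δ * ∑ j, |q.1 j| then |w q.1 * (q.1 ⬝ᵥ d)| else 0

lemma abs_dotProduct_le {x v : Fin p → ℝ} {δ : ℝ} (hv : ‖v‖ ≤ δ) :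
    |x ⬝ᵥ v| ≤ δ * ∑ j, |x j| := by
  calc |x ⬝ᵥ v| ≤ ∑ j, |x j * v j| := Finset.abs_sum_le_sum_abs _ _
    _ ≤ ∑ j, δ * |x j| := Finset.sum_le_sum fun j _ => by
        rw [abs_mul, mul_comm]
        have := (norm_le_pi_norm v j).trans hv
        rw [Real.norm_eq_abs] at this
        gcongr
    _ = _ := (Finset.mul_sum _ _ _).symm

lemma score_sub_scoreOsc_le {w : (Fin p → ℝ) → ℝ} {θ β β' d : Fin p → ℝ} {δ : ℝ}
    (h : ‖β' - β‖ ≤ δ) (q : (Fin p → ℝ) × ℝ) :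
    score w θ β d q - scoreOsc w θ β d δ q ≤ score w θ β' d q := by
  have h1 := abs_le.1 (abs_dotProduct_le (x := q.1) h)
  have h2 : q.1 ⬝ᵥ (β' - θ) = q.1 ⬝ᵥ (β - θ) + q.1 ⬝ᵥ (β' - β) := by
    rw [← dotProduct_add]; congr 1; abel
  have h3 := abs_le.1 (le_refl |w q.1 * (q.1 ⬝ᵥ d)|)
  have h4 := abs_nonneg (w q.1 * (q.1 ⬝ᵥ d))
  unfold score scoreOsc
  by_cases ha : q.2 ≤ q.1 ⬝ᵥ (β - θ) <;> by_cases hb : q.2 ≤ q.1 ⬝ᵥ (β' - θ)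
  · simp only [ha, hb, if_true]; split_ifs <;> linarith
  · have : |q.2 - q.1 ⬝ᵥ (β - θ)| ≤ δ * ∑ j, |q.1 j| := by
      rw [abs_le]; constructor <;> linarith
    simp only [ha, hb, this, if_true, if_false]
    linarith [h3.1]
  · have : |q.2 - q.1 ⬝ᵥ (β - θ)| ≤ δ * ∑ j, |q.1 j| := by
      rw [abs_le]; constructor <;> linarith
    simp only [ha, hb, this, if_true, if_false]
    linarith [h3.2]
  · simp only [ha, hb, if_false]; split_ifs <;> linarith

lemma score_sq_le (w : (Fin p → ℝ) → ℝ) (θ β d : Fin p → ℝ) (q : (Fin p → ℝ) × ℝ) :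
    score w θ β d q ^ 2 ≤ (w q.1 * (q.1 ⬝ᵥ d)) ^ 2 := by
  rw [score, mul_pow]
  refine mul_le_of_le_one_left (sq_nonneg _) ?_
  split_ifs <;> norm_num

lemma measurable_dotProduct_const (v : Fin p → ℝ) : Measurable fun x : Fin p → ℝ => x ⬝ᵥ v := by
  simp only [dotProduct]; fun_prop

section

variable {w : (Fin p → ℝ) → ℝ}

lemma measurable_weighted (hw : Measurable w) (d : Fin p → ℝ) :
    Measurable fun q : (Fin p → ℝ) × ℝ => w q.1 * (q.1 ⬝ᵥ d) :=
  (hw.mul (measurable_dotProduct_const d)).comp measurable_fst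

lemma measurable_score (hw : Measurable w) (θ β d : Fin p → ℝ) : Measurable (score w θ β d) := by
  refine (measurable_const.sub (Measurable.ite ?_ measurable_const measurable_const)).mul
    (measurable_weighted hw d)
  exact measurableSet_le measurable_snd ((measurable_dotProduct_const _).comp measurable_fst)

lemma measurable_scoreOsc (hw : Measurable w) (θ β d : Fin p → ℝ) (δ : ℝ) :
    Measurable (scoreOsc w θ β d δ) := by
  refine Measurable.ite ?_ (measurable_weighted hw d).abs measurable_const
  refine measurableSet_le
    (measurable_snd.sub ((measurable_dotProduct_const _).comp measurable_fst)).abs ?_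
  fun_prop

variable {π : Measure (Fin p → ℝ)} [IsProbabilityMeasure π] {ε : Measure ℝ}
  [IsProbabilityMeasure ε]

lemma integrable_weighted (hw : Measurable w) {d : Fin p → ℝ}
    (hQ : Integrable (fun x => (w x * (x ⬝ᵥ d)) ^ 2) π) :
    Integrable (fun q : (Fin p → ℝ) × ℝ => |w q.1 * (q.1 ⬝ᵥ d)|) (π.prod ε) := by
  have h1 : Integrable (fun x => w x * (x ⬝ᵥ d)) π := by
    refine ((integrable_const (1 : ℝ)).add hQ).mono'
      (hw.mul (measurable_dotProduct_const d)).aestronglyMeasurable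
      (Eventually.of_forall fun x => ?_)
    simp only [Pi.add_apply, Real.norm_eq_abs]
    nlinarith [sq_abs (w x * (x ⬝ᵥ d)), sq_nonneg (|w x * (x ⬝ᵥ d)| - 1)]
  exact (h1.comp_fst ε).abs

lemma integrable_score (hw : Measurable w) {d : Fin p → ℝ}
    (hQ : Integrable (fun x => (w x * (x ⬝ᵥ d)) ^ 2) π) (θ β : Fin p → ℝ) :
    Integrable (score w θ β d) (π.prod ε) := by
  refine (integrable_weighted hw hQ).mono' (measurable_score hw θ β d).aestronglyMeasurable
    (Eventually.of_forall fun q => ?_)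
  rw [Real.norm_eq_abs]
  exact sq_le_sq.1 (score_sq_le w θ β d q)

lemma integrable_scoreOsc (hw : Measurable w) {d : Fin p → ℝ}
    (hQ : Integrable (fun x => (w x * (x ⬝ᵥ d)) ^ 2) π) (θ β : Fin p → ℝ) (δ : ℝ) :
    Integrable (scoreOsc w θ β d δ) (π.prod ε) := by
  refine (integrable_weighted hw hQ).mono' (measurable_scoreOsc hw θ β d δ).aestronglyMeasurable
    (Eventually.of_forall fun q => ?_)
  rw [Real.norm_eq_abs, scoreOsc]
  split_ifs
  · rw [abs_abs]
  · rw [abs_zero]; exact abs_nonneg _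

/-- The oscillation has small mean on small balls since the innovations have no atoms. -/
lemma tendsto_integral_scoreOsc [NullSingletonClass ε] (hw : Measurable w) {d : Fin p → ℝ}
    (hQ : Integrable (fun x => (w x * (x ⬝ᵥ d)) ^ 2) π) (θ β : Fin p → ℝ) :
    Tendsto (fun k : ℕ => ∫ q, scoreOsc w θ β d (1 / ((k : ℝ) + 1)) q ∂(π.prod ε)) atTop (𝓝 0) := by
  rw [show (0 : ℝ) = ∫ _, (0 : ℝ) ∂(π.prod ε) by simp]
  refine tendsto_integral_of_dominated_convergence (fun q => |w q.1 * (q.1 ⬝ᵥ d)|)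
    (fun k => (measurable_scoreOsc hw θ β d _).aestronglyMeasurable) (integrable_weighted hw hQ)
    (fun k => Eventually.of_forall fun q => ?_) ?_
  · rw [Real.norm_eq_abs, scoreOsc]
    split_ifs
    · rw [abs_abs]
    · rw [abs_zero]; exact abs_nonneg _
  · have hS : MeasurableSet {q : (Fin p → ℝ) × ℝ | q.2 = q.1 ⬝ᵥ (β - θ)} :=
      measurableSet_eq_fun measurable_snd ((measurable_dotProduct_const _).comp measurable_fst)
    have hnull : (π.prod ε) {q : (Fin p → ℝ) × ℝ | q.2 = q.1 ⬝ᵥ (β - θ)} = 0 := by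
      rw [Measure.measure_prod_null hS]
      refine Eventually.of_forall fun x => ?_
      have : Prod.mk x ⁻¹' {q : (Fin p → ℝ) × ℝ | q.2 = q.1 ⬝ᵥ (β - θ)} = {x ⬝ᵥ (β - θ)} := by
        ext v; simp
      change ε (Prod.mk x ⁻¹' {q : (Fin p → ℝ) × ℝ | q.2 = q.1 ⬝ᵥ (β - θ)}) = 0
      rw [this]; simp
    have hae : ∀ᵐ q ∂(π.prod ε), q.2 ≠ q.1 ⬝ᵥ (β - θ) := by
      rw [ae_iff]; simpa using hnull
    filter_upwards [hae] with q hq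
    have hpos : 0 < |q.2 - q.1 ⬝ᵥ (β - θ)| := abs_pos.2 (sub_ne_zero.2 hq)
    have hlim : Tendsto (fun k : ℕ => 1 / ((k : ℝ) + 1) * ∑ j, |q.1 j|) atTop (𝓝 0) := by
      simpa using tendsto_one_div_add_atTop_nhds_zero_nat.mul_const (∑ j, |q.1 j|)
    refine tendsto_const_nhds.congr' ?_
    filter_upwards [hlim.eventually_lt_const hpos] with k hk
    rw [scoreOsc, if_neg (not_le.2 hk)]

lemma integral_half_sub_indicator (z : ℝ) :
    ∫ v, ((1 / 2 : ℝ) - if v ≤ z then 1 else 0) ∂ε = 1 / 2 - ε.real (Set.Iic z) := by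
  have h1 : (fun v : ℝ => if v ≤ z then (1 : ℝ) else 0) = (Set.Iic z).indicator 1 := by
    ext v; simp [Set.indicator_apply]
  have h2 : Integrable (fun v : ℝ => if v ≤ z then (1 : ℝ) else 0) ε := by
    rw [h1]; exact (integrable_const (1 : ℝ)).indicator measurableSet_Iic
  rw [integral_sub (integrable_const _) h2, h1, integral_indicator_one measurableSet_Iic]
  simp

lemma integral_score (hw : Measurable w) {d : Fin p → ℝ}
    (hQ : Integrable (fun x => (w x * (x ⬝ᵥ d)) ^ 2) π) (θ β : Fin p → ℝ) :
    ∫ q, score w θ β d q ∂(π.prod ε) =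
      ∫ x, ((1 / 2 : ℝ) - ε.real (Set.Iic (x ⬝ᵥ (β - θ)))) * (w x * (x ⬝ᵥ d)) ∂π := by
  rw [integral_prod _ (integrable_score hw hQ θ β)]
  refine integral_congr_ae (Eventually.of_forall fun x => ?_)
  simp only [score]
  rw [integral_mul_const]
  congr 1
  exact integral_half_sub_indicator _

/-- At the true parameter the score has mean zero. -/
lemma integral_score_self (hw : Measurable w) {d : Fin p → ℝ}
    (hQ : Integrable (fun x => (w x * (x ⬝ᵥ d)) ^ 2) π) (h0 : ε.real (Set.Iic 0) = 1 / 2)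
    (θ : Fin p → ℝ) : ∫ q, score w θ θ d q ∂(π.prod ε) = 0 := by
  rw [integral_score hw hQ]
  simp [h0]

/-- At a wrong parameter `β` the score in the direction of the true one has positive mean. -/
lemma integral_score_pos (hw : Measurable w) (hw0 : ∀ x, 0 < w x) {θ β : Fin p → ℝ}
    (hQ : Integrable (fun x => (w x * (x ⬝ᵥ (θ - β))) ^ 2) π)
    (hF : ∀ z ≠ 0, 0 < (ε.real (Set.Iic z) - 1 / 2) * z)
    (hnd : ¬ ∀ᵐ x ∂π, x ⬝ᵥ (θ - β) = 0) : 0 < ∫ q, score w θ β (θ - β) q ∂(π.prod ε) := by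
  have hI : Integrable (fun x => ((1 / 2 : ℝ) - ε.real (Set.Iic (x ⬝ᵥ (β - θ)))) *
      (w x * (x ⬝ᵥ (θ - β)))) π := by
    have h1 := (integrable_score (ε := ε) hw hQ θ β).integral_prod_left
    refine h1.congr (Eventually.of_forall fun x => ?_)
    simp only [score]
    rw [integral_mul_const]
    congr 1
    exact integral_half_sub_indicator _
  have heq : ∀ x : Fin p → ℝ, ((1 / 2 : ℝ) - ε.real (Set.Iic (x ⬝ᵥ (β - θ)))) *
      (w x * (x ⬝ᵥ (θ - β))) =
      w x * ((ε.real (Set.Iic (x ⬝ᵥ (β - θ))) - 1 / 2) * (x ⬝ᵥ (β - θ))) := fun x => by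
    rw [← neg_sub β θ, dotProduct_neg]; ring
  rw [integral_score hw hQ]
  simp_rw [heq] at hI ⊢
  have hpos : ∀ x : Fin p → ℝ, x ⬝ᵥ (θ - β) ≠ 0 →
      0 < w x * ((ε.real (Set.Iic (x ⬝ᵥ (β - θ))) - 1 / 2) * (x ⬝ᵥ (β - θ))) := fun x hx => by
    refine mul_pos (hw0 x) (hF _ ?_)
    rwa [← neg_sub θ β, dotProduct_neg, neg_ne_zero]
  have hnn : ∀ x : Fin p → ℝ,
      0 ≤ w x * ((ε.real (Set.Iic (x ⬝ᵥ (β - θ))) - 1 / 2) * (x ⬝ᵥ (β - θ))) := fun x => by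
    by_cases hx : x ⬝ᵥ (θ - β) = 0
    · have : x ⬝ᵥ (β - θ) = 0 := by rw [← neg_sub θ β, dotProduct_neg, hx, neg_zero]
      simp [this]
    · exact (hpos x hx).le
  rw [integral_pos_iff_support_of_nonneg hnn hI, pos_iff_ne_zero]
  intro h0
  refine hnd ?_
  rw [ae_iff]
  exact measure_mono_null (fun x hx => (hpos x hx).ne') h0

end

/-! ### The distribution function of the innovations -/

lemma real_Iic_zero_eq_half {ε : Measure ℝ} [IsProbabilityMeasure ε] [NullSingletonClass ε]
    (h1 : 1 / 2 ≤ ε.real (Set.Iic 0)) (h2 : 1 / 2 ≤ ε.real (Set.Ici 0)) :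
    ε.real (Set.Iic 0) = 1 / 2 := by
  have h3 : ε.real (Set.Iic (0 : ℝ))ᶜ = 1 - ε.real (Set.Iic 0) := probReal_compl_eq_one_sub
    measurableSet_Iic
  have h4 : ε.real (Set.Ici (0 : ℝ)) = ε.real (Set.Ioi 0) := by
    rw [measureReal_def, measureReal_def, measure_congr Ioi_ae_eq_Ici]
  rw [Set.compl_Iic, ← h4] at h3
  linarith

/-- The positive derivative at `0` makes `0` the only median. -/
lemma cdf_sub_half_mul_pos {ε : Measure ℝ} [IsProbabilityMeasure ε] {a : ℝ}
    (h0 : ε.real (Set.Iic 0) = 1 / 2) (hd : HasDerivAt (cdf ε) a 0) (ha : 0 < a) {z : ℝ}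
    (hz : z ≠ 0) : 0 < (ε.real (Set.Iic z) - 1 / 2) * z := by
  have hs := (hasDerivAt_iff_tendsto_slope.1 hd).eventually_const_lt ha
  have hmono : ∀ {s t : ℝ}, s ≤ t → ε.real (Set.Iic s) ≤ ε.real (Set.Iic t) := fun hst =>
    measureReal_mono (Set.Iic_subset_Iic.2 hst)
  have hslope : ∀ y : ℝ, slope (cdf ε) 0 y = (ε.real (Set.Iic y) - 1 / 2) / y := fun y => by
    rw [slope_def_field, cdf_eq_real, cdf_eq_real, h0, sub_zero]
  rcases lt_or_gt_of_ne hz with hz | hz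
  · have h1 : ∀ᶠ y in 𝓝[<] (0 : ℝ), 0 < slope (cdf ε) 0 y :=
      hs.filter_mono (nhdsWithin_mono _ fun y hy => ne_of_lt hy)
    obtain ⟨y, hy, hy1, hy2⟩ := (h1.and (Ioo_mem_nhdsLT hz)).exists
    rw [hslope, div_pos_iff] at hy
    have := hmono hy1.le
    rcases hy with hy | hy
    · linarith [hy.2]
    · exact mul_pos_of_neg_of_neg (by linarith [hy.1]) hz
  · have h1 : ∀ᶠ y in 𝓝[>] (0 : ℝ), 0 < slope (cdf ε) 0 y :=
      hs.filter_mono (nhdsWithin_mono _ fun y hy => ne_of_gt hy)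
    obtain ⟨y, hy, hy1, hy2⟩ := (h1.and (Ioo_mem_nhdsGT hz)).exists
    rw [hslope, div_pos_iff] at hy
    have := hmono hy2.le
    rcases hy with hy | hy
    · exact mul_pos (by linarith) hz
    · linarith [hy.2]

end

/-! ### Stationary processes and series with a change as chains -/

section

variable {Ω : Type*} {p : ℕ}

/-- The residual `y_t - X_{t-1}'θ` of a process at the parameter `θ`. -/
def resid (θ : Fin p → ℝ) (y : ℤ → Ω → ℝ) (t : ℤ) (ω : Ω) : ℝ :=
  y t ω - lag p (fun s => y s ω) t ⬝ᵥ θ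

/-- The σ-algebra generated by the observations before time `t`. -/
abbrev past (y : ℤ → Ω → ℝ) (t : ℤ) : MeasurableSpace Ω :=
  ⨆ s ∈ Set.Iio t, MeasurableSpace.comap (y s) inferInstance

/-- The lag vectors generated by the recursion with parameter `θ` from the initial lag
vector `x₀` and the innovations `u`. -/
def driven (θ : Fin p → ℝ) (x₀ : Ω → Fin p → ℝ) (u : ℕ → Ω → ℝ) : ℕ → Ω → Fin p → ℝ
  | 0 => x₀
  | i + 1 => fun ω => step θ (driven θ x₀ u i ω) (u i ω)

lemma lag_add_one (θ : Fin p → ℝ) (y : ℤ → ℝ) (t : ℤ) :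
    lag p y (t + 1) = step θ (lag p y t) (y t - lag p y t ⬝ᵥ θ) := by
  funext j
  simp only [step]
  split_ifs with h
  · simp [lag, h]
  · simp only [lag]
    congr 1
    have := j.2
    omega

lemma measurable_past {y : ℤ → Ω → ℝ} {s t : ℤ} (h : s < t) : Measurable[past y t] (y s) :=
  (comap_measurable (y s)).mono
    (le_iSup₂ (f := fun s (_ : s ∈ Set.Iio t) => MeasurableSpace.comap (y s) inferInstance) s h)
    le_rfl

lemma past_mono {y : ℤ → Ω → ℝ} {s t : ℤ} (h : s ≤ t) : past y s ≤ past y t :=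
  biSup_mono fun _ hr => lt_of_lt_of_le hr h

lemma measurable_lag_past {y : ℤ → Ω → ℝ} (t : ℤ) :
    Measurable[past y t] fun ω => lag p (fun s => y s ω) t :=
  @measurable_pi_lambda _ _ _ (past y t) _ _ fun j => measurable_past (by omega)

variable [mΩ : MeasurableSpace Ω]

lemma ARChain.redrive {μ : Measure Ω} {ε : Measure ℝ} {θ : Fin p → ℝ}
    {𝓕 : ℕ → MeasurableSpace Ω} {X : ℕ → Ω → Fin p → ℝ} {u : ℕ → Ω → ℝ}
    (h : ARChain μ ε θ 𝓕 X u) (θ' : Fin p → ℝ) {x₀ : Ω → Fin p → ℝ} (hx : Measurable[𝓕 0] x₀) :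
    ARChain μ ε θ' 𝓕 (driven θ' x₀ u) u where
  le := h.le
  mono := h.mono
  adapted_zero := hx
  adapted_innov := h.adapted_innov
  law := h.law
  indep := h.indep
  step_eq _ _ := rfl

namespace IsStationaryAR

variable {μ : Measure Ω} {e : ℤ → Ω → ℝ} {θ : Fin p → ℝ}
  {y : ℤ → Ω → ℝ}

lemma resid_ae_eq (hy : IsStationaryAR μ e θ y) (t : ℤ) : resid θ y t =ᵐ[μ] e t := by
  filter_upwards [hy.recursion t] with ω hω
  rw [resid, hω]; ring

lemma chain (hy : IsStationaryAR μ e θ y) {ε : Measure ℝ}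
    (hlaw : ∀ t, μ.map (e t) = ε) (t₀ : ℤ) :
    ARChain μ ε θ (fun i => past y (t₀ + i)) (fun i ω => lag p (fun s => y s ω) (t₀ + i))
      (fun i => resid θ y (t₀ + i)) where
  le i := iSup₂_le fun s _ => (hy.measurable s).comap_le
  mono i j hij := past_mono (by omega)
  adapted_zero := measurable_lag_past _
  adapted_innov i := by
    have h1 : Measurable[past y (t₀ + (i + 1 : ℕ))] (y (t₀ + i)) :=
      measurable_past (by push_cast; omega)
    have h2 : Measurable[past y (t₀ + (i + 1 : ℕ))]
        fun ω => lag p (fun s => y s ω) (t₀ + i) ⬝ᵥ θ :=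
      (measurable_dotProduct_const θ).comp ((measurable_lag_past _).mono
        (past_mono (by push_cast; omega)) le_rfl)
    exact h1.sub h2
  law i := by rw [Measure.map_congr (hy.resid_ae_eq _), hlaw]
  indep i := by
    have h1 := (hy.indep_past (t₀ + i)).symm
    rw [Indep_iff] at h1 ⊢
    rintro A _ hA ⟨S, hS, rfl⟩
    have h2 := h1 A (e (t₀ + i) ⁻¹' S) hA ⟨S, hS, rfl⟩
    have h3 : (resid θ y (t₀ + i) ⁻¹' S : Set Ω) =ᵐ[μ] (e (t₀ + i) ⁻¹' S : Set Ω) := by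
      filter_upwards [hy.resid_ae_eq (t₀ + i)] with ω hω
      change (resid θ y (t₀ + i) ω ∈ S) = (e (t₀ + i) ω ∈ S)
      rw [hω]
    rw [measure_congr h3, measure_congr ((ae_eq_refl A).inter h3)]
    exact h2
  step_eq i ω := by
    rw [Nat.cast_succ, ← add_assoc]
    exact lag_add_one θ _ _

lemma map_lag (hy : IsStationaryAR μ e θ y) (t : ℤ) :
    μ.map (fun ω => lag p (fun s => y s ω) t) = μ.map (fun ω => lag p (fun s => y s ω) 1) := by
  have hm : Measurable fun z : ℤ → ℝ => lag p z 1 :=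
    measurable_pi_lambda _ fun j => measurable_pi_apply _
  have h1 := ((hy.stationary (t - 1)).comp hm).map_eq
  refine Eq.trans ?_ h1
  congr 1
  funext ω j
  simp only [lag, Function.comp_apply]
  congr 1
  ring

end IsStationaryAR

/-- Up to the change the series coincides with the stationary process `y₁`; afterwards its lag
vectors are driven by the parameter `θ₂` and the same innovations, which are the residuals
of `y₁`. -/
lemma IsChangeSeries.ae_eq {μ : Measure Ω} {e : ℤ → Ω → ℝ} {θ₁ θ₂ : Fin p → ℝ}
    {y₁ : ℤ → Ω → ℝ} {n k : ℕ} {y : ℤ → Ω → ℝ} (h : IsChangeSeries μ e θ₁ θ₂ y₁ n k y)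
    (hy : IsStationaryAR μ e θ₁ y₁) (hk : k ≤ n) :
    ∀ᵐ ω ∂μ, (∀ i : ℕ, i < k →
        lag p (fun s => y s ω) (1 + i) = lag p (fun s => y₁ s ω) (1 + i) ∧
        resid θ₁ y (1 + i) ω = resid θ₁ y₁ (1 + i) ω) ∧
      ∀ j : ℕ, k + j < n →
        lag p (fun s => y s ω) (1 + k + j) = driven θ₂ (fun ω => lag p (fun s => y₁ s ω) (1 + k))
          (fun i => resid θ₁ y₁ (1 + k + i)) j ω ∧
        resid θ₂ y (1 + k + j) ω = resid θ₁ y₁ (1 + k + j) ω := by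
  have a1 : ∀ᵐ ω ∂μ, ∀ t : ℤ, 1 - (p : ℤ) ≤ t → t ≤ 0 → y t ω = y₁ t ω :=
    ae_all_iff.2 fun t => by
      simpa only [eventually_imp_distrib_left] using h.init t
  have a2 : ∀ᵐ ω ∂μ, ∀ t : ℤ, 1 ≤ t → t ≤ n → t ≤ k →
      y t ω = lag p (fun s => y s ω) t ⬝ᵥ θ₁ + e t ω :=
    ae_all_iff.2 fun t => by
      simpa only [eventually_imp_distrib_left] using h.before t
  have a3 : ∀ᵐ ω ∂μ, ∀ t : ℤ, 1 ≤ t → t ≤ n → k < t →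
      y t ω = lag p (fun s => y s ω) t ⬝ᵥ θ₂ + e t ω :=
    ae_all_iff.2 fun t => by
      simpa only [eventually_imp_distrib_left] using h.after t
  have a4 : ∀ᵐ ω ∂μ, ∀ t : ℤ, y₁ t ω = lag p (fun s => y₁ s ω) t ⬝ᵥ θ₁ + e t ω :=
    ae_all_iff.2 hy.recursion
  filter_upwards [a1, a2, a3, a4] with ω b1 b2 b3 b4
  have hagree : ∀ m : ℕ, m ≤ k → ∀ t : ℤ, 1 - (p : ℤ) ≤ t → t ≤ m → y t ω = y₁ t ω := by
    intro m
    induction m with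
    | zero => exact fun _ t h1 h2 => b1 t h1 (by simpa using h2)
    | succ m ih =>
      intro hm t h1 h2
      push_cast at h2
      rcases (show t ≤ m ∨ t = m + 1 by omega) with h3 | rfl
      · exact ih (by omega) t h1 h3
      · have hlag : lag p (fun s => y s ω) (m + 1) = lag p (fun s => y₁ s ω) (m + 1) := by
          funext j
          have := j.2
          exact ih (by omega) _ (by omega) (by omega)
        rw [b2 _ (by omega) (by omega) (by omega), b4, hlag]
  have hlag : ∀ i : ℕ, i ≤ k →
      lag p (fun s => y s ω) (1 + i) = lag p (fun s => y₁ s ω) (1 + i) := fun i hi => by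
    funext j
    have := j.2
    exact hagree k le_rfl _ (by omega) (by omega)
  have hres : ∀ j : ℕ, k + j < n → resid θ₂ y (1 + k + j) ω = resid θ₁ y₁ (1 + k + j) ω :=
    fun j hj => by
      rw [resid, resid, b3 _ (by omega) (by omega) (by omega), b4]; ring
  refine ⟨fun i hi => ⟨hlag i hi.le, ?_⟩, fun j hj => ⟨?_, hres j hj⟩⟩
  · rw [resid, resid, hlag i hi.le, hagree k le_rfl _ (by omega) (by omega)]
  · induction j with
    | zero => simpa [driven] using hlag k le_rfl
    | succ j ih =>
      rw [driven]
      beta_reduce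
      rw [← ih (by omega), ← hres j (by omega), Nat.cast_succ, ← add_assoc]
      exact lag_add_one θ₂ _ _

end

/-! ### Consequences of the moment assumptions -/

section

variable {p q : ℕ}

/-- The linear functional `v ↦ ∑ d_j v_j` of the lag coordinates of a moment vector. -/
def lagForm (q : ℕ) (d : Fin p → ℝ) : EuclideanSpace ℝ (Fin p ⊕ Fin q) →ₗ[ℝ] ℝ where
  toFun v := ∑ j, v (Sum.inl j) * d j
  map_add' v v' := by simp [add_mul, Finset.sum_add_distrib]
  map_smul' c v := by simp [mul_assoc, Finset.mul_sum]

lemma lagForm_moment (w : (Fin p → ℝ) → ℝ) (φ : (Fin p → ℝ) → (Fin q → ℝ)) (y : ℤ → ℝ) (t : ℤ)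
    (θ β d : Fin p → ℝ) : lagForm q d (moment w φ y t β) =
      score w θ β d (lag p y t, y t - lag p y t ⬝ᵥ θ) := by
  have h1 : y t - lag p y t ⬝ᵥ β ≤ 0 ↔ y t - lag p y t ⬝ᵥ θ ≤ lag p y t ⬝ᵥ (β - θ) := by
    rw [dotProduct_sub]; constructor <;> intro h <;> linarith
  have h2 : lagForm q d (wInstr w φ (lag p y t)) = w (lag p y t) * (lag p y t ⬝ᵥ d) := by
    simp [lagForm, wInstr, instr, dotProduct, Finset.mul_sum]
  rw [moment, map_smul, h2, smul_eq_mul, score]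
  congr 2
  by_cases hc : y t - lag p y t ⬝ᵥ β ≤ 0
  · rw [if_pos hc, if_pos (h1.1 hc)]
  · rw [if_neg hc, if_neg fun h => hc (h1.2 h)]

lemma sq_dotProduct_le_norm_instr (φ : (Fin p → ℝ) → (Fin q → ℝ)) (x d : Fin p → ℝ) :
    (x ⬝ᵥ d) ^ 2 ≤ (∑ j, d j ^ 2) * ‖instr φ x‖ ^ 2 := by
  have h1 : (x ⬝ᵥ d) ^ 2 ≤ (∑ j, x j ^ 2) * ∑ j, d j ^ 2 :=
    Finset.sum_mul_sq_le_sq_mul_sq _ _ _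
  have h2 : ∑ j, x j ^ 2 ≤ ‖instr φ x‖ ^ 2 := by
    rw [EuclideanSpace.norm_sq_eq, Fintype.sum_sum_type]
    simp only [instr, Sum.elim_inl, Sum.elim_inr, Real.norm_eq_abs, sq_abs]
    linarith [Finset.sum_nonneg fun (j : Fin q) (_ : j ∈ Finset.univ) => sq_nonneg (φ x j)]
  have h3 : 0 ≤ ∑ j, d j ^ 2 := Finset.sum_nonneg fun j _ => sq_nonneg _
  nlinarith

lemma norm_sq_wInstr_le {w : (Fin p → ℝ) → ℝ} (hw0 : ∀ x, 0 < w x)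
    (φ : (Fin p → ℝ) → (Fin q → ℝ)) (x : Fin p → ℝ) :
    w x ^ 2 * ‖instr φ x‖ ^ 2 ≤
      (w x + w x ^ 2) * (‖instr φ x‖ ^ 2 + ‖instr φ x‖ ^ 3) := by
  have := hw0 x
  gcongr
  · linarith
  · linarith [pow_nonneg (norm_nonneg (instr φ x)) 3]

namespace MomentMixing

variable {Ω : Type*} [MeasurableSpace Ω] {μ : Measure Ω} {e : ℤ → Ω → ℝ}
  {w : (Fin p → ℝ) → ℝ} {φ : (Fin p → ℝ) → (Fin q → ℝ)} {θ : Fin p → ℝ} {y : ℤ → Ω → ℝ}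

lemma integrable_sq (h : MomentMixing μ e w φ θ y) (hw : Measurable w) (hw0 : ∀ x, 0 < w x)
    (hy : ∀ t, Measurable (y t)) (d : Fin p → ℝ) :
    Integrable (fun x => (w x * (x ⬝ᵥ d)) ^ 2) (μ.map fun ω => lag p (fun s => y s ω) 1) := by
  have hm : Measurable fun x : Fin p → ℝ => (w x * (x ⬝ᵥ d)) ^ 2 :=
    (hw.mul (measurable_dotProduct_const d)).pow_const 2
  have hX : Measurable fun ω => lag p (fun s => y s ω) 1 :=
    measurable_pi_lambda _ fun j => hy _
  rw [integrable_map_measure hm.aestronglyMeasurable hX.aemeasurable]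
  refine ((h.weighted_moments 1).const_mul (∑ j, d j ^ 2)).mono'
    (hm.comp hX).aestronglyMeasurable (Eventually.of_forall fun ω => ?_)
  have h3 : 0 ≤ ∑ j, d j ^ 2 := Finset.sum_nonneg fun j _ => sq_nonneg _
  simp only [Function.comp_apply]
  rw [Real.norm_eq_abs, abs_of_nonneg (sq_nonneg _), mul_pow]
  set x := lag p (fun s => y s ω) 1
  calc w x ^ 2 * (x ⬝ᵥ d) ^ 2 ≤ w x ^ 2 * ((∑ j, d j ^ 2) * ‖instr φ x‖ ^ 2) := by
        gcongr; exact sq_dotProduct_le_norm_instr φ x d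
    _ = (∑ j, d j ^ 2) * (w x ^ 2 * ‖instr φ x‖ ^ 2) := by ring
    _ ≤ _ := mul_le_mul_of_nonneg_left (norm_sq_wInstr_le hw0 φ x) h3

/-- Otherwise the covariance matrix of the moments would annihilate the vector with lag
coordinates `d` and the other coordinates `0`. -/
lemma not_ae_dotProduct_eq_zero (h : MomentMixing μ e w φ θ y) (hw : Measurable w)
    (hw0 : ∀ x, 0 < w x) (hφ : Measurable φ) (hy : ∀ t, Measurable (y t)) {d : Fin p → ℝ}
    (hd : d ≠ 0) : ¬ ∀ᵐ x ∂(μ.map fun ω => lag p (fun s => y s ω) 1), x ⬝ᵥ d = 0 := by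
  intro hae
  have hX : Measurable fun ω => lag p (fun s => y s ω) 1 :=
    measurable_pi_lambda _ fun j => hy _
  have hae' := ae_of_ae_map hX.aemeasurable hae
  set g : Fin p ⊕ Fin q → Ω → ℝ := fun i ω => moment w φ (fun s => y s ω) 1 θ i with hg
  have hgm : ∀ i, Measurable (g i) := fun i => by
    have h1 : Measurable fun ω => wInstr w φ (lag p (fun s => y s ω) 1) i := by
      rcases i with j | j
      · exact (hw.comp hX).mul ((measurable_pi_apply j).comp hX)
      · exact (hw.comp hX).mul ((measurable_pi_apply j).comp (hφ.comp hX))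
    refine Measurable.mul (measurable_const.sub (Measurable.ite ?_ measurable_const
      measurable_const)) h1
    exact measurableSet_le ((hy 1).sub ((measurable_dotProduct_const θ).comp hX)) measurable_const
  have hbound : ∀ i ω, |g i ω| ≤ w (lag p (fun s => y s ω) 1) *
      ‖instr φ (lag p (fun s => y s ω) 1)‖ := fun i ω => by
    have h1 := PiLp.norm_apply_le (moment w φ (fun s => y s ω) 1 θ) i
    rw [Real.norm_eq_abs] at h1
    refine h1.trans ?_
    rw [moment, wInstr, norm_smul, norm_smul, Real.norm_eq_abs, Real.norm_eq_abs,
      abs_of_pos (hw0 _)]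
    refine mul_le_of_le_one_left (mul_nonneg (hw0 _).le (norm_nonneg _)) ?_
    split_ifs <;> norm_num [abs_le]
  have hgi : ∀ i j, Integrable (fun ω => g i ω * g j ω) μ := fun i j => by
    refine (h.weighted_moments 1).mono' ((hgm i).mul (hgm j)).aestronglyMeasurable
      (Eventually.of_forall fun ω => ?_)
    rw [Real.norm_eq_abs, abs_mul]
    refine le_trans ?_ (norm_sq_wInstr_le hw0 φ (lag p (fun s => y s ω) 1))
    rw [← mul_pow, sq]
    exact mul_le_mul (hbound i ω) (hbound j ω) (abs_nonneg _)
      (mul_nonneg (hw0 _).le (norm_nonneg _))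
  set v : Fin p ⊕ Fin q → ℝ := Sum.elim d 0 with hv
  have hv0 : v ≠ 0 := fun h0 => hd (funext fun j => by simpa [hv] using congrFun h0 (Sum.inl j))
  have hpos := (h.posDef 1).dotProduct_mulVec_pos hv0
  have hMv : (Matrix.of fun i j : Fin p ⊕ Fin q => ∫ ω, g i ω * g j ω ∂μ) *ᵥ v = 0 := by
    funext i
    have h1 : ∫ ω, ∑ j, g i ω * g j ω * v j ∂μ = 0 := by
      rw [show (0 : ℝ) = ∫ _, (0 : ℝ) ∂μ by simp]
      refine integral_congr_ae ?_
      filter_upwards [hae'] with ω hω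
      have h2 : ∑ j, g j ω * v j = lagForm q d (moment w φ (fun s => y s ω) 1 θ) := by
        rw [Fintype.sum_sum_type]
        simp [hv, hg, lagForm]
      simp_rw [mul_assoc]
      rw [← Finset.mul_sum, h2, lagForm_moment w φ _ _ θ, score]
      simp only
      rw [hω]; simp
    rw [integral_finsetSum _ fun j _ => (hgi i j).mul_const _] at h1
    simp_rw [integral_mul_const] at h1
    simpa [Matrix.mulVec, dotProduct] using h1
  change 0 < star v ⬝ᵥ ((Matrix.of fun i j : Fin p ⊕ Fin q => ∫ ω, g i ω * g j ω ∂μ) *ᵥ v) at hpos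
  rw [hMv, dotProduct_zero] at hpos
  exact lt_irrefl _ hpos

end MomentMixing

end

/-! ### Sums along the series with a change -/

section

variable {Ω : Type*} [mΩ : MeasurableSpace Ω] {p : ℕ}

/-- The events `P n` hold with probability tending to one. -/
def Whp (μ : Measure Ω) (P : ℕ → Ω → Prop) : Prop :=
  Tendsto (fun n => μ {ω | ¬ P n ω}) atTop (𝓝 0)

namespace Whp

variable {μ : Measure Ω} {P Q : ℕ → Ω → Prop}

lemma mono (hP : Whp μ P) (h : ∀ᶠ n in atTop, ∀ᵐ ω ∂μ, P n ω → Q n ω) : Whp μ Q := by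
  refine tendsto_of_tendsto_of_tendsto_of_le_of_le' tendsto_const_nhds hP
    (Eventually.of_forall fun _ => zero_le) ?_
  filter_upwards [h] with n hn
  refine measure_mono_ae ?_
  filter_upwards [hn] with ω hω hq hp
  exact hq (hω hp)

lemma and (hP : Whp μ P) (hQ : Whp μ Q) : Whp μ fun n ω => P n ω ∧ Q n ω := by
  have h1 := Tendsto.add hP hQ
  rw [add_zero] at h1
  refine tendsto_of_tendsto_of_tendsto_of_le_of_le tendsto_const_nhds h1 (fun _ => zero_le)
    fun n => ?_
  refine le_trans (measure_mono fun ω hω => ?_) (measure_union_le _ _)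
  exact not_and_or.1 hω

end Whp

/-- The law of large numbers with the normalization `n`, for sums of length `l n ∼ ρ n`. -/
lemma ARChain.lln_scaled {μ : Measure Ω} [IsProbabilityMeasure μ] {f : ℝ → ℝ} {ε : Measure ℝ}
    [IsProbabilityMeasure ε] {θ : Fin p → ℝ} {𝓕 : ℕ → MeasurableSpace Ω}
    {X : ℕ → Ω → Fin p → ℝ} {u : ℕ → Ω → ℝ} {π : Measure (Fin p → ℝ)}
    (h : ARChain μ ε θ 𝓕 X u) (hX : ∀ i, μ.map (X i) = π)
    (hf : Measurable f) (hf0 : ∀ x, 0 ≤ f x) (hf1 : ∫⁻ u, ‖f u‖ₑ = 1)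
    (hε : ε = volume.withDensity fun x => ENNReal.ofReal (f x))
    (hθ : ∀ z : ℂ, ‖z‖ ≤ 1 → 1 - ∑ j : Fin p, (θ j : ℂ) * z ^ ((j : ℕ) + 1) ≠ 0)
    {H : (Fin p → ℝ) × ℝ → ℝ} (hH : Measurable H) (hHi : Integrable H (π.prod ε))
    {𝓖 : ℕ → ℕ → MeasurableSpace Ω} {X' : ℕ → ℕ → Ω → Fin p → ℝ} {u' : ℕ → ℕ → Ω → ℝ}
    (h' : ∀ n, ARChain μ ε θ (𝓖 n) (X' n) (u' n)) {ν : Measure (Fin p → ℝ)}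
    (hν : ∀ n, μ.map (X' n 0) = ν) {l : ℕ → ℕ} {ρ : ℝ}
    (hl : Tendsto (fun n => (l n : ℝ) / n) atTop (𝓝 ρ))
    (hρ : 0 < ρ ∨ ρ = 0 ∧ ∀ᶠ n in atTop, l n = 0) {δ : ℝ} (hδ : 0 < δ) :
    Whp μ fun n ω => |psum H (X' n) (u' n) 0 (l n) ω - n * (ρ * ∫ q, H q ∂(π.prod ε))| ≤ δ * n := by
  have hpm : Measurable fun ω => (X 0 ω, u 0 ω) :=
    (h.measurable_state 0).prodMk (h.measurable_innov 0)
  have hmap := h.map_pair 0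
  rw [hX] at hmap
  have hc : ∫ ω, H (X 0 ω, u 0 ω) ∂μ = ∫ q, H q ∂(π.prod ε) := by
    rw [← hmap, integral_map hpm.aemeasurable hH.aestronglyMeasurable]
  have hHi' : Integrable (fun ω => H (X 0 ω, u 0 ω)) μ := by
    rw [← hmap] at hHi
    exact hHi.comp_measurable hpm
  set c := ∫ q, H q ∂(π.prod ε)
  rcases hρ with hρ | ⟨rfl, hl0⟩
  · have hlt : Tendsto l atTop atTop := by
      have h1 : Tendsto (fun n : ℕ => (l n : ℝ) / n * n) atTop atTop :=
        hl.pos_mul_atTop hρ tendsto_natCast_atTop_atTop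
      rw [← tendsto_natCast_atTop_iff (R := ℝ)]
      refine h1.congr' ?_
      filter_upwards [eventually_gt_atTop 0] with n hn
      field_simp
    have hmain := h.lln_of_initial_law hX hf hf0 hf1 hε hθ hH hHi' h' hν hlt
      (δ := δ / (2 * (ρ + 1))) (by positivity)
    rw [hc] at hmain
    have hW : Whp μ fun n ω => |psum H (X' n) (u' n) 0 (l n) ω - l n * c| <
        δ / (2 * (ρ + 1)) * l n := by
      simpa only [Whp, not_lt] using hmain
    have hlc : Tendsto (fun n : ℕ => |((l n : ℝ) / n - ρ) * c|) atTop (𝓝 0) := by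
      have := ((hl.sub_const ρ).mul_const c).abs
      simpa using this
    refine hW.mono ?_
    filter_upwards [hl.eventually_lt_const (show ρ < ρ + 1 by linarith),
      hlc.eventually_lt_const (show (0 : ℝ) < δ / 2 by positivity), eventually_gt_atTop 0]
      with n hn1 hn2 hn0
    refine Eventually.of_forall fun ω hω => ?_
    have hn : (0 : ℝ) < n := by exact_mod_cast hn0
    have e1 : δ / (2 * (ρ + 1)) * l n ≤ δ / 2 * n := by
      rw [div_lt_iff₀ hn] at hn1
      calc δ / (2 * (ρ + 1)) * l n ≤ δ / (2 * (ρ + 1)) * ((ρ + 1) * n) := by gcongr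
        _ = δ / 2 * n := by field_simp
    have e2 : |(l n : ℝ) * c - n * (ρ * c)| ≤ δ / 2 * n := by
      have : (l n : ℝ) * c - n * (ρ * c) = ((l n : ℝ) / n - ρ) * c * n := by field_simp
      rw [this, abs_mul, abs_of_pos hn]
      gcongr
    have e3 := abs_sub_le (psum H (X' n) (u' n) 0 (l n) ω) (l n * c) (n * (ρ * c))
    linarith
  · have htriv : Whp μ fun (_ : ℕ) (_ : Ω) => True := by simp [Whp]
    refine htriv.mono ?_
    filter_upwards [hl0] with n hn
    refine Eventually.of_forall fun ω _ => ?_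
    rw [hn]
    simp only [psum, Finset.range_zero, Finset.sum_empty, zero_mul, mul_zero, sub_zero, abs_zero]
    positivity

/-- The value at time `t` of a function of lag vector and innovation along the series `y`, where
the function is `Φ₁` and the innovation is computed with `θ₁` up to time `k`, and with `Φ₂`, `θ₂`
afterwards. -/
def regimeVal (Φ₁ Φ₂ : (Fin p → ℝ) × ℝ → ℝ) (θ₁ θ₂ : Fin p → ℝ) (k : ℕ) (y : ℤ → ℝ) (t : ℕ) : ℝ :=
  if t ≤ k then Φ₁ (lag p y t, y t - lag p y t ⬝ᵥ θ₁) else Φ₂ (lag p y t, y t - lag p y t ⬝ᵥ θ₂)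

lemma sum_Icc_one_eq_sum_range (z : ℕ → ℝ) (b : ℕ) :
    ∑ t ∈ Finset.Icc 1 b, z t = ∑ i ∈ Finset.range b, z (1 + i) := by
  rw [← Finset.Ico_add_one_right_eq_Icc, Finset.sum_Ico_eq_sum_range, Nat.add_sub_cancel]

lemma sum_Icc_succ_eq_sub (z : ℕ → ℝ) {k n : ℕ} (hkn : k ≤ n) :
    ∑ t ∈ Finset.Icc (k + 1) n, z t =
      ∑ t ∈ Finset.Icc 1 n, z t - ∑ t ∈ Finset.Icc 1 k, z t := by
  obtain ⟨m, rfl⟩ := Nat.exists_eq_add_of_le hkn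
  rw [sum_Icc_one_eq_sum_range, sum_Icc_one_eq_sum_range, Finset.sum_range_add,
    ← Finset.Ico_add_one_right_eq_Icc, Finset.sum_Ico_eq_sum_range]
  have : k + m + 1 - (k + 1) = m := by omega
  rw [this, add_sub_cancel_left]
  refine Finset.sum_congr rfl fun i _ => ?_
  congr 1; omega

section

variable {μ : Measure Ω} {e : ℤ → Ω → ℝ} {f : ℝ → ℝ} {θ₁ θ₂ : Fin p → ℝ}
  {y₁ y₂ : ℤ → Ω → ℝ} {kstar : ℕ → ℕ} {τ : ℝ} {Y : ℕ → ℤ → Ω → ℝ}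

namespace Innovations

lemma nullSingletonClass (_ : Innovations μ e f) :
    NullSingletonClass (volume.withDensity fun x => ENNReal.ofReal (f x)) :=
  ⟨fun x => withDensity_absolutelyContinuous _ _ (measure_singleton x)⟩

variable [IsProbabilityMeasure μ]

lemma isProbabilityMeasure (he : Innovations μ e f) :
    IsProbabilityMeasure (volume.withDensity fun x => ENNReal.ofReal (f x)) :=
  he.law 0 ▸ Measure.isProbabilityMeasure_map (he.measurable 0).aemeasurable

lemma lintegral_enorm (he : Innovations μ e f) : ∫⁻ u, ‖f u‖ₑ = 1 := by
  have h1 := he.isProbabilityMeasure.measure_univ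
  rw [withDensity_apply _ MeasurableSet.univ, Measure.restrict_univ] at h1
  rw [← h1]
  refine lintegral_congr fun u => ?_
  rw [Real.enorm_eq_ofReal_abs, abs_of_nonneg (he.density_nonneg u)]

end Innovations

/-- The law of large numbers for sums over `1, …, b n` with `b n ∼ κ n` along the series with a
change at a fraction `τ ≠ κ`. -/
lemma sum_regimeVal_lln [IsProbabilityMeasure μ] (he : Innovations μ e f)
    (hs₁ : ∀ z : ℂ, ‖z‖ ≤ 1 → 1 - ∑ j : Fin p, (θ₁ j : ℂ) * z ^ ((j : ℕ) + 1) ≠ 0)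
    (hs₂ : ∀ z : ℂ, ‖z‖ ≤ 1 → 1 - ∑ j : Fin p, (θ₂ j : ℂ) * z ^ ((j : ℕ) + 1) ≠ 0)
    (hy₁ : IsStationaryAR μ e θ₁ y₁) (hy₂ : IsStationaryAR μ e θ₂ y₂)
    (hτ₀ : 0 < τ) (hτ₁ : τ < 1) (hk : Tendsto (fun n : ℕ => (kstar n : ℝ) / n) atTop (𝓝 τ))
    (hY : ∀ n, IsChangeSeries μ e θ₁ θ₂ y₁ n (kstar n) (Y n))
    {Φ₁ Φ₂ : (Fin p → ℝ) × ℝ → ℝ} (hm₁ : Measurable Φ₁) (hm₂ : Measurable Φ₂)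
    {P₁ P₂ : Measure ((Fin p → ℝ) × ℝ)}
    (hP₁ : P₁ = (μ.map fun ω => lag p (fun s => y₁ s ω) 1).prod
      (volume.withDensity fun x => ENNReal.ofReal (f x)))
    (hP₂ : P₂ = (μ.map fun ω => lag p (fun s => y₂ s ω) 1).prod
      (volume.withDensity fun x => ENNReal.ofReal (f x)))
    (hi₁ : Integrable Φ₁ P₁) (hi₂ : Integrable Φ₂ P₂)
    {b : ℕ → ℕ} {κ : ℝ} (hb : Tendsto (fun n => (b n : ℝ) / n) atTop (𝓝 κ)) (hκ : 0 < κ)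
    (hκτ : κ ≠ τ) (hbn : ∀ᶠ n in atTop, b n ≤ n) {δ : ℝ} (hδ : 0 < δ) :
    Whp μ fun n ω => |∑ t ∈ Finset.Icc 1 (b n),
        regimeVal Φ₁ Φ₂ θ₁ θ₂ (kstar n) (fun s => Y n s ω) t -
      n * (min κ τ * ∫ q, Φ₁ q ∂P₁ + max (κ - τ) 0 * ∫ q, Φ₂ q ∂P₂)| ≤ δ * n := by
  have hprob := he.isProbabilityMeasure
  have c₁ := hy₁.chain he.law 1
  have c₂ := hy₂.chain he.law 1
  -- after the change: a chain with parameter `θ₂` whose initial law is the stationary one of `θ₁`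
  have c₃ : ∀ n, ARChain μ (volume.withDensity fun x => ENNReal.ofReal (f x)) θ₂
      (fun i => past y₁ (1 + kstar n + i))
      (driven θ₂ (fun ω => lag p (fun s => y₁ s ω) (1 + kstar n))
        (fun i => resid θ₁ y₁ (1 + kstar n + i)))
      (fun i => resid θ₁ y₁ (1 + kstar n + i)) := fun n =>
    (hy₁.chain he.law (1 + kstar n)).redrive θ₂
      ((measurable_lag_past _).mono (past_mono (by simp)) le_rfl)
  have hlmin : Tendsto (fun n => ((min (b n) (kstar n) : ℕ) : ℝ) / n) atTop (𝓝 (min κ τ)) := by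
    refine (hb.min hk).congr fun n => ?_
    rw [Nat.cast_min, min_div_div_right (Nat.cast_nonneg n)]
  have hlmax : Tendsto (fun n => ((b n - kstar n : ℕ) : ℝ) / n) atTop (𝓝 (max (κ - τ) 0)) := by
    refine ((hb.sub hk).max (tendsto_const_nhds (x := (0 : ℝ)))).congr fun n => ?_
    rw [← sub_div, ← zero_div (n : ℝ), max_div_div_right (Nat.cast_nonneg n)]
    congr 1
    rcases le_total (kstar n) (b n) with h | h
    · rw [Nat.cast_sub h, max_eq_left (by rw [sub_nonneg]; exact_mod_cast h)]
    · rw [Nat.sub_eq_zero_of_le h, Nat.cast_zero, max_eq_right]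
      rw [sub_nonpos]; exact_mod_cast h
  have hρ : 0 < max (κ - τ) 0 ∨ max (κ - τ) 0 = 0 ∧ ∀ᶠ n in atTop, b n - kstar n = 0 := by
    rcases lt_or_gt_of_ne hκτ with h | h
    · refine Or.inr ⟨max_eq_right (by linarith), ?_⟩
      filter_upwards [hb.eventually_lt hk h, eventually_gt_atTop 0] with n hn hn0
      rw [div_lt_div_iff_of_pos_right (by exact_mod_cast hn0)] at hn
      have : b n < kstar n := by exact_mod_cast hn
      omega
    · exact Or.inl (lt_max_of_lt_left (by linarith))
  have w₁ := c₁.lln_scaled (fun i => hy₁.map_lag _) he.measurable_density he.density_nonneg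
    he.lintegral_enorm rfl hs₁ hm₁ (hP₁ ▸ hi₁) (fun _ => c₁)
    (fun _ => hy₁.map_lag _) hlmin (Or.inl (lt_min hκ hτ₀)) (δ := δ / 2) (by positivity)
  have w₂ := c₂.lln_scaled (fun i => hy₂.map_lag _) he.measurable_density he.density_nonneg
    he.lintegral_enorm rfl hs₂ hm₂ (hP₂ ▸ hi₂) c₃
    (fun n => hy₁.map_lag (1 + kstar n)) hlmax hρ (δ := δ / 2) (by positivity)
  rw [← hP₁] at w₁
  rw [← hP₂] at w₂
  have hkn : ∀ᶠ n in atTop, kstar n ≤ n := by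
    filter_upwards [hk.eventually_lt_const hτ₁, eventually_gt_atTop 0] with n hn hn0
    rw [div_lt_one (by exact_mod_cast hn0)] at hn
    exact_mod_cast hn.le
  refine (w₁.and w₂).mono ?_
  filter_upwards [hkn, hbn] with n hn hbn
  filter_upwards [(hY n).ae_eq hy₁ hn] with ω hω hw
  have hsum : ∑ t ∈ Finset.Icc 1 (b n), regimeVal Φ₁ Φ₂ θ₁ θ₂ (kstar n) (fun s => Y n s ω) t =
      psum Φ₁ (fun i ω => lag p (fun s => y₁ s ω) (1 + i)) (fun i => resid θ₁ y₁ (1 + i)) 0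
        (min (b n) (kstar n)) ω +
      psum Φ₂ (driven θ₂ (fun ω => lag p (fun s => y₁ s ω) (1 + kstar n))
        (fun i => resid θ₁ y₁ (1 + kstar n + i))) (fun i => resid θ₁ y₁ (1 + kstar n + i)) 0
        (b n - kstar n) ω := by
    have hb' : b n = min (b n) (kstar n) + (b n - kstar n) := by omega
    rw [sum_Icc_one_eq_sum_range]
    conv_lhs => rw [hb', Finset.sum_range_add]
    simp only [psum, zero_add]
    congr 1
    · refine Finset.sum_congr rfl fun i hi => ?_
      have hi' := Finset.mem_range.1 hi
      have h1 := hω.1 i (by omega)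
      rw [regimeVal, if_pos (by omega), ← h1.1, ← h1.2, resid]
      push_cast
      rfl
    · refine Finset.sum_congr rfl fun i hi => ?_
      have hi' := Finset.mem_range.1 hi
      have hmin : min (b n) (kstar n) = kstar n := by omega
      have h1 := hω.2 i (by omega)
      rw [hmin, regimeVal, if_neg (by omega), ← h1.1, ← h1.2, resid]
      push_cast
      rw [← add_assoc]
  rw [hsum]
  have h1 := hw.1
  have h2 := hw.2
  rw [abs_le] at h1 h2 ⊢
  constructor <;> nlinarith [h1.1, h1.2, h2.1, h2.2]

end

end

/-! ### Divergence of the profile likelihood ratio -/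

section

variable {Ω : Type*} [mΩ : MeasurableSpace Ω] {p q : ℕ}

/-- The first (`true`) or second (`false`) of the two blocks into which `1, …, n` is split at
`k`. -/
def block (s : Bool) (k n : ℕ) : Finset ℕ :=
  if s then Finset.Icc 1 k else Finset.Icc (k + 1) n

/-- The asymptotic fraction of times before the change in the block `s`, when the candidate is at
the fraction `κ` and the change at the fraction `τ` of the observations. -/
def fracBefore (κ τ : ℝ) (s : Bool) : ℝ := if s then min κ τ else τ - min κ τ

/-- The asymptotic fraction of times after the change in the block `s`. -/
def fracAfter (κ τ : ℝ) (s : Bool) : ℝ := if s then max (κ - τ) 0 else 1 - τ - max (κ - τ) 0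

/-- The law of large numbers over a block: `Φ₁` has weight `a` and mean under `P₁`, `Φ₂` has
weight `b` and mean under `P₂`. -/
def BlockLLN (μ : Measure Ω) (θ₁ θ₂ : Fin p → ℝ) (kstar k : ℕ → ℕ) (Y : ℕ → ℤ → Ω → ℝ)
    (P₁ P₂ : Measure ((Fin p → ℝ) × ℝ)) (s : Bool) (a b : ℝ) : Prop :=
  ∀ Φ₁ Φ₂ : (Fin p → ℝ) × ℝ → ℝ, Measurable Φ₁ → Measurable Φ₂ → Integrable Φ₁ P₁ →
    Integrable Φ₂ P₂ → ∀ δ : ℝ, 0 < δ → Whp μ fun n ω =>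
      |∑ t ∈ block s (k n) n, regimeVal Φ₁ Φ₂ θ₁ θ₂ (kstar n) (fun s => Y n s ω) t -
        n * (a * ∫ q, Φ₁ q ∂P₁ + b * ∫ q, Φ₂ q ∂P₂)| ≤ δ * n

section

variable {μ : Measure Ω} {e : ℤ → Ω → ℝ} {f : ℝ → ℝ}
  {θ₁ θ₂ : Fin p → ℝ} {y₁ y₂ : ℤ → Ω → ℝ} {kstar k : ℕ → ℕ} {τ κ : ℝ} {Y : ℕ → ℤ → Ω → ℝ}
  {P₁ P₂ : Measure ((Fin p → ℝ) × ℝ)}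

lemma blockLLN [IsProbabilityMeasure μ] (he : Innovations μ e f)
    (hs₁ : ∀ z : ℂ, ‖z‖ ≤ 1 → 1 - ∑ j : Fin p, (θ₁ j : ℂ) * z ^ ((j : ℕ) + 1) ≠ 0)
    (hs₂ : ∀ z : ℂ, ‖z‖ ≤ 1 → 1 - ∑ j : Fin p, (θ₂ j : ℂ) * z ^ ((j : ℕ) + 1) ≠ 0)
    (hy₁ : IsStationaryAR μ e θ₁ y₁) (hy₂ : IsStationaryAR μ e θ₂ y₂)
    (hτ₀ : 0 < τ) (hτ₁ : τ < 1) (hk : Tendsto (fun n : ℕ => (kstar n : ℝ) / n) atTop (𝓝 τ))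
    (hY : ∀ n, IsChangeSeries μ e θ₁ θ₂ y₁ n (kstar n) (Y n))
    (hP₁ : P₁ = (μ.map fun ω => lag p (fun s => y₁ s ω) 1).prod
      (volume.withDensity fun x => ENNReal.ofReal (f x)))
    (hP₂ : P₂ = (μ.map fun ω => lag p (fun s => y₂ s ω) 1).prod
      (volume.withDensity fun x => ENNReal.ofReal (f x)))
    (hb : Tendsto (fun n => (k n : ℝ) / n) atTop (𝓝 κ)) (hκ : 0 < κ) (hκτ : κ ≠ τ)
    (hkn : ∀ᶠ n in atTop, k n ≤ n) (s : Bool) :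
    BlockLLN μ θ₁ θ₂ kstar k Y P₁ P₂ s (fracBefore κ τ s) (fracAfter κ τ s) := by
  intro Φ₁ Φ₂ hm₁ hm₂ hi₁ hi₂ δ hδ
  cases s with
  | true =>
    exact sum_regimeVal_lln he hs₁ hs₂ hy₁ hy₂ hτ₀ hτ₁ hk hY hm₁ hm₂ hP₁ hP₂ hi₁ hi₂ hb hκ hκτ
      hkn hδ
  | false =>
    have h1 := sum_regimeVal_lln he hs₁ hs₂ hy₁ hy₂ hτ₀ hτ₁ hk hY hm₁ hm₂ hP₁ hP₂ hi₁ hi₂ hb hκ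
      hκτ hkn (δ := δ / 2) (by positivity)
    have hone : Tendsto (fun n : ℕ => ((id n : ℕ) : ℝ) / n) atTop (𝓝 1) := by
      refine tendsto_const_nhds.congr' ?_
      filter_upwards [eventually_gt_atTop 0] with n hn
      have : (n : ℝ) ≠ 0 := by exact_mod_cast hn.ne'
      simp [this]
    have h2 := sum_regimeVal_lln he hs₁ hs₂ hy₁ hy₂ hτ₀ hτ₁ hk hY hm₁ hm₂ hP₁ hP₂ hi₁ hi₂ hone
      one_pos hτ₁.ne' (Eventually.of_forall fun n => le_rfl) (δ := δ / 2) (by positivity)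
    refine (h1.and h2).mono ?_
    filter_upwards [hkn] with n hn
    refine Eventually.of_forall fun ω hω => ?_
    simp only [block, fracBefore, fracAfter, Bool.false_eq_true, if_false]
    rw [sum_Icc_succ_eq_sub _ hn]
    have h3 := hω.1
    have h4 := hω.2
    rw [min_eq_right hτ₁.le, max_eq_left (by linarith : (0 : ℝ) ≤ 1 - τ), id] at h4
    rw [abs_le] at h3 h4 ⊢
    constructor <;> nlinarith [h3.1, h3.2, h4.1, h4.2]

/-- If at `β₀` the moment function has a mean with a positive component over one of the blocks,
then the likelihood ratio diverges uniformly in a neighbourhood of `β₀`. -/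
lemma exists_ball_whp_le_logELR {w : (Fin p → ℝ) → ℝ} (φ : (Fin p → ℝ) → (Fin q → ℝ))
    (hw : Measurable w) {π₁ π₂ : Measure (Fin p → ℝ)} [IsProbabilityMeasure π₁]
    [IsProbabilityMeasure π₂] {ε : Measure ℝ} [IsProbabilityMeasure ε] [NullSingletonClass ε]
    {s : Bool} {a b : ℝ} (ha : 0 ≤ a) (hb : 0 ≤ b)
    (hL : BlockLLN μ θ₁ θ₂ kstar k Y (π₁.prod ε) (π₂.prod ε) s a b) {β₀ d : Fin p → ℝ}
    (hQ₁ : Integrable (fun x => (w x * (x ⬝ᵥ d)) ^ 2) π₁)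
    (hQ₂ : Integrable (fun x => (w x * (x ⬝ᵥ d)) ^ 2) π₂)
    (hpos : 0 < a * ∫ q, score w θ₁ β₀ d q ∂(π₁.prod ε) + b * ∫ q, score w θ₂ β₀ d q ∂(π₂.prod ε))
    (hk : ∀ᶠ n in atTop, 0 < k n ∧ k n < n) :
    ∃ δ : ℝ, 0 < δ ∧ ∀ R : ℝ, Whp μ fun n ω => ∀ β : Fin p → ℝ, ‖β - β₀‖ ≤ δ →
      (R : EReal) ≤ logELR (fun β (t : ℕ) => moment w φ (fun s => Y n s ω) (t : ℤ) β) n (k n)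
        β β := by
  set m := a * ∫ q, score w θ₁ β₀ d q ∂(π₁.prod ε) + b * ∫ q, score w θ₂ β₀ d q ∂(π₂.prod ε)
    with hm
  have hosc := ((tendsto_integral_scoreOsc (ε := ε) hw hQ₁ θ₁ β₀).const_mul a).add
    ((tendsto_integral_scoreOsc (ε := ε) hw hQ₂ θ₂ β₀).const_mul b)
  simp only [mul_zero, add_zero] at hosc
  obtain ⟨N, hN⟩ := (hosc.eventually_lt_const (show (0 : ℝ) < m / 2 by positivity)).exists
  set δ : ℝ := 1 / ((N : ℝ) + 1) with hδ
  have hδ0 : 0 < δ := by positivity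
  refine ⟨δ, hδ0, fun R => ?_⟩
  -- the lower bounds for the components of the moment function on the ball
  have h1 := hL (fun q => score w θ₁ β₀ d q - scoreOsc w θ₁ β₀ d δ q)
    (fun q => score w θ₂ β₀ d q - scoreOsc w θ₂ β₀ d δ q)
    ((measurable_score hw _ _ _).sub (measurable_scoreOsc hw _ _ _ _))
    ((measurable_score hw _ _ _).sub (measurable_scoreOsc hw _ _ _ _))
    ((integrable_score hw hQ₁ _ _).sub (integrable_scoreOsc hw hQ₁ _ _ _))
    ((integrable_score hw hQ₂ _ _).sub (integrable_scoreOsc hw hQ₂ _ _ _)) (m / 4) (by positivity)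
  rw [integral_sub (integrable_score hw hQ₁ _ _) (integrable_scoreOsc hw hQ₁ _ _ _),
    integral_sub (integrable_score hw hQ₂ _ _) (integrable_scoreOsc hw hQ₂ _ _ _)] at h1
  -- the bound for the square sums
  have hQm : Measurable fun q : (Fin p → ℝ) × ℝ => (w q.1 * (q.1 ⬝ᵥ d)) ^ 2 :=
    (measurable_weighted hw d).pow_const 2
  have h2 := hL _ _ hQm hQm (hQ₁.comp_fst ε) (hQ₂.comp_fst ε) 1 one_pos
  set I₁ := ∫ q : (Fin p → ℝ) × ℝ, (w q.1 * (q.1 ⬝ᵥ d)) ^ 2 ∂(π₁.prod ε)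
  set I₂ := ∫ q : (Fin p → ℝ) × ℝ, (w q.1 * (q.1 ⬝ᵥ d)) ^ 2 ∂(π₂.prod ε)
  have hI₁ : 0 ≤ I₁ := integral_nonneg fun q => sq_nonneg _
  have hI₂ : 0 ≤ I₂ := integral_nonneg fun q => sq_nonneg _
  set C := a * I₁ + b * I₂ + 1 with hC
  have hC0 : 0 < C := by positivity
  have hlim : Tendsto (fun n : ℕ => m / 4 / (2 * √C) * √(n : ℝ) - 1 / 4) atTop atTop := by
    refine tendsto_atTop_add_const_right _ _ (Tendsto.const_mul_atTop ?_ ?_)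
    · have := Real.sqrt_pos.2 hC0
      positivity
    · exact Real.tendsto_sqrt_atTop.comp tendsto_natCast_atTop_atTop
  refine (h1.and h2).mono ?_
  filter_upwards [hk, hlim.eventually_ge_atTop R] with n hkn hR
  refine Eventually.of_forall fun ω hω β hβ => ?_
  have hn : (0 : ℝ) < n := by exact_mod_cast (show 0 < n by omega)
  refine le_trans (EReal.coe_le_coe_iff.2 hR) (le_logELR hkn.1 hkn.2 hC0 (lagForm q d)
    (s := block s (k n) n) (by cases s <;> simp [block]) ?_ ?_)
  · calc m / 4 * n ≤ ∑ t ∈ block s (k n) n, regimeVal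
          (fun q => score w θ₁ β₀ d q - scoreOsc w θ₁ β₀ d δ q)
          (fun q => score w θ₂ β₀ d q - scoreOsc w θ₂ β₀ d δ q) θ₁ θ₂ (kstar n)
          (fun s => Y n s ω) t := by
          have h3 := (abs_le.1 hω.1).1
          have h4 : m / 2 ≤ a * (∫ q, score w θ₁ β₀ d q ∂(π₁.prod ε) -
              ∫ q, scoreOsc w θ₁ β₀ d δ q ∂(π₁.prod ε)) + b * (∫ q, score w θ₂ β₀ d q ∂(π₂.prod ε) -
              ∫ q, scoreOsc w θ₂ β₀ d δ q ∂(π₂.prod ε)) := by linarith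
          have h5 := mul_le_mul_of_nonneg_left h4 hn.le
          linarith
      _ ≤ _ := by
          refine Finset.sum_le_sum fun t _ => ?_
          rw [regimeVal]
          split_ifs
          · rw [lagForm_moment w φ _ _ θ₁]
            exact score_sub_scoreOsc_le hβ _
          · rw [lagForm_moment w φ _ _ θ₂]
            exact score_sub_scoreOsc_le hβ _
  · calc _ ≤ ∑ t ∈ block s (k n) n, regimeVal
          (fun q : (Fin p → ℝ) × ℝ => (w q.1 * (q.1 ⬝ᵥ d)) ^ 2)
          (fun q : (Fin p → ℝ) × ℝ => (w q.1 * (q.1 ⬝ᵥ d)) ^ 2) θ₁ θ₂ (kstar n)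
          (fun s => Y n s ω) t := by
          refine Finset.sum_le_sum fun t _ => ?_
          rw [regimeVal]
          split_ifs
          · rw [lagForm_moment w φ _ _ θ₁]
            exact score_sq_le _ _ _ _ _
          · rw [lagForm_moment w φ _ _ θ₂]
            exact score_sq_le _ _ _ _ _
      _ ≤ C * n := by
          have h3 := (abs_le.1 hω.2).2
          rw [hC]
          linarith

end

/-- Whatever `β` is, over one of the two blocks the moment function at `β` has a non-zero mean. If
`κ < τ` the first block belongs to `θ₁` alone, which excludes all `β ≠ θ₁`, and `β = θ₁` is excluded
by the part of the second block after the change; if `τ < κ` the roles are exchanged. -/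
lemma exists_block_pos {w : (Fin p → ℝ) → ℝ} (hw : Measurable w) (hw0 : ∀ x, 0 < w x)
    {π₁ π₂ : Measure (Fin p → ℝ)} [IsProbabilityMeasure π₁] [IsProbabilityMeasure π₂]
    {ε : Measure ℝ} [IsProbabilityMeasure ε]
    (hQ₁ : ∀ d, Integrable (fun x => (w x * (x ⬝ᵥ d)) ^ 2) π₁)
    (hQ₂ : ∀ d, Integrable (fun x => (w x * (x ⬝ᵥ d)) ^ 2) π₂)
    (hF0 : ε.real (Set.Iic 0) = 1 / 2) (hF : ∀ z ≠ 0, 0 < (ε.real (Set.Iic z) - 1 / 2) * z)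
    (hd₁ : ∀ d ≠ 0, ¬ ∀ᵐ x ∂π₁, x ⬝ᵥ d = 0) (hd₂ : ∀ d ≠ 0, ¬ ∀ᵐ x ∂π₂, x ⬝ᵥ d = 0)
    {θ₁ θ₂ : Fin p → ℝ} (hne : θ₁ ≠ θ₂) {κ τ : ℝ} (hκ₀ : 0 < κ) (hκ₁ : κ < 1) (hτ₀ : 0 < τ)
    (hτ₁ : τ < 1) (hκτ : κ ≠ τ) (β : Fin p → ℝ) :
    ∃ (s : Bool) (d : Fin p → ℝ), 0 < fracBefore κ τ s * ∫ q, score w θ₁ β d q ∂(π₁.prod ε) +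
      fracAfter κ τ s * ∫ q, score w θ₂ β d q ∂(π₂.prod ε) := by
  have pos₁ : ∀ β, β ≠ θ₁ → 0 < ∫ q, score w θ₁ β (θ₁ - β) q ∂(π₁.prod ε) := fun β hβ =>
    integral_score_pos hw hw0 (hQ₁ _) hF (hd₁ _ (sub_ne_zero.2 hβ.symm))
  have pos₂ : ∀ β, β ≠ θ₂ → 0 < ∫ q, score w θ₂ β (θ₂ - β) q ∂(π₂.prod ε) := fun β hβ =>
    integral_score_pos hw hw0 (hQ₂ _) hF (hd₂ _ (sub_ne_zero.2 hβ.symm))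
  rcases lt_or_gt_of_ne hκτ with h | h
  · by_cases hβ : β = θ₁
    · subst hβ
      refine ⟨false, θ₂ - β, ?_⟩
      rw [integral_score_self hw (hQ₁ _) hF0, mul_zero, zero_add]
      refine mul_pos ?_ (pos₂ _ hne)
      simp only [fracAfter, Bool.false_eq_true, if_false]
      rw [max_eq_right (by linarith)]
      linarith
    · refine ⟨true, θ₁ - β, ?_⟩
      simp only [fracBefore, fracAfter, if_true]
      rw [max_eq_right (by linarith), zero_mul, add_zero, min_eq_left h.le]
      exact mul_pos hκ₀ (pos₁ _ hβ)
  · by_cases hβ : β = θ₂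
    · subst hβ
      refine ⟨true, θ₁ - β, ?_⟩
      rw [integral_score_self hw (hQ₂ _) hF0, mul_zero, add_zero]
      refine mul_pos ?_ (pos₁ _ hne.symm)
      simp only [fracBefore, if_true]
      exact lt_min hκ₀ hτ₀
    · refine ⟨false, θ₂ - β, ?_⟩
      simp only [fracBefore, fracAfter, Bool.false_eq_true, if_false]
      rw [max_eq_left (by linarith), min_eq_right h.le, sub_self, zero_mul, zero_add]
      exact mul_pos (by linarith) (pos₂ _ hβ)

lemma fracBefore_nonneg {κ τ : ℝ} (hκ : 0 ≤ κ) (hτ : 0 ≤ τ) (s : Bool) : 0 ≤ fracBefore κ τ s := by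
  cases s
  · simp [fracBefore]
  · simp [fracBefore, hκ, hτ]

lemma fracAfter_nonneg {κ τ : ℝ} (hκ : κ ≤ 1) (hτ : τ ≤ 1) (s : Bool) : 0 ≤ fracAfter κ τ s := by
  cases s
  · simp only [fracAfter, Bool.false_eq_true, if_false, sub_nonneg, max_le_iff]
    constructor <;> linarith
  · simp [fracAfter]

/-- If the likelihood ratio diverges locally uniformly at the candidate `k n`, then it diverges
uniformly over the compact parameter space. -/
lemma whp_le_logELR_of_isCompact {μ : Measure Ω} {w : (Fin p → ℝ) → ℝ}
    {φ : (Fin p → ℝ) → (Fin q → ℝ)} {B : Set (Fin p → ℝ)} (hB : IsCompact B) {k : ℕ → ℕ}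
    {Y : ℕ → ℤ → Ω → ℝ} {R : ℝ}
    (h : ∀ β₀ : Fin p → ℝ, ∃ δ : ℝ, 0 < δ ∧ Whp μ fun n ω => ∀ β : Fin p → ℝ, ‖β - β₀‖ ≤ δ →
      (R : EReal) ≤ logELR (fun β (t : ℕ) => moment w φ (fun s => Y n s ω) (t : ℤ) β) n (k n)
        β β) :
    Whp μ fun n ω => ∀ β ∈ B,
      (R : EReal) ≤ logELR (fun β (t : ℕ) => moment w φ (fun s => Y n s ω) (t : ℤ) β) n (k n)
        β β := by
  refine hB.induction_on (p := fun S => Whp μ fun n ω => ∀ β ∈ S,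
      (R : EReal) ≤ logELR (fun β (t : ℕ) => moment w φ (fun s => Y n s ω) (t : ℤ) β) n (k n)
        β β) ?_ ?_ ?_ ?_
  · simp [Whp]
  · exact fun S T hST hT => hT.mono (Eventually.of_forall fun n =>
      Eventually.of_forall fun ω hω β hβ => hω β (hST hβ))
  · exact fun S T hS hT => (hS.and hT).mono (Eventually.of_forall fun n =>
      Eventually.of_forall fun ω hω β hβ => hβ.elim (hω.1 β) (hω.2 β))
  · intro β₀ _
    obtain ⟨δ, hδ, h1⟩ := h β₀
    refine ⟨Metric.closedBall β₀ δ, mem_nhdsWithin_of_mem_nhds (Metric.closedBall_mem_nhds _ hδ),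
      h1.mono (Eventually.of_forall fun n => Eventually.of_forall fun ω hω β hβ => hω β ?_)⟩
    rwa [Metric.mem_closedBall, dist_eq_norm] at hβ

/-- A statistic that exceeds every level with probability tending to one also exceeds critical
values that are bounded in probability. -/
lemma tendsto_measure_lt_of_boundedInProb {μ : Measure Ω} [IsProbabilityMeasure μ]
    {T : ℕ → Ω → EReal} (hT : ∀ M : ℝ, Tendsto (fun n => μ {ω | T n ω ≤ (M : EReal)}) atTop (𝓝 0))
    {c : ℕ → Ω → ℝ} (hc : BoundedInProb μ c) :
    Tendsto (fun n => μ {ω | ((c n ω : ℝ) : EReal) < T n ω}) atTop (𝓝 1) := by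
  have hcompl : Tendsto (fun n => μ {ω | T n ω ≤ ((c n ω : ℝ) : EReal)}) atTop (𝓝 0) := by
    rw [ENNReal.tendsto_nhds_zero]
    intro η hη
    have hη2 : 0 < η / 2 := by simp [hη.ne']
    obtain ⟨M, hM⟩ := hc (η / 2) hη2
    filter_upwards [hM, ENNReal.tendsto_nhds_zero.1 (hT M) _ hη2] with n h1 h2
    calc μ {ω | T n ω ≤ ((c n ω : ℝ) : EReal)}
        ≤ μ ({ω | T n ω ≤ (M : EReal)} ∪ {ω | M < |c n ω|}) := by
          refine measure_mono fun ω hω => ?_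
          by_cases hcω : M < |c n ω|
          · exact Or.inr hcω
          · refine Or.inl (le_trans hω (EReal.coe_le_coe_iff.2 ?_))
            exact (le_abs_self _).trans (not_lt.1 hcω)
      _ ≤ η / 2 + η / 2 := (measure_union_le _ _).trans (add_le_add h2 h1)
      _ = η := ENNReal.add_halves η
  have hlow := ENNReal.Tendsto.sub (tendsto_const_nhds (x := (1 : ℝ≥0∞))) hcompl
    (Or.inl ENNReal.one_ne_top)
  rw [tsub_zero] at hlow
  refine tendsto_of_tendsto_of_tendsto_of_le_of_le hlow tendsto_const_nhds (fun n => ?_)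
    fun n => prob_le_one
  rw [tsub_le_iff_right, ← measure_univ (μ := μ)]
  refine le_trans (measure_mono fun ω _ => ?_) (measure_union_le _ _)
  exact lt_or_ge ((c n ω : ℝ) : EReal) (T n ω)

end

end ARChange

theorem theorem3p3 {Ω : Type*} [MeasurableSpace Ω] (μ : Measure Ω) [IsProbabilityMeasure μ]
    {p q : ℕ}
    (e : ℤ → Ω → ℝ) (f : ℝ → ℝ) (he : ARChange.Innovations μ e f)
    (B : Set (Fin p → ℝ)) (hB : ARChange.ParameterSpace B)
    (w : (Fin p → ℝ) → ℝ) (hw : Measurable w) (hw_pos : ∀ x, 0 < w x)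
    (φ : (Fin p → ℝ) → (Fin q → ℝ)) (hφ : Measurable φ)
    (θ₁ θ₂ : Fin p → ℝ) (hθ₁ : θ₁ ∈ interior B) (hθ₂ : θ₂ ∈ interior B) (hne : θ₁ ≠ θ₂)
    (y₁ y₂ : ℤ → Ω → ℝ)
    (hy₁ : ARChange.IsStationaryAR μ e θ₁ y₁) (hy₂ : ARChange.IsStationaryAR μ e θ₂ y₂)
    (hm₁ : ARChange.MomentMixing μ e w φ θ₁ y₁) (hm₂ : ARChange.MomentMixing μ e w φ θ₂ y₂)
    (r₁ r₂ : ℝ) (hr₁ : 0 < r₁) (hr : r₁ < r₂) (hr₂ : r₂ < 1)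
    (h : ℝ → ℝ) (hh_bdd : BddAbove ((fun r => h r ^ 2) '' Set.Ioo 0 1))
    (hh_pos : ∃ c : ℝ, 0 < c ∧ ∀ r ∈ Set.Icc r₁ r₂, c ≤ h r)
    (kstar : ℕ → ℕ) (τ : ℝ) (hτ₀ : 0 < τ) (hτ₁ : τ < 1)
    (hk : Tendsto (fun n : ℕ => (kstar n : ℝ) / n) atTop (𝓝 τ))
    (Y : ℕ → ℤ → Ω → ℝ)
    (hY : ∀ n, ARChange.IsChangeSeries μ e θ₁ θ₂ y₁ n (kstar n) (Y n)) :
    (∀ M : ℝ, Tendsto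
      (fun n : ℕ => μ {ω | ARChange.statT w φ B h r₁ r₂ n (fun t => Y n t ω) ≤ (M : EReal)})
      atTop (𝓝 0)) ∧
    (∀ c : ℕ → Ω → ℝ, ARChange.BoundedInProb μ c → Tendsto
      (fun n : ℕ => μ {ω | ((c n ω : ℝ) : EReal) <
        ARChange.statT w φ B h r₁ r₂ n (fun t => Y n t ω)})
      atTop (𝓝 1)) := by
  have hdiv : ∀ M : ℝ, Tendsto
      (fun n : ℕ => μ {ω | ARChange.statT w φ B h r₁ r₂ n (fun t => Y n t ω) ≤ (M : EReal)})
      atTop (𝓝 0) := by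
    have hprob := he.isProbabilityMeasure
    have hnull := he.nullSingletonClass
    -- a candidate fraction in the trimmed range that differs from the true one
    obtain ⟨κ, ⟨hκ₁, hκ₂⟩, hκτ⟩ := (Set.Ioo_infinite hr).nontrivial.exists_ne τ
    have hκ0 : 0 < κ := hr₁.trans hκ₁
    have hκ1 : κ < 1 := hκ₂.trans hr₂
    set k : ℕ → ℕ := fun n => ⌊κ * n⌋₊ with hkdef
    have hkl : Tendsto (fun n => (k n : ℝ) / n) atTop (𝓝 κ) :=
      (tendsto_nat_floor_mul_div_atTop hκ0.le).comp tendsto_natCast_atTop_atTop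
    have hkr : ∀ᶠ n : ℕ in atTop, 0 < n ∧ r₁ * n ≤ k n ∧ (k n : ℝ) ≤ r₂ * n := by
      filter_upwards [eventually_gt_atTop 0, hkl.eventually_const_lt hκ₁,
        hkl.eventually_lt_const hκ₂] with n hn h1 h2
      have hn' : (0 : ℝ) < n := by exact_mod_cast hn
      exact ⟨hn, ((lt_div_iff₀ hn').1 h1).le, ((div_lt_iff₀ hn').1 h2).le⟩
    have hkn : ∀ᶠ n in atTop, 0 < k n ∧ k n < n := by
      filter_upwards [hkr] with n hn
      have hn' : (0 : ℝ) < n := by exact_mod_cast hn.1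
      constructor
      · have : (0 : ℝ) < k n := lt_of_lt_of_le (by positivity) hn.2.1
        exact_mod_cast this
      · have : (k n : ℝ) < n := lt_of_le_of_lt hn.2.2 (by nlinarith)
        exact_mod_cast this
    -- the distribution function of the innovations
    have hIic : ∀ t, (volume.withDensity fun x => ENNReal.ofReal (f x)).real (Set.Iic t) =
        μ.real {ω | e 0 ω ≤ t} := fun t => by
      rw [← he.law 0, map_measureReal_apply (he.measurable 0) measurableSet_Iic]; rfl
    have hIci : (volume.withDensity fun x => ENNReal.ofReal (f x)).real (Set.Ici 0) =
        μ.real {ω | 0 ≤ e 0 ω} := by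
      rw [← he.law 0, map_measureReal_apply (he.measurable 0) measurableSet_Ici]; rfl
    have hF0 := ARChange.real_Iic_zero_eq_half ((he.median_le 0).trans_eq (hIic 0).symm)
      ((he.median_ge 0).trans_eq hIci.symm)
    have hcdf := he.hasDerivAt_cdf 0
    rw [he.law 0] at hcdf
    have hF : ∀ z ≠ 0, 0 < ((volume.withDensity fun x => ENNReal.ofReal (f x)).real (Set.Iic z) -
        1 / 2) * z := fun z hz => ARChange.cdf_sub_half_mul_pos hF0 hcdf he.density_pos hz
    -- the stationary laws of the two regimes
    have hX : ∀ y : ℤ → Ω → ℝ, (∀ t, Measurable (y t)) → IsProbabilityMeasure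
        (μ.map fun ω => ARChange.lag p (fun s => y s ω) 1) := fun y hy =>
      Measure.isProbabilityMeasure_map (measurable_pi_lambda _ fun j => hy _).aemeasurable
    have hπ₁ := hX y₁ hy₁.measurable
    have hπ₂ := hX y₂ hy₂.measurable
    have hQ₁ := hm₁.integrable_sq hw hw_pos hy₁.measurable
    have hQ₂ := hm₂.integrable_sq hw hw_pos hy₂.measurable
    have hblock := ARChange.blockLLN he (hB.stable θ₁ (interior_subset hθ₁))
      (hB.stable θ₂ (interior_subset hθ₂)) hy₁ hy₂ hτ₀ hτ₁ hk hY rfl rfl hkl hκ0 hκτ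
      (hkn.mono fun n hn => hn.2.le)
    intro M
    obtain ⟨c, hc, hch⟩ := hh_pos
    obtain ⟨R, hR0, hRM⟩ : ∃ R : ℝ, 0 ≤ R ∧ M < 2 * (c * R) := by
      refine ⟨(|M| + 1) / (2 * c), by positivity, ?_⟩
      have : 2 * (c * ((|M| + 1) / (2 * c))) = |M| + 1 := by field_simp
      rw [this]
      linarith [le_abs_self M]
    have hW := ARChange.whp_le_logELR_of_isCompact (μ := μ) (w := w) (φ := φ) (k := k) (Y := Y)
      (R := R) hB.compact fun β₀ => by
        obtain ⟨s, d, hpos⟩ := ARChange.exists_block_pos hw hw_pos hQ₁ hQ₂ hF0 hF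
          (fun d hd => hm₁.not_ae_dotProduct_eq_zero hw hw_pos hφ hy₁.measurable hd)
          (fun d hd => hm₂.not_ae_dotProduct_eq_zero hw hw_pos hφ hy₂.measurable hd)
          hne hκ0 hκ1 hτ₀ hτ₁ hκτ β₀
        obtain ⟨δ, hδ, hδR⟩ := ARChange.exists_ball_whp_le_logELR φ hw
          (ARChange.fracBefore_nonneg hκ0.le hτ₀.le s) (ARChange.fracAfter_nonneg hκ1.le hτ₁.le s)
          (hblock s) (hQ₁ d) (hQ₂ d) hpos hkn
        exact ⟨δ, hδ, hδR R⟩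
    have hgt : ARChange.Whp μ fun n ω =>
        ¬ ARChange.statT w φ B h r₁ r₂ n (fun t => Y n t ω) ≤ (M : EReal) := by
      refine hW.mono ?_
      filter_upwards [hkr] with n hn
      refine Eventually.of_forall fun ω hω => not_le.2 ?_
      have hn' : (0 : ℝ) < n := by exact_mod_cast hn.1
      refine lt_of_lt_of_le (EReal.coe_lt_coe_iff.2 hRM)
        (ARChange.le_statT hn.2.1 hn.2.2 hc.le hR0 (hch _ ⟨?_, ?_⟩) hω)
      · rw [le_div_iff₀ hn']; exact hn.2.1
      · rw [div_le_iff₀ hn']; exact hn.2.2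
    simpa only [ARChange.Whp, not_not] using hgt
  exact ⟨hdiv, fun c hc => ARChange.tendsto_measure_lt_of_boundedInProb hdiv hc⟩
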